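/- \textbf{Key Lemma for critical branching random walks.} Let $\mu$ be a probability law on $\mathbb N$ with $\sum_k k\mu(k)=1$ (offspring law) and $\mathcal P$ a probability law on $\mathbb R^d$ (motion law). Let $\mathbf P$ be the law of the branching random walk started from one particle at $0$: each particle independently has a $\mu$-distributed number of children, and each child is displaced from its parent by an independent $\mathcal P$-distributed jump. Write $|u|$ and $S_u$ for the generation and the position of a particle $u$, $\rho_u$ for its displacement from its parent, and $Z_n(B)$ for the number of particles of generation $n$ in $B$. We consider three cases. \begin{itemize} \item $\mathcal H_1$: $d\ge 3$, $\mathcal P$ is the standard Gaussian law on $\mathbb R^d$, $\sum_k k^2\mu(k)<\infty$; put $\Sigma=I_d$. \item $\mathcal H_2$: $d\ge3$, $\mathcal P=\sum_{z\in\mathcal R}p(z)\delta_z$ with $\mathcal R\subset\mathbb Z^d$ finite, $\mathcal R=-\mathcal R$ and $p(-z)=p(z)$; the covariance matrix $\Sigma$ of $\mathcal P$ is positive definite; the random walk $\hat S$ started from $0$ with step law $\mathcal P$ is aperiodic on $\mathbb Z^d$, i.e. for every $z\in\mathbb Z^d$, $\mathbb P(\hat S_n=z)>0$ for all large $n$;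 and $\sum_k k^2\mu(k)<\infty$. \item $\mathcal H_3$: for some $\alpha\in(0,2)$, $\int e^{i\langle y,x\rangle}\mathcal P(dx)=e^{-\|y\|^\alpha}$ for all $y\in\mathbb R^d$, and there is $\beta\in(0,1]$ with $d>\alpha/\beta$ and $\sum_k k^{1+\gamma}\mu(k)<\infty$ for every $0<\gamma<\beta$. \end{itemize} \emph{The constant $I_{A,f}$.} Let $\mathbf Q^*$ be the law of the size-biased branching random walk with spine $(w_n)_{n\ge0}$: $w_0$ is the ancestor, located at $0$; $w_n$ has $k$ children with probability $\nu(k)=k\mu(k)$, and $w_{n+1}$ is one of them, chosen uniformly; all other particles have $\mu$-distributed numbers of children; all displacements have law $\mathcal P$; all these choices are independent. Let $B(w_{k+1})$ be the set of children of $w_k$ other than $w_{k+1}$. For a particle $u$ let $\mathcal Z^u_j$ be the set of its descendants $j$ generations after it and $S^u_v=S_v-S_u$ for $v\in\mathcal Z^u_j$. For $k\ge1$ and $z\in\mathbb R^d$ put $$\tilde Y_k(z)=\sum_{u\in B(w_{k+1})}\#\{v\in\mathcal Z^u_{k-1}: z+\rho_u+S^u_v\in A\},\qquad \tilde Y_{f,k}(z)=\sum_{u\in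 B(w_{k+1})}\ \sum_{v\in\mathcal Z^u_{k-1}}f(z+\rho_u+S^u_v),$$ and $\tilde Y_{f,0}(z)=f(z)$. Define $$G_{A,f}(y)=\mathbb E_{\mathbf Q^*}\!\left[\frac{\exp\left(\sum_{k\ge0}\tilde Y_{f,k}(y-S_{w_k})\right)}{1+\sum_{k\ge1}\tilde Y_k(y-S_{w_k})}\right],$$ and $I_{A,f}=\int_A G_{A,f}(y)\,dy$ under $\mathcal H_1$ and $\mathcal H_3$, $I_{A,f}=\sum_{y\in A\cap\mathbb Z^d}G_{A,f}(y)$ under $\mathcal H_2$. \emph{Statement.} Let $A$ be a Euclidean closed ball of positive radius, which under $\mathcal H_2$ is assumed to contain a point of $\mathbb Z^d$. Let $f:\mathbb R^d\to\mathbb C$ be continuous with $\mathrm{supp}(f)\subset A$ and values in $\mathbb R_-\cup i\mathbb R$, and let $M>0$. Put $$E_n(x)=\mathbb E_{\mathbf P}\Big[\mathbf 1\{Z_n(A-x)\ge1\}\exp\Big(\sum_{|u|=n}f(S_u+x)\Big)\Big].$$ (1) Under $\mathcal H_1$, uniformly over $x\in\mathbb R^d$ with $\|x\|\le M\sqrt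 n$, and under $\mathcal H_2$, uniformly over $x\in\mathbb Z^d$ with $\|x\|\le M\sqrt n$, as $n\to\infty$, $$E_n(x)=(2\pi n)^{-d/2}\det(\Sigma)^{-1/2}\exp\Big(-\frac1{2n}\langle x,\Sigma^{-1}x\rangle\Big)\,\big(I_{A,f}+o(1)\big).$$ (2) Under $\mathcal H_3$, $\mathcal P$ has a continuous density $L_\alpha\ge0$, and, uniformly over $x\in\mathbb R^d$ with $\|x\|\le Mn^{1/\alpha}$, as $n\to\infty$, $$E_n(x)=n^{-d/\alpha}L_\alpha\big(x/n^{1/\alpha}\big)\,\big(I_{A,f}+o(1)\big).$$ In all cases, if $f$ takes values in $\mathbb R_-$ or if $I_{A,f}\ne0$, the factor $I_{A,f}+o(1)$ can be replaced by $(1+o(1))\,I_{A,f}$, still uniformly in $x$. -/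

import Mathlib

open MeasureTheory ProbabilityTheory Filter Topology
open scoped ENNReal NNReal Matrix

noncomputable section

namespace BRW

abbrev E (d : ℕ) := EuclideanSpace ℝ (Fin d)

/-! ### Marked trees and the critical branching random walk -/

/-- Labels of particles. The root is `[]` and the `i`-th child of `u` (with `i = 0, 1, …`) is
`i :: u`, so the generation `|u|` is the length of the list and the parent is the tail. -/
abbrev Label := List ℕ

/-- A label `u` carries the number `N_u` of its children and the displacement `ρ_u` of `u` from
its parent. The mark of a label that is not in the genealogical tree plays no role. -/
abbrev MarkedTree (d : ℕ) := Label → ℕ × E d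

/-- The labels of the particles alive in generation `n`. -/
def gen {d : ℕ} (T : MarkedTree d) : ℕ → Finset Label
  | 0 => {[]}
  | n + 1 => (gen T n).biUnion fun u => (Finset.range (T u).1).image fun i => i :: u

/-- The position `S_u` (the ancestor is located at `0`). -/
def pos {d : ℕ} (T : MarkedTree d) : Label → E d
  | [] => 0
  | i :: u => pos T u + (T (i :: u)).2

open Classical in
/-- `Z_n(B)`: the number of particles of generation `n` located in `B`. -/
def count {d : ℕ} (T : MarkedTree d) (n : ℕ) (B : Set (E d)) : ℕ :=
  ((gen T n).filter fun u => pos T u ∈ B).card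

/-- `∑_{|u| = n} g(S_u)`. -/
def sumOver {d : ℕ} (T : MarkedTree d) (n : ℕ) (g : E d → ℂ) : ℂ :=
  ∑ u ∈ gen T n, g (pos T u)

/-- The tree of the descendants of `u`, with positions relative to `S_u`. -/
def subtree {d : ℕ} (T : MarkedTree d) (u : Label) : MarkedTree d := fun v => T (v ++ u)

/-- The law `𝐏` of the branching random walk started from one particle at `0`: all the `N_u` have
the offspring law `μ`, all the `ρ_u` have the motion law `P`, and they are independent. -/
def treeLaw {d : ℕ} (μ : PMF ℕ) (P : Measure (E d)) [IsProbabilityMeasure P] :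
    Measure (MarkedTree d) :=
  Measure.infinitePi fun _ : Label => μ.toMeasure.prod P

/-- `E_𝐏 [1{Z_n(A - x) ≥ 1} exp (∑_{|u| = n} f(S_u + x))]`. -/
def keyExpectation {d : ℕ} (μ : PMF ℕ) (P : Measure (E d)) [IsProbabilityMeasure P]
    (A : Set (E d)) (f : E d → ℂ) (n : ℕ) (x : E d) : ℂ :=
  ∫ T, (if 1 ≤ count T n {s | s + x ∈ A} then 1 else 0) *
    Complex.exp (sumOver T n fun s => f (s + x)) ∂(treeLaw μ P)

/-! ### The size-biased tree with a spine -/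

/-- Criticality: the offspring law has mean `1`. -/
def Critical (μ : PMF ℕ) : Prop := ∑' k : ℕ, (k : ℝ≥0∞) * μ k = 1

/-- The size-biased offspring law `ν(k) = k μ(k)`. -/
def sizeBiased (μ : PMF ℕ) (hμ : Critical μ) : PMF ℕ :=
  ⟨fun k => (k : ℝ≥0∞) * μ k, hμ ▸ ENNReal.summable.hasSum⟩

/-- The joint law of the number `k` of children of a spine particle, which has law `ν`, and of the
index of the next spine particle, which is uniform among the `k` children. (The value `k = 0` has
probability `0` under `ν`.) -/
def spineStep (μ : PMF ℕ) (hμ : Critical μ) : PMF (ℕ × ℕ) :=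
  (sizeBiased μ hμ).bind fun k =>
    if h : (Finset.range k).Nonempty then
      (PMF.uniformOfFinset (Finset.range k) h).map fun j => (k, j)
    else PMF.pure (k, 0)

/-- The randomness of the size-biased process: marks for all the labels, and for every `n` the
number of children of the spine particle `w_n` with the index of `w_{n+1}` among them. -/
abbrev SpineSpace (d : ℕ) := MarkedTree d × (ℕ → ℕ × ℕ)

/-- The spine `w_0, w_1, w_2, …`. -/
def spine {d : ℕ} (ω : SpineSpace d) : ℕ → Label
  | 0 => []
  | n + 1 => (ω.2 n).2 :: spine ω n

/-- The size-biased tree: the spine particles use their own offspring numbers, all other particles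
use the original ones. -/
def spineTree {d : ℕ} (ω : SpineSpace d) : MarkedTree d := fun u =>
  (if u = spine ω u.length then (ω.2 u.length).1 else (ω.1 u).1, (ω.1 u).2)

/-- The law `𝐐*` of the size-biased branching random walk with its spine. -/
def spineLaw {d : ℕ} (μ : PMF ℕ) (hμ : Critical μ) (P : Measure (E d)) [IsProbabilityMeasure P] :
    Measure (SpineSpace d) :=
  (treeLaw μ P).prod (Measure.infinitePi fun _ : ℕ => (spineStep μ hμ).toMeasure)

/-- The position `S_{w_k}` of the spine. -/
def spinePos {d : ℕ} (ω : SpineSpace d) (k : ℕ) : E d := pos (spineTree ω) (spine ω k)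

/-- The brothers `B(w_{k+1})` of `w_{k+1}`: the children of `w_k` other than `w_{k+1}`. -/
def brothers {d : ℕ} (ω : SpineSpace d) (k : ℕ) : Finset Label :=
  ((Finset.range (spineTree ω (spine ω k)).1).image fun i => i :: spine ω k).erase
    (spine ω (k + 1))

/-- `Ỹ_k(z) = ∑_{u ∈ B(w_{k+1})} Z^u_{k-1}(A - z - ρ_u)`, used for `k ≥ 1`. -/
def Ytilde {d : ℕ} (A : Set (E d)) (ω : SpineSpace d) (k : ℕ) (z : E d) : ℕ :=
  ∑ u ∈ brothers ω k,
    count (subtree (spineTree ω) u) (k - 1) {s | z + (spineTree ω u).2 + s ∈ A}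

/-- `Ỹ_{f,0}(z) = f(z)`, and for `k ≥ 1`
`Ỹ_{f,k}(z) = ∑_{u ∈ B(w_{k+1})} ∑_{v ∈ 𝒵^u_{k-1}} f(z + ρ_u + S^u_v)`. -/
def Yftilde {d : ℕ} (f : E d → ℂ) (ω : SpineSpace d) : ℕ → E d → ℂ
  | 0, z => f z
  | k + 1, z => ∑ u ∈ brothers ω (k + 1),
      sumOver (subtree (spineTree ω) u) k fun s => f (z + (spineTree ω u).2 + s)

/-- `G_{A,f}(y) = E_{𝐐*} [(1 + ∑_{k ≥ 1} Ỹ_k(y - S_{w_k}))⁻¹ exp (∑_{k ≥ 0} Ỹ_{f,k}(y - S_{w_k}))]`.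
The first series is summed in `[0, ∞]`. Where it is finite, only finitely many of its terms are
nonzero, and then (as `f` vanishes off `A`) the second series has finitely many nonzero terms;
where it is infinite the integrand is `0`. -/
def G {d : ℕ} (μ : PMF ℕ) (hμ : Critical μ) (P : Measure (E d)) [IsProbabilityMeasure P]
    (A : Set (E d)) (f : E d → ℂ) (y : E d) : ℂ :=
  ∫ ω, (((1 + ∑' k : ℕ, (Ytilde A ω (k + 1) (y - spinePos ω (k + 1)) : ℝ≥0∞))⁻¹).toReal : ℂ) *
    Complex.exp (∑' k : ℕ, Yftilde f ω k (y - spinePos ω k)) ∂(spineLaw μ hμ P)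

/-- The point of `ℝ^d` with the given integer coordinates. -/
def latticePt {d : ℕ} (z : Fin d → ℤ) : E d := WithLp.toLp 2 fun i => (z i : ℝ)

/-- `I_{A,f} = ∫_A G_{A,f}(y) dy`, for motion laws on `ℝ^d`. -/
def Icont {d : ℕ} (μ : PMF ℕ) (hμ : Critical μ) (P : Measure (E d)) [IsProbabilityMeasure P]
    (A : Set (E d)) (f : E d → ℂ) : ℂ :=
  ∫ y in A, G μ hμ P A f y

/-- `I_{A,f} = ∑_{y ∈ A ∩ ℤ^d} G_{A,f}(y)`, for motion laws on `ℤ^d` (a finite sum when `A` is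
bounded). -/
def Ilattice {d : ℕ} (μ : PMF ℕ) (hμ : Critical μ) (P : Measure (E d)) [IsProbabilityMeasure P]
    (A : Set (E d)) (f : E d → ℂ) : ℂ :=
  ∑ᶠ (z : Fin d → ℤ) (_ : latticePt z ∈ A), G μ hμ P A f (latticePt z)

/-! ### The hypotheses -/

/-- The covariance matrix of the motion law. -/
def covMat {d : ℕ} (P : Measure (E d)) : Matrix (Fin d) (Fin d) ℝ :=
  Matrix.of fun i j => covariance (fun x : E d => x i) (fun x : E d => x j) P

def FiniteSecondMoment (μ : PMF ℕ) : Prop := ∑' k : ℕ, (k : ℝ≥0∞) ^ 2 * μ k < ∞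

/-- Gaussian motion. -/
structure H1 {d : ℕ} (μ : PMF ℕ) (P : Measure (E d)) : Prop where
  three_le : 3 ≤ d
  gaussian : P = stdGaussian (E d)
  secondMoment : FiniteSecondMoment μ

/-- Symmetric finite-range motion on `ℤ^d`. The random walk `Ŝ` with this motion law is aperiodic
on `ℤ^d`: for each `z ∈ ℤ^d` one has `ℙ(Ŝ_n = z) > 0` for all large `n`. -/
structure H2 {d : ℕ} (μ : PMF ℕ) (P : Measure (E d)) : Prop where
  three_le : 3 ≤ d
  finiteRange : ∃ (R : Finset (Fin d → ℤ)) (p : (Fin d → ℤ) → ℝ≥0),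
    P = ∑ z ∈ R, (p z : ℝ≥0∞) • Measure.dirac (latticePt z) ∧
      ∀ z ∈ R, -z ∈ R ∧ p (-z) = p z
  posDef : (covMat P).PosDef
  aperiodic : ∀ z : Fin d → ℤ, ∀ᶠ n : ℕ in atTop,
    0 < Measure.pi (fun _ : Fin n => P) {ξ | ∑ i, ξ i = latticePt z}
  secondMoment : FiniteSecondMoment μ

/-- Spherically symmetric `α`-stable motion. -/
structure H3 {d : ℕ} (μ : PMF ℕ) (P : Measure (E d)) (α : ℝ) : Prop where
  alpha_pos : 0 < α
  alpha_lt_two : α < 2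
  stable : ∀ y : E d, charFun P y = ((Real.exp (-‖y‖ ^ α) : ℝ) : ℂ)
  moments : ∃ β : ℝ, 0 < β ∧ β ≤ 1 ∧ α / β < d ∧
    ∀ γ : ℝ, 0 < γ → γ < β → ∑' k : ℕ, (k : ℝ≥0∞) ^ (1 + γ) * μ k < ∞

/-- `f` is continuous, supported in `A`, with values in `ℝ_- ∪ iℝ`. -/
structure Admissible {d : ℕ} (A : Set (E d)) (f : E d → ℂ) : Prop where
  continuous : Continuous f
  support : tsupport f ⊆ A
  values : ∀ y, ((f y).im = 0 ∧ (f y).re ≤ 0) ∨ (f y).re = 0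

/-! ### The asymptotic relations -/

/-- `(2πn)^{-d/2} det(S)^{-1/2} exp (-⟨x, S⁻¹ x⟩ / (2n))`. -/
def gaussFactor {d : ℕ} (S : Matrix (Fin d) (Fin d) ℝ) (n : ℕ) (x : E d) : ℝ :=
  (2 * Real.pi * n) ^ (-(d : ℝ) / 2) * S.det ^ (-(1 : ℝ) / 2) *
    Real.exp (-((x : Fin d → ℝ) ⬝ᵥ (S⁻¹ *ᵥ (x : Fin d → ℝ))) / (2 * n))

/-- `n^{-d/α} L(x / n^{1/α})`. -/
def stableFactor {d : ℕ} (α : ℝ) (L : E d → ℝ) (n : ℕ) (x : E d) : ℝ :=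
  (n : ℝ) ^ (-(d : ℝ) / α) * L (((n : ℝ) ^ (1 / α))⁻¹ • x)

/-- `F_n(x) = g_n(x) (I + o(1))`, uniformly in `x ∈ D_n`. -/
def UniformAsymp {d : ℕ} (D : ℕ → Set (E d)) (F : ℕ → E d → ℂ) (g : ℕ → E d → ℝ) (I : ℂ) :
    Prop :=
  ∀ ε : ℝ, 0 < ε → ∀ᶠ n : ℕ in atTop, ∀ x ∈ D n,
    ∃ δ : ℂ, ‖δ‖ ≤ ε ∧ F n x = g n x * (I + δ)

/-- `F_n(x) = (1 + o(1)) g_n(x) I`, uniformly in `x ∈ D_n`. -/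
def UniformEquiv {d : ℕ} (D : ℕ → Set (E d)) (F : ℕ → E d → ℂ) (g : ℕ → E d → ℝ) (I : ℂ) :
    Prop :=
  ∀ ε : ℝ, 0 < ε → ∀ᶠ n : ℕ in atTop, ∀ x ∈ D n,
    ∃ δ : ℂ, ‖δ‖ ≤ ε ∧ F n x = (1 + δ) * (g n x * I)

end BRW

end

/-! Give every particle of generation `n` the weight `s^{1_A} e^f` and let `U_n^s(x)` (`genExp`) be
the mean of the product of the weights when the ancestor stands at `x`. Since `1{N ≥ 1} = 1^N -
0^N`, the expectation to be estimated is `D_n = U_n^1 - U_n^0` (`keyDiff`). Let `F` be the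
generating function of `μ` and `Π` the average over one step. The branching property gives `U_{n+1}
= F(Π U_n)`, and `F(a) - F(b)` is exactly `slope(a, b) (a - b)`, so `D_{n+1} = slope · Π D_n`;
criticality makes the slope `1` at `(1, 1)`.

The quantity `1 - Π U_n` is at most twice the probability that the random walk is in `A`, of order
`n^{-θ}` with `θ = d/2` or `d/α`. The moment of order `1 + γ` then bounds `1 - slope` by a multiple
of `n^{-θγ}`, which is summable when `θγ > 1`. After a large fixed time `K` the function `D`
therefore evolves like a mean along the random walk, up to a small relative error
(`norm_keyDiff_sub_avg_le`), and a local limit theorem gives `n^θ D_n(x) ≈ g_n(x) ∫ D_K dℓ`, where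
`ℓ` is Lebesgue or counting measure (`tendsto_keyDiff`).

It remains to see that `∫ D_K dℓ` tends to `I_{A,f}`. Write `D_K` as the integral over `s` of `V_K =
∂_s U_K`, where `V_{n+1} = F'(Π U_n) Π V_n`. As `ℓ` is invariant under the steps, these operators
can be transposed one at a time, and `∫ V_K dℓ` becomes the integral over `A` of `e^f` times a
function given by the reversed recursion (`integral_genDeriv_mul_spineExp`). Now `F'` is the
generating function of the number of brothers on the spine, so this function is a `Q*`-mean of the
product of the weights of the descendants of these brothers (`integral_spineProd`). Finally `∫ s^N
ds = 1/(1+N)` over `[0, 1]` yields the denominator of `G` (`integral_keyDiff`, `tendsto_G`).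

For real `f` the slopes are positive and summably close to `1`, which keeps `∫ D_n dℓ` away from `0`
(`integral_G_ne_zero`). The local limit theorems come from Fourier inversion: with exact
self-similarity for Gaussian and stable motion, and with a Gaussian bound for the characteristic
function on `[-π, π]^d` for lattice motion. -/

namespace BRW

set_option linter.unusedSectionVars false

/-! ### Splitting infinite product measures -/

section InfiniteProduct

variable {ι X : Type*} [MeasurableSpace X] (ν : Measure X) [IsProbabilityMeasure ν]

/-- A product measure is recognised by its values on boxes over finite index sets. That criterion
applies to the inverse map, which reassembles a function on `Option ι`; the bijection is then
undone. -/
lemma map_infinitePi_option :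
    (Measure.infinitePi fun _ : Option ι => ν).map (fun x => (x none, fun i => x (some i))) =
      ν.prod (Measure.infinitePi fun _ : ι => ν) := by
  classical
  have key : (ν.prod (Measure.infinitePi fun _ : ι => ν)).map
      (fun p : X × (ι → X) => fun o : Option ι => o.elim p.1 p.2) =
        Measure.infinitePi fun _ : Option ι => ν := by
    have hm : Measurable (fun p : X × (ι → X) => fun o : Option ι => o.elim p.1 p.2) := by
      refine measurable_pi_lambda _ fun o => ?_
      cases o with
      | none => exact measurable_fst
      | some i => exact (measurable_pi_apply i).comp measurable_snd
    refine Measure.eq_infinitePi _ fun s t ht => ?_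
    rw [Measure.map_apply hm (.pi s.countable_toSet fun i _ => ht i)]
    have : (fun p : X × (ι → X) => fun o : Option ι => o.elim p.1 p.2) ⁻¹' ((s : Set _).pi t) =
        (if none ∈ s then t none else Set.univ) ×ˢ
          ((Finset.eraseNone s : Finset ι) : Set ι).pi (fun i => t (some i)) := by
      ext ⟨a, b⟩
      simp only [Set.mem_preimage, Set.mem_pi, Set.mem_prod, Finset.mem_coe, Finset.mem_eraseNone]
      constructor
      · intro h
        refine ⟨?_, fun i hi => h _ hi⟩
        split_ifs with h0
        · exact h _ h0
        · trivial
      · rintro ⟨h1, h2⟩ o ho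
        cases o with
        | none => simpa [ho] using h1
        | some i => exact h2 i ho
    rw [this, Measure.prod_prod, Measure.infinitePi_pi _ fun i _ => ht _]
    by_cases h0 : none ∈ s
    · rw [if_pos h0, ← Finset.mul_prod_erase _ _ h0]
      congr 1
      refine Finset.prod_bij (fun i _ => some i) ?_ ?_ ?_ ?_
      · intro i hi; simpa using hi
      · intro i _ j _ h; simpa using h
      · rintro (_ | i) hi
        · simp at hi
        · exact ⟨i, by simpa using hi, rfl⟩
      · intro _ _; rfl
    · rw [if_neg h0, measure_univ, one_mul]
      refine Finset.prod_bij (fun i _ => some i) ?_ ?_ ?_ ?_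
      · intro i hi; simpa using hi
      · intro i _ j _ h; simpa using h
      · rintro (_ | i) hi
        · exact absurd hi h0
        · exact ⟨i, by simpa using hi, rfl⟩
      · intro _ _; rfl
  have hm : Measurable (fun p : X × (ι → X) => fun o : Option ι => o.elim p.1 p.2) := by
    refine measurable_pi_lambda _ fun o => ?_
    cases o with
    | none => exact measurable_fst
    | some i => exact (measurable_pi_apply i).comp measurable_snd
  rw [← key, Measure.map_map (by fun_prop) hm]
  exact Measure.map_id

lemma measurePreserving_nat_cons :
    MeasurePreserving (fun σ : ℕ → X => (σ 0, fun n => σ (n + 1)))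
      (Measure.infinitePi fun _ : ℕ => ν) (ν.prod (Measure.infinitePi fun _ : ℕ => ν)) := by
  refine ⟨by fun_prop, ?_⟩
  rw [← map_infinitePi_option (ι := ℕ) ν]
  have hf : Function.Injective (fun o : Option ℕ => o.elim 0 Nat.succ) := by
    rintro (_ | a) (_ | b) h <;> simp at h ⊢
    exact h
  rw [← Measure.map_infinitePi_infinitePi_of_inj (P := fun _ : ℕ => ν) hf,
    Measure.map_map (by fun_prop) (by fun_prop)]
  rfl

lemma integral_infinitePi_prod (s : Finset ι) (f : ι → X → ℂ) (hf : ∀ i, Measurable (f i)) :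
    ∫ x, ∏ i ∈ s, f i (x i) ∂(Measure.infinitePi fun _ : ι => ν) = ∏ i ∈ s, ∫ x, f i x ∂ν := by
  have h1 : ∀ x : ι → X, ∏ i ∈ s, f i (x i) =
      (fun y : s → X => ∏ i : s, f i (y i)) (s.restrict x) := by
    intro x
    simp only [Finset.restrict]
    rw [← Finset.prod_coe_sort]
  simp_rw [h1]
  rw [integral_restrict_infinitePi (μ := fun _ : ι => ν)
    (f := fun y : s → X => ∏ i : s, f i (y i))]
  · rw [integral_fintype_prod_eq_prod (fun (i : s) x => f i x)]
    exact Finset.prod_coe_sort s fun i => ∫ x, f i x ∂ν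
  · exact (Finset.measurable_fun_prod Finset.univ fun (i : s) _ =>
      (hf i).comp (measurable_pi_apply i)).aestronglyMeasurable

end InfiniteProduct

/-! ### Decomposition of a tree at its root -/

section Root

variable {d : ℕ}

instance (μ : PMF ℕ) (P : Measure (E d)) [IsProbabilityMeasure P] :
    IsProbabilityMeasure (treeLaw μ P) := by
  unfold treeLaw; infer_instance

/-- This is the branching property. A nonempty label ends with the index of its first-generation
ancestor, so the labels are the root together with pairs `(i, u)` standing for `u ++ [i]`. The
subtree of `i` keeps at its root the displacement of `i`. -/
lemma measurePreserving_root (μ : PMF ℕ) (P : Measure (E d)) [IsProbabilityMeasure P] :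
    MeasurePreserving (fun T : MarkedTree d => (T [], fun i : ℕ => subtree T [i])) (treeLaw μ P)
      ((μ.toMeasure.prod P).prod (Measure.infinitePi fun _ : ℕ => treeLaw μ P)) := by
  have hm : Measurable (fun T : MarkedTree d => (T [], fun i : ℕ => subtree T [i])) := by
    unfold subtree; fun_prop
  refine ⟨hm, ?_⟩
  have hf : Function.Injective
      (fun o : Option (ℕ × Label) => o.elim ([] : Label) fun p => p.2 ++ [p.1]) := by
    rintro (_ | ⟨i, u⟩) (_ | ⟨j, v⟩) h
    · rfl
    · simp at h
    · simp at h
    · have h' : u ++ [i] = v ++ [j] := h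
      obtain ⟨h1, h2⟩ := List.append_inj' h' rfl
      simp only [List.cons.injEq, and_true] at h2
      rw [h1, h2]
  have h1 := Measure.map_infinitePi_infinitePi_of_inj
    (P := fun _ : Label => μ.toMeasure.prod P) hf
  have h2 := map_infinitePi_option (ι := ℕ × Label) (μ.toMeasure.prod P)
  have h3 := Measure.infinitePi_map_curry (fun (_ : ℕ) (_ : Label) => μ.toMeasure.prod P)
  unfold treeLaw
  have h4 := Measure.map_prod_map (μ.toMeasure.prod P)
    (Measure.infinitePi fun _ : ℕ × Label => μ.toMeasure.prod P) measurable_id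
    (MeasurableEquiv.curry ℕ Label (ℕ × E d)).measurable
  rw [Measure.map_id] at h4
  rw [← h3, h4, ← h2, ← h1,
    Measure.map_map (by fun_prop) (by fun_prop), Measure.map_map (by fun_prop) (by fun_prop)]
  rfl

lemma measurable_subtree (u : Label) : Measurable fun T : MarkedTree d => subtree T u :=
  measurable_pi_lambda _ fun _ => measurable_pi_apply _

/-- `gen` adds the youngest generation at the head of the list, whereas recursions on the tree
separate the oldest one, at the end of the list. This reconciles the two. -/
lemma mem_gen_succ_append (T : MarkedTree d) (n : ℕ) (v : Label) (i : ℕ) :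
    v ++ [i] ∈ gen T (n + 1) ↔ i < (T []).1 ∧ v ∈ gen (subtree T [i]) n := by
  induction n generalizing v with
  | zero =>
    cases v with
    | nil => simp [gen]
    | cons a v => simp [gen]
  | succ n ih =>
    rw [gen]
    simp only [Finset.mem_biUnion, Finset.mem_image, Finset.mem_range]
    constructor
    · rintro ⟨u, hu, j, hj, he⟩
      cases v with
      | nil =>
        simp only [List.nil_append, List.cons.injEq] at he
        obtain ⟨rfl, rfl⟩ := he
        simp [gen] at hu
      | cons a v =>
        simp only [List.cons_append, List.cons.injEq] at he
        obtain ⟨rfl, rfl⟩ := he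
        obtain ⟨h1, h2⟩ := (ih v).1 hu
        refine ⟨h1, ?_⟩
        rw [gen]
        simp only [Finset.mem_biUnion, Finset.mem_image, Finset.mem_range]
        exact ⟨v, h2, j, hj, rfl⟩
    · rintro ⟨h1, h2⟩
      rw [gen] at h2
      simp only [Finset.mem_biUnion, Finset.mem_image, Finset.mem_range] at h2
      obtain ⟨u, hu, j, hj, rfl⟩ := h2
      exact ⟨u ++ [i], (ih u).2 ⟨h1, hu⟩, j, hj, rfl⟩

lemma gen_succ_eq (T : MarkedTree d) (n : ℕ) :
    gen T (n + 1) = (Finset.range (T []).1).biUnion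
      fun i => (gen (subtree T [i]) n).image fun v => v ++ [i] := by
  ext u
  simp only [Finset.mem_biUnion, Finset.mem_image, Finset.mem_range]
  constructor
  · intro h
    rcases List.eq_nil_or_concat u with rfl | ⟨v, i, rfl⟩
    · simp [gen] at h
    · rw [List.concat_eq_append, mem_gen_succ_append] at h
      exact ⟨i, h.1, v, h.2, by simp⟩
  · rintro ⟨i, hi, v, hv, rfl⟩
    exact (mem_gen_succ_append T n v i).2 ⟨hi, hv⟩

lemma prod_gen_succ {M : Type*} [CommMonoid M] (T : MarkedTree d) (n : ℕ) (φ : Label → M) :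
    ∏ u ∈ gen T (n + 1), φ u =
      ∏ i ∈ Finset.range (T []).1, ∏ v ∈ gen (subtree T [i]) n, φ (v ++ [i]) := by
  rw [gen_succ_eq, Finset.prod_biUnion]
  · refine Finset.prod_congr rfl fun i _ => ?_
    rw [Finset.prod_image]
    intro u _ v _ h
    exact List.append_cancel_right h
  · intro i _ j _ hij
    rw [Function.onFun, Finset.disjoint_left]
    intro u hu hv
    simp only [Finset.mem_image] at hu hv
    obtain ⟨a, _, rfl⟩ := hu
    obtain ⟨b, _, hb⟩ := hv
    have := (List.append_inj' hb rfl).2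
    simp only [List.cons.injEq, and_true] at this
    exact hij this.symm

lemma pos_append_singleton (T : MarkedTree d) (v : Label) (i : ℕ) :
    pos T (v ++ [i]) = (T [i]).2 + pos (subtree T [i]) v := by
  induction v with
  | nil => simp [pos]
  | cons a v ih => simp only [List.cons_append, pos, ih, subtree]; abel

/-- The product of the weights `h` of the particles of generation `n`, for the process whose
ancestor is born at distance `ρ` of `x`, where `ρ` is the displacement carried by the root. -/
def genProd (h : E d → ℂ) (n : ℕ) (T : MarkedTree d) (x : E d) : ℂ :=
  ∏ u ∈ gen T n, h (x + (T []).2 + pos T u)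

lemma genProd_zero (h : E d → ℂ) (T : MarkedTree d) (x : E d) :
    genProd h 0 T x = h (x + (T []).2) := by
  simp [genProd, gen, pos]

lemma genProd_succ (h : E d → ℂ) (n : ℕ) (T : MarkedTree d) (x : E d) :
    genProd h (n + 1) T x =
      ∏ i ∈ Finset.range (T []).1, genProd h n (subtree T [i]) (x + (T []).2) := by
  rw [genProd, prod_gen_succ]
  refine Finset.prod_congr rfl fun i _ => Finset.prod_congr rfl fun v _ => ?_
  rw [pos_append_singleton, show subtree T [i] [] = T [i] from rfl]
  congr 1
  abel

lemma measurable_prod_range {S : Type*} [MeasurableSpace S] {N : S → ℕ} (hN : Measurable N)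
    {φ : ℕ → S → ℂ} (hφ : ∀ i, Measurable (φ i)) :
    Measurable fun s => ∏ i ∈ Finset.range (N s), φ i s := by
  have : Measurable fun p : ℕ × S => ∏ i ∈ Finset.range p.1, φ i p.2 :=
    measurable_from_prod_countable_right fun n =>
      Finset.measurable_fun_prod (Finset.range n) fun i _ => hφ i
  exact this.comp (hN.prodMk measurable_id)

lemma measurable_genProd {h : E d → ℂ} (hh : Measurable h) (n : ℕ) :
    Measurable fun p : MarkedTree d × E d => genProd h n p.1 p.2 := by
  induction n with
  | zero =>
    simp_rw [genProd_zero]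
    exact hh.comp (measurable_snd.add ((measurable_pi_apply []).comp measurable_fst).snd)
  | succ n ih =>
    simp_rw [genProd_succ]
    refine measurable_prod_range ((measurable_pi_apply []).comp measurable_fst).fst fun i => ?_
    have h1 : Measurable fun p : MarkedTree d × E d => subtree p.1 [i] :=
      (measurable_subtree [i]).comp measurable_fst
    have h2 : Measurable fun p : MarkedTree d × E d => p.2 + (p.1 []).2 :=
      measurable_snd.add ((measurable_pi_apply []).comp measurable_fst).snd
    have h3 := ih.comp (h1.prodMk h2)
    simp only [Function.comp_def] at h3
    exact h3

lemma norm_genProd_le {h : E d → ℂ} (hh : ∀ x, ‖h x‖ ≤ 1) (n : ℕ) (T : MarkedTree d) (x : E d) :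
    ‖genProd h n T x‖ ≤ 1 := by
  rw [genProd, norm_prod]
  exact Finset.prod_le_one (fun _ _ => norm_nonneg _) fun _ _ => hh _

end Root

/-! ### The generating function of the offspring law -/

section GeneratingFunction

/-- The generating function `∑ μ(k) w^k`. -/
noncomputable def genFun (μ : PMF ℕ) (w : ℂ) : ℂ := ∑' k : ℕ, ((μ k).toReal : ℂ) * w ^ k

/-- The difference quotient of the generating function: `∑ μ(k) ∑_{j < k} a^j b^{k-1-j}`. -/
noncomputable def genSlope (μ : PMF ℕ) (a b : ℂ) : ℂ :=
  ∑' k : ℕ, ((μ k).toReal : ℂ) * ∑ j ∈ Finset.range k, a ^ j * b ^ (k - 1 - j)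

variable {μ : PMF ℕ}

lemma summable_toReal (μ : PMF ℕ) : Summable fun k => (μ k).toReal :=
  ENNReal.summable_toReal μ.tsum_coe_ne_top

lemma tsum_toReal (μ : PMF ℕ) : ∑' k, (μ k).toReal = 1 := by
  rw [← ENNReal.tsum_toReal_eq fun k => μ.apply_ne_top k, μ.tsum_coe, ENNReal.toReal_one]

lemma summable_mean (hμ : Critical μ) : Summable fun k : ℕ => (μ k).toReal * k := by
  have h : ∑' k : ℕ, (k : ℝ≥0∞) * μ k ≠ ∞ := by rw [show _ = _ from hμ]; simp
  refine (ENNReal.summable_toReal h).congr fun k => ?_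
  rw [ENNReal.toReal_mul, ENNReal.toReal_natCast, mul_comm]

lemma tsum_mean (hμ : Critical μ) : ∑' k : ℕ, (μ k).toReal * k = 1 := by
  have h2 : ∑' k : ℕ, (k : ℝ≥0∞) * μ k = 1 := hμ
  have h : ∀ k : ℕ, (k : ℝ≥0∞) * μ k ≠ ∞ := fun k =>
    ENNReal.mul_ne_top (ENNReal.natCast_ne_top k) (μ.apply_ne_top k)
  rw [← ENNReal.toReal_one, ← h2, ENNReal.tsum_toReal_eq h]
  refine tsum_congr fun k => ?_
  rw [ENNReal.toReal_mul, ENNReal.toReal_natCast, mul_comm]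

lemma norm_sum_pow_mul_pow_le {a b : ℂ} (ha : ‖a‖ ≤ 1) (hb : ‖b‖ ≤ 1) (k : ℕ) :
    ‖∑ j ∈ Finset.range k, a ^ j * b ^ (k - 1 - j)‖ ≤ k := by
  refine (norm_sum_le_of_le _ (f := fun j => a ^ j * b ^ (k - 1 - j)) (n := fun _ => (1 : ℝ))
    fun j _ => ?_).trans (by simp)
  rw [norm_mul, norm_pow, norm_pow]
  exact mul_le_one₀ (pow_le_one₀ (norm_nonneg _) ha) (by positivity)
    (pow_le_one₀ (norm_nonneg _) hb)

lemma norm_genFun_term_le {w : ℂ} (hw : ‖w‖ ≤ 1) (k : ℕ) :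
    ‖((μ k).toReal : ℂ) * w ^ k‖ ≤ (μ k).toReal := by
  rw [norm_mul, Complex.norm_real, Real.norm_of_nonneg ENNReal.toReal_nonneg, norm_pow]
  exact mul_le_of_le_one_right ENNReal.toReal_nonneg (pow_le_one₀ (norm_nonneg _) hw)

lemma summable_genFun {w : ℂ} (hw : ‖w‖ ≤ 1) : Summable fun k => ((μ k).toReal : ℂ) * w ^ k :=
  .of_norm_bounded (summable_toReal μ) (norm_genFun_term_le hw)

lemma norm_genSlope_term_le {a b : ℂ} (ha : ‖a‖ ≤ 1) (hb : ‖b‖ ≤ 1) (k : ℕ) :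
    ‖((μ k).toReal : ℂ) * ∑ j ∈ Finset.range k, a ^ j * b ^ (k - 1 - j)‖ ≤ (μ k).toReal * k := by
  rw [norm_mul, Complex.norm_real, Real.norm_of_nonneg ENNReal.toReal_nonneg]
  exact mul_le_mul_of_nonneg_left (norm_sum_pow_mul_pow_le ha hb k) ENNReal.toReal_nonneg

lemma summable_genSlope (hμ : Critical μ) {a b : ℂ} (ha : ‖a‖ ≤ 1) (hb : ‖b‖ ≤ 1) :
    Summable fun k => ((μ k).toReal : ℂ) * ∑ j ∈ Finset.range k, a ^ j * b ^ (k - 1 - j) :=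
  .of_norm_bounded (summable_mean hμ) (norm_genSlope_term_le ha hb)

lemma norm_genFun_le {w : ℂ} (hw : ‖w‖ ≤ 1) : ‖genFun μ w‖ ≤ 1 := by
  rw [← tsum_toReal μ]
  exact tsum_of_norm_bounded (summable_toReal μ).hasSum (norm_genFun_term_le hw)

lemma norm_genSlope_le (hμ : Critical μ) {a b : ℂ} (ha : ‖a‖ ≤ 1) (hb : ‖b‖ ≤ 1) :
    ‖genSlope μ a b‖ ≤ 1 := by
  rw [← tsum_mean hμ]
  exact tsum_of_norm_bounded (summable_mean hμ).hasSum (norm_genSlope_term_le ha hb)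

lemma genFun_one : genFun μ 1 = 1 := by
  simp_rw [genFun, one_pow, mul_one]
  rw [← Complex.ofReal_tsum, tsum_toReal, Complex.ofReal_one]

/-- Factor `a^k - b^k` term by term. Being an exact identity, without a Taylor remainder, it turns
the nonlinear recursion for `U_n` into a linear one for differences. -/
lemma genFun_sub_genFun (hμ : Critical μ) {a b : ℂ} (ha : ‖a‖ ≤ 1) (hb : ‖b‖ ≤ 1) :
    genFun μ a - genFun μ b = genSlope μ a b * (a - b) := by
  rw [genFun, genFun, ← (summable_genFun ha).tsum_sub (summable_genFun hb), genSlope,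
    ← (summable_genSlope hμ ha hb).tsum_mul_right]
  refine tsum_congr fun k => ?_
  rw [mul_assoc, (Commute.all a b).geom_sum₂_mul]
  ring

lemma norm_genFun_sub_le (hμ : Critical μ) {a b : ℂ} (ha : ‖a‖ ≤ 1) (hb : ‖b‖ ≤ 1) :
    ‖genFun μ a - genFun μ b‖ ≤ ‖a - b‖ := by
  rw [genFun_sub_genFun hμ ha hb, norm_mul]
  exact mul_le_of_le_one_left (norm_nonneg _) (norm_genSlope_le hμ ha hb)

/-- On the diagonal the slope is `F'`, which is also the mean of `w^{k-1}` under the size-biased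
law. -/
lemma genSlope_self (w : ℂ) :
    genSlope μ w w = ∑' k : ℕ, ((μ k).toReal : ℂ) * (k * w ^ (k - 1)) := by
  refine tsum_congr fun k => ?_
  congr 1
  rw [Finset.sum_congr rfl (g := fun _ => w ^ (k - 1)), Finset.sum_const, Finset.card_range,
    nsmul_eq_mul]
  intro j hj
  rw [Finset.mem_range] at hj
  rw [← pow_add]
  congr 1
  omega

lemma measurable_genFun : Measurable (genFun μ) := by
  refine Measurable.tsum fun k => ?_
  fun_prop

lemma measurable_genSlope : Measurable fun p : ℂ × ℂ => genSlope μ p.1 p.2 := by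
  refine Measurable.tsum fun k => ?_
  fun_prop

lemma continuousOn_genSlope (hμ : Critical μ) :
    ContinuousOn (fun p : ℂ × ℂ => genSlope μ p.1 p.2)
      (Metric.closedBall 0 1 ×ˢ Metric.closedBall 0 1) := by
  refine continuousOn_tsum (fun k => by fun_prop) (summable_mean hμ) fun k p hp => ?_
  simp only [Set.mem_prod, mem_closedBall_zero_iff] at hp
  exact norm_genSlope_term_le hp.1 hp.2 k

lemma norm_one_sub_pow_mul_pow_le {a b : ℂ} (ha : ‖a‖ ≤ 1) (hb : ‖b‖ ≤ 1) {δ : ℝ}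
    (hδa : ‖1 - a‖ ≤ δ) (hδb : ‖1 - b‖ ≤ δ) (i j : ℕ) :
    ‖1 - a ^ i * b ^ j‖ ≤ (i + j) * δ := by
  have hpow : ∀ {c : ℂ}, ‖c‖ ≤ 1 → ‖1 - c‖ ≤ δ → ∀ n : ℕ, ‖1 - c ^ n‖ ≤ n * δ := by
    intro c hc hδ n
    induction n with
    | zero => simp
    | succ n ih =>
      have : 1 - c ^ (n + 1) = (1 - c ^ n) + c ^ n * (1 - c) := by ring
      rw [this]
      refine (norm_add_le _ _).trans ?_
      rw [norm_mul, norm_pow]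
      have h1 : ‖c‖ ^ n * ‖1 - c‖ ≤ 1 * δ :=
        mul_le_mul (pow_le_one₀ (norm_nonneg _) hc) hδ (norm_nonneg _) zero_le_one
      push_cast
      linarith
  have : 1 - a ^ i * b ^ j = (1 - a ^ i) + a ^ i * (1 - b ^ j) := by ring
  rw [this]
  refine (norm_add_le _ _).trans ?_
  rw [norm_mul, norm_pow]
  have h1 := hpow ha hδa i
  have h2 : ‖a‖ ^ i * ‖1 - b ^ j‖ ≤ 1 * (j * δ) :=
    mul_le_mul (pow_le_one₀ (norm_nonneg _) ha) (hpow hb hδb j) (norm_nonneg _) zero_le_one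
  linarith

/-- By criticality `1 = ∑ k μ(k)`, so `1 - slope` is the `μ`-mean of `∑_{j<k} (1 - a^j b^{k-1-j})`.
Each summand is at most `min(kδ, 2) ≤ 2 (kδ)^γ`, an interpolation that uses only the moment of order
`1 + γ`. -/
lemma norm_one_sub_genSlope_le (hμ : Critical μ) {γ : ℝ} (hγ0 : 0 < γ) (hγ1 : γ ≤ 1)
    (hm : Summable fun k : ℕ => (μ k).toReal * (k : ℝ) ^ (1 + γ))
    {a b : ℂ} (ha : ‖a‖ ≤ 1) (hb : ‖b‖ ≤ 1) {δ : ℝ}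
    (hδa : ‖1 - a‖ ≤ δ) (hδb : ‖1 - b‖ ≤ δ) :
    ‖1 - genSlope μ a b‖ ≤ 2 * (∑' k : ℕ, (μ k).toReal * (k : ℝ) ^ (1 + γ)) * δ ^ γ := by
  have hδ : 0 ≤ δ := (norm_nonneg _).trans hδa
  have hone : (1 : ℂ) = ∑' k : ℕ, ((μ k).toReal : ℂ) * (k : ℂ) := by
    have := congrArg (fun x : ℝ => (x : ℂ)) (tsum_mean hμ)
    simpa [Complex.ofReal_tsum] using this.symm
  have hs1 : Summable fun k : ℕ => ((μ k).toReal : ℂ) * (k : ℂ) := by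
    have := Complex.hasSum_ofReal.2 (summable_mean hμ).hasSum
    simpa using this.summable
  rw [hone, genSlope, ← hs1.tsum_sub (summable_genSlope hμ ha hb)]
  have hs2 := hm.hasSum.mul_left (2 * δ ^ γ)
  have hs3 : HasSum (fun k : ℕ => 2 * δ ^ γ * ((μ k).toReal * (k : ℝ) ^ (1 + γ)))
      (2 * (∑' k : ℕ, (μ k).toReal * (k : ℝ) ^ (1 + γ)) * δ ^ γ) := by
    rw [mul_right_comm]
    exact hs2
  refine tsum_of_norm_bounded hs3 fun k => ?_
  rw [← mul_sub, norm_mul, Complex.norm_real, Real.norm_of_nonneg ENNReal.toReal_nonneg,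
    mul_left_comm]
  refine mul_le_mul_of_nonneg_left ?_ ENNReal.toReal_nonneg
  rcases Nat.eq_zero_or_pos k with rfl | hk
  · simp only [Nat.cast_zero, Finset.range_zero, Finset.sum_empty, sub_zero, norm_zero]
    positivity
  have hk0 : (0 : ℝ) < k := by exact_mod_cast hk
  have h1 : (k : ℂ) - ∑ j ∈ Finset.range k, a ^ j * b ^ (k - 1 - j) =
      ∑ j ∈ Finset.range k, (1 - a ^ j * b ^ (k - 1 - j)) := by
    simp
  have hterm : ∀ j ∈ Finset.range k, ‖1 - a ^ j * b ^ (k - 1 - j)‖ ≤ 2 * (k * δ) ^ γ := by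
    intro j hj
    rw [Finset.mem_range] at hj
    by_cases hkδ : k * δ ≤ 1
    · have h2 := norm_one_sub_pow_mul_pow_le ha hb hδa hδb j (k - 1 - j)
      have h3 : ((j : ℝ) + ((k - 1 - j : ℕ) : ℝ)) ≤ k := by
        have : j + (k - 1 - j) ≤ k := by omega
        exact_mod_cast this
      have h4 : (k * δ) ^ (1 : ℝ) ≤ (k * δ) ^ γ :=
        Real.rpow_le_rpow_of_exponent_ge_of_imp (by positivity) hkδ hγ1 (fun _ h => by linarith)
      rw [Real.rpow_one] at h4
      have h5 : ((j : ℝ) + ((k - 1 - j : ℕ) : ℝ)) * δ ≤ k * δ := by gcongr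
      have h6 : 0 ≤ (k * δ) ^ γ := by positivity
      linarith
    · have h2 : ‖a ^ j * b ^ (k - 1 - j)‖ ≤ 1 := by
        rw [norm_mul, norm_pow, norm_pow]
        exact mul_le_one₀ (pow_le_one₀ (norm_nonneg _) ha) (by positivity)
          (pow_le_one₀ (norm_nonneg _) hb)
      have h3 : 1 ≤ (k * δ) ^ γ := Real.one_le_rpow (le_of_not_ge hkδ) hγ0.le
      have h4 := norm_sub_le (1 : ℂ) (a ^ j * b ^ (k - 1 - j))
      rw [norm_one] at h4
      linarith
  rw [h1]
  refine (norm_sum_le_of_le _ hterm).trans (le_of_eq ?_)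
  rw [Finset.sum_const, Finset.card_range, nsmul_eq_mul, Real.mul_rpow hk0.le hδ,
    Real.rpow_add hk0, Real.rpow_one]
  ring

end GeneratingFunction

/-! ### Expectations along the first generation -/

section Expectation

variable {d : ℕ} (μ : PMF ℕ) (P : Measure (E d)) [IsProbabilityMeasure P]

lemma integrable_of_bound {S : Type*} [MeasurableSpace S] {ν : Measure S} [IsFiniteMeasure ν]
    {φ : S → ℂ} (hφ : Measurable φ) {C : ℝ} (hC : ∀ s, ‖φ s‖ ≤ C) : Integrable φ ν :=
  .of_bound hφ.aestronglyMeasurable C (.of_forall hC)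

lemma norm_integral_le_one {S : Type*} [MeasurableSpace S] {ν : Measure S}
    [IsProbabilityMeasure ν] {φ : S → ℂ} (hC : ∀ s, ‖φ s‖ ≤ 1) : ‖∫ s, φ s ∂ν‖ ≤ 1 := by
  have := norm_integral_le_of_norm_le_const (μ := ν) (f := φ) (.of_forall hC)
  simpa using this

lemma integral_pmf_eq_genFun {w : ℂ} (hw : ‖w‖ ≤ 1) :
    ∫ k, w ^ k ∂μ.toMeasure = genFun μ w := by
  rw [PMF.integral_eq_tsum]
  · exact tsum_congr fun k => by rw [Complex.real_smul]
  · refine integrable_of_bound (by fun_prop) (C := 1) fun k => ?_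
    rw [norm_pow]
    exact pow_le_one₀ (norm_nonneg _) hw

/-- Given the mark of the root, the subtrees of its children are independent copies of the tree, so
the product integrates to a power, and averaging over the number of children gives `F`. The map `y`
lets the displacement of the root be either added to the position or ignored. -/
lemma integral_root {Λ : MarkedTree d → E d → ℂ} (hΛ : Measurable fun p : _ × _ => Λ p.1 p.2)
    (hΛ1 : ∀ T x, ‖Λ T x‖ ≤ 1) {y : E d → E d} (hy : Measurable y) :
    ∫ T, ∏ i ∈ Finset.range (T []).1, Λ (subtree T [i]) (y (T []).2) ∂treeLaw μ P =
      ∫ ρ, genFun μ (∫ T, Λ T (y ρ) ∂treeLaw μ P) ∂P := by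
  have hm : Measurable fun p : (ℕ × E d) × (ℕ → MarkedTree d) =>
      ∏ i ∈ Finset.range p.1.1, Λ (p.2 i) (y p.1.2) := by
    refine measurable_prod_range measurable_fst.fst fun i => ?_
    have h1 : Measurable fun p : (ℕ × E d) × (ℕ → MarkedTree d) => (p.2 i, y p.1.2) :=
      ((measurable_pi_apply i).comp measurable_snd).prodMk (hy.comp measurable_fst.snd)
    exact hΛ.comp h1
  have hb : ∀ p : (ℕ × E d) × (ℕ → MarkedTree d),
      ‖∏ i ∈ Finset.range p.1.1, Λ (p.2 i) (y p.1.2)‖ ≤ 1 := fun p => by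
    rw [norm_prod]
    exact Finset.prod_le_one (fun _ _ => norm_nonneg _) fun _ _ => hΛ1 _ _
  have hmp := measurePreserving_root μ P
  have h1 := integral_map (μ := treeLaw μ P) hmp.measurable.aemeasurable
    (f := fun p : (ℕ × E d) × (ℕ → MarkedTree d) =>
      ∏ i ∈ Finset.range p.1.1, Λ (p.2 i) (y p.1.2)) hm.aestronglyMeasurable
  rw [hmp.map_eq] at h1
  rw [← h1, integral_prod _ (integrable_of_bound hm hb)]
  have h2 : ∀ m : ℕ × E d, ∫ S, ∏ i ∈ Finset.range m.1, Λ (S i) (y m.2)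
      ∂(Measure.infinitePi fun _ : ℕ => treeLaw μ P) = (∫ T, Λ T (y m.2) ∂treeLaw μ P) ^ m.1 := by
    intro m
    rw [integral_infinitePi_prod (treeLaw μ P) (Finset.range m.1) (fun _ T => Λ T (y m.2))
      fun _ => hΛ.comp (measurable_id.prodMk measurable_const)]
    simp
  simp_rw [h2]
  have hm2 : Measurable fun x => ∫ T, Λ T x ∂treeLaw μ P :=
    (hΛ.comp measurable_swap).stronglyMeasurable.integral_prod_right'.measurable
  rw [integral_prod_symm]
  · refine integral_congr_ae (.of_forall fun ρ => ?_)
    exact integral_pmf_eq_genFun μ (w := ∫ T, Λ T (y ρ) ∂treeLaw μ P)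
      (norm_integral_le_one fun T => hΛ1 T _)
  · refine integrable_of_bound (C := 1) ?_ fun m => ?_
    · exact (hm2.comp (hy.comp measurable_snd)).pow measurable_fst
    · rw [norm_pow]
      exact pow_le_one₀ (norm_nonneg _) (norm_integral_le_one fun T => hΛ1 T _)

/-- The average `∫ h(x + ρ) P(dρ)`. -/
noncomputable def avg (h : E d → ℂ) (x : E d) : ℂ := ∫ ρ, h (x + ρ) ∂P

/-- The functions `U_0 = h`, `U_{n+1} = F ∘ avg U_n`. -/
noncomputable def genExp (h : E d → ℂ) : ℕ → E d → ℂ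
  | 0 => h
  | n + 1 => fun x => genFun μ (avg P (genExp h n) x)

variable {μ P}

lemma measurable_avg {h : E d → ℂ} (hh : Measurable h) : Measurable (avg P h) := by
  have : Measurable fun p : E d × E d => h (p.1 + p.2) := by fun_prop
  exact this.stronglyMeasurable.integral_prod_right'.measurable

lemma norm_avg_le {h : E d → ℂ} (hh : ∀ x, ‖h x‖ ≤ 1) (x : E d) : ‖avg P h x‖ ≤ 1 :=
  norm_integral_le_one fun _ => hh _

lemma measurable_genExp {h : E d → ℂ} (hh : Measurable h) (n : ℕ) :
    Measurable (genExp μ P h n) := by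
  induction n with
  | zero => exact hh
  | succ n ih => exact measurable_genFun.comp (measurable_avg ih)

lemma norm_genExp_le {h : E d → ℂ} (hh : ∀ x, ‖h x‖ ≤ 1) (n : ℕ) (x : E d) :
    ‖genExp μ P h n x‖ ≤ 1 := by
  induction n generalizing x with
  | zero => exact hh x
  | succ n ih => exact norm_genFun_le (norm_avg_le ih x)

/-- The outer `avg` comes from the displacement carried by the root. In `integral_prod_gen` the
ancestor stands exactly at `x` and this average is absent. -/
lemma integral_genProd {h : E d → ℂ} (hh : Measurable h) (hh1 : ∀ x, ‖h x‖ ≤ 1) (n : ℕ)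
    (x : E d) : ∫ T, genProd h n T x ∂treeLaw μ P = avg P (genExp μ P h n) x := by
  induction n generalizing x with
  | zero =>
    simp_rw [genProd_zero]
    have h1 := measurePreserving_root μ P
    have h2 : MeasurePreserving (fun T : MarkedTree d => (T []).2) (treeLaw μ P) P :=
      (measurePreserving_snd (μ := μ.toMeasure) (ν := P)).comp (measurePreserving_fst.comp h1)
    have h3 := integral_map (μ := treeLaw μ P) h2.measurable.aemeasurable
      (f := fun ρ => h (x + ρ)) (hh.comp (measurable_const_add x)).aestronglyMeasurable
    rw [h2.map_eq] at h3
    exact h3.symm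
  | succ n ih =>
    simp_rw [genProd_succ]
    rw [integral_root μ P (measurable_genProd hh n) (norm_genProd_le hh1 n)
      (y := fun ρ => x + ρ) (by fun_prop)]
    simp_rw [ih]
    rfl

lemma integral_prod_gen {h : E d → ℂ} (hh : Measurable h) (hh1 : ∀ x, ‖h x‖ ≤ 1) (n : ℕ)
    (x : E d) : ∫ T, ∏ u ∈ gen T n, h (x + pos T u) ∂treeLaw μ P = genExp μ P h n x := by
  cases n with
  | zero => simp [gen, pos, genExp]
  | succ n =>
    have h1 : ∀ T : MarkedTree d, ∏ u ∈ gen T (n + 1), h (x + pos T u) =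
        ∏ i ∈ Finset.range (T []).1, genProd h n (subtree T [i]) ((fun _ => x) (T []).2) := by
      intro T
      rw [prod_gen_succ]
      refine Finset.prod_congr rfl fun i _ => Finset.prod_congr rfl fun v _ => ?_
      rw [pos_append_singleton, show subtree T [i] [] = T [i] from rfl, add_assoc]
    simp_rw [h1]
    rw [integral_root μ P (measurable_genProd hh n) (norm_genProd_le hh1 n)
      (y := fun _ => x) (by fun_prop)]
    simp_rw [integral_genProd hh hh1]
    simp [genExp]

end Expectation

/-! ### Decomposition of the size-biased tree at its root -/

section Spine

variable {d : ℕ}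

/-- The size-biased process seen from the first spine particle after the root. -/
def shift (ω : SpineSpace d) : SpineSpace d :=
  (subtree ω.1 [(ω.2 0).2], fun n => ω.2 (n + 1))

lemma spine_succ (ω : SpineSpace d) (k : ℕ) :
    spine ω (k + 1) = spine (shift ω) k ++ [(ω.2 0).2] := by
  induction k with
  | zero => rfl
  | succ k ih => rw [spine, ih]; rfl

lemma spineTree_append (ω : SpineSpace d) (v : Label) :
    spineTree ω (v ++ [(ω.2 0).2]) = spineTree (shift ω) v := by
  have h1 : (v ++ [(ω.2 0).2]).length = v.length + 1 := by simp
  have h2 : v ++ [(ω.2 0).2] = spine ω (v.length + 1) ↔ v = spine (shift ω) v.length := by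
    rw [spine_succ]
    exact List.append_left_inj _
  unfold spineTree
  rw [h1]
  simp only [h2]
  rfl

lemma spineTree_append_of_ne (ω : SpineSpace d) (v : Label) {i : ℕ} (hi : i ≠ (ω.2 0).2) :
    spineTree ω (v ++ [i]) = subtree ω.1 [i] v := by
  have h1 : (v ++ [i]).length = v.length + 1 := by simp
  have h2 : ¬ v ++ [i] = spine ω (v.length + 1) := by
    rw [spine_succ]
    intro h
    have := (List.append_inj' h rfl).2
    simp only [List.cons.injEq, and_true] at this
    exact hi this
  unfold spineTree
  rw [h1, if_neg h2]
  rfl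

lemma subtree_spineTree_append (ω : SpineSpace d) (v : Label) :
    subtree (spineTree ω) (v ++ [(ω.2 0).2]) = subtree (spineTree (shift ω)) v := by
  funext w
  rw [subtree, ← List.append_assoc, spineTree_append]
  rfl

lemma subtree_spineTree_singleton (ω : SpineSpace d) {i : ℕ} (hi : i ≠ (ω.2 0).2) :
    subtree (spineTree ω) [i] = subtree ω.1 [i] := by
  funext w
  rw [subtree, spineTree_append_of_ne ω w hi]

lemma brothers_zero (ω : SpineSpace d) :
    brothers ω 0 = ((Finset.range (ω.2 0).1).erase (ω.2 0).2).image fun i => [i] := by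
  ext u
  simp only [brothers, spine, spineTree, List.length_nil, if_true, Finset.mem_erase,
    Finset.mem_image, Finset.mem_range]
  constructor
  · rintro ⟨h1, i, hi, rfl⟩
    exact ⟨i, ⟨fun h => h1 (by rw [h]), hi⟩, rfl⟩
  · rintro ⟨i, ⟨h1, hi⟩, rfl⟩
    exact ⟨fun h => h1 (by simpa using h), i, hi, rfl⟩

lemma brothers_succ (ω : SpineSpace d) (k : ℕ) :
    brothers ω (k + 1) = (brothers (shift ω) k).image fun v => v ++ [(ω.2 0).2] := by
  ext u
  simp only [brothers, spine_succ ω, spineTree_append, Finset.mem_erase, Finset.mem_image,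
    Finset.mem_range]
  constructor
  · rintro ⟨h1, i, hi, rfl⟩
    exact ⟨i :: spine (shift ω) k, ⟨fun h => h1 (by rw [← h]; rfl), i, hi, rfl⟩, rfl⟩
  · rintro ⟨v, ⟨h1, i, hi, rfl⟩, rfl⟩
    exact ⟨fun h => h1 (List.append_cancel_right h), i, hi, rfl⟩

lemma prod_brothers_succ {M : Type*} [CommMonoid M] (ω : SpineSpace d) (k : ℕ) (φ : Label → M) :
    ∏ u ∈ brothers ω (k + 1), φ u = ∏ v ∈ brothers (shift ω) k, φ (v ++ [(ω.2 0).2]) := by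
  rw [brothers_succ, Finset.prod_image]
  intro u _ v _ h
  exact List.append_cancel_right h

lemma pos_congr_snd {T T' : MarkedTree d} (h : ∀ u, (T u).2 = (T' u).2) (u : Label) :
    pos T u = pos T' u := by
  induction u with
  | nil => rfl
  | cons i u ih => rw [pos, pos, ih, h]

lemma spinePos_succ (ω : SpineSpace d) (k : ℕ) :
    spinePos ω (k + 1) = ((shift ω).1 []).2 + spinePos (shift ω) k := by
  rw [spinePos, spine_succ, pos_append_singleton, spinePos]
  congr 1
  refine pos_congr_snd (fun u => ?_) _
  rw [subtree, spineTree_append]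

lemma spinePos_zero (ω : SpineSpace d) : spinePos ω 0 = 0 := rfl

/-- The product of the weights of the descendants of the brothers of the spine, those of
`B(w_{k+1})` being taken `m + k` generations after them, for `k < K`. -/
noncomputable def spineProd (h : E d → ℂ) (m K : ℕ) (ω : SpineSpace d) (x : E d) : ℂ :=
  ∏ k ∈ Finset.range K, ∏ u ∈ brothers ω k,
    genProd h (m + k) (subtree (spineTree ω) u) (x - (ω.1 []).2 - spinePos ω k)

/-- The brothers in `B(w_1)` carry unmodified subtrees, observed `m` generations later. All other
factors are those of the process seen from `w_1`, with one more generation to run; the displacement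
of the root is subtracted because positions enter through `x - S_{w_k}`. -/
lemma spineProd_succ (h : E d → ℂ) (m K : ℕ) (ω : SpineSpace d) (x : E d) :
    spineProd h m (K + 1) ω x =
      (∏ i ∈ (Finset.range (ω.2 0).1).erase (ω.2 0).2,
        genProd h m (subtree ω.1 [i]) (x - (ω.1 []).2)) *
      spineProd h (m + 1) K (shift ω) (x - (ω.1 []).2) := by
  rw [spineProd, Finset.prod_range_succ', mul_comm]
  congr 1
  · rw [brothers_zero, Finset.prod_image]
    · refine Finset.prod_congr rfl fun i hi => ?_
      rw [subtree_spineTree_singleton ω (Finset.ne_of_mem_erase hi), spinePos_zero, sub_zero]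
      rfl
    · intro i _ j _ hij
      simpa using hij
  · refine Finset.prod_congr rfl fun k _ => ?_
    rw [prod_brothers_succ]
    refine Finset.prod_congr rfl fun v _ => ?_
    rw [subtree_spineTree_append, spinePos_succ, Nat.add_right_comm m 1 k, ← add_assoc, sub_sub,
      sub_sub, sub_sub, add_assoc]

/-- The series in `G` start with the brothers `B(w_2)`, so the first reproduction on the spine plays
no role. Seen from `w_1` they become a `spineProd`, in which the root carries the displacement of
`w_1`. -/
lemma prod_brothers_shift (h : E d → ℂ) (K : ℕ) (ω : SpineSpace d) (y : E d) :
    ∏ k ∈ Finset.range K, ∏ u ∈ brothers ω (k + 1),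
      genProd h k (subtree (spineTree ω) u) (y - spinePos ω (k + 1)) =
    spineProd h 0 K (shift ω) y := by
  refine Finset.prod_congr rfl fun k _ => ?_
  rw [prod_brothers_succ]
  refine Finset.prod_congr rfl fun v _ => ?_
  rw [subtree_spineTree_append, spinePos_succ, zero_add, sub_sub]

lemma measurable_shift : Measurable (shift : SpineSpace d → SpineSpace d) := by
  have h1 : Measurable fun p : ℕ × MarkedTree d => subtree p.2 [p.1] :=
    measurable_from_prod_countable_right fun n => measurable_subtree [n]
  have h2 : Measurable fun ω : SpineSpace d => ((ω.2 0).2, ω.1) :=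
    ((measurable_pi_apply 0).comp measurable_snd).snd.prodMk measurable_fst
  have h3 : Measurable fun ω : SpineSpace d => fun n : ℕ => ω.2 (n + 1) := by fun_prop
  exact (h1.comp h2).prodMk h3

lemma measurable_prod_erase {S : Type*} [MeasurableSpace S] {N J : S → ℕ} (hN : Measurable N)
    (hJ : Measurable J) {φ : ℕ → S → ℂ} (hφ : ∀ i, Measurable (φ i)) :
    Measurable fun s => ∏ i ∈ (Finset.range (N s)).erase (J s), φ i s := by
  have : Measurable fun p : (ℕ × ℕ) × S => ∏ i ∈ (Finset.range p.1.1).erase p.1.2, φ i p.2 :=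
    measurable_from_prod_countable_right fun n =>
      Finset.measurable_fun_prod ((Finset.range n.1).erase n.2) fun i _ => hφ i
  exact this.comp ((hN.prodMk hJ).prodMk measurable_id)

lemma measurable_root_displacement : Measurable fun ω : SpineSpace d => (ω.1 []).2 :=
  ((measurable_pi_apply []).comp measurable_fst).snd

lemma measurable_spineProd {h : E d → ℂ} (hh : Measurable h) (m K : ℕ) :
    Measurable fun p : SpineSpace d × E d => spineProd h m K p.1 p.2 := by
  induction K generalizing m with
  | zero => simp [spineProd]
  | succ K ih =>
    simp_rw [spineProd_succ]
    have hx : Measurable fun p : SpineSpace d × E d => p.2 - (p.1.1 []).2 :=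
      measurable_snd.sub (measurable_root_displacement.comp measurable_fst)
    have hσ : Measurable fun p : SpineSpace d × E d => p.1.2 0 :=
      (measurable_pi_apply 0).comp measurable_fst.snd
    refine (measurable_prod_erase hσ.fst hσ.snd fun i => ?_).mul ?_
    · have h1 : Measurable fun p : SpineSpace d × E d => subtree p.1.1 [i] :=
        (measurable_subtree [i]).comp measurable_fst.fst
      have h3 := (measurable_genProd hh m).comp (h1.prodMk hx)
      simp only [Function.comp_def] at h3
      exact h3
    · have h3 := (ih (m + 1)).comp ((measurable_shift.comp measurable_fst).prodMk hx)
      simp only [Function.comp_def] at h3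
      exact h3

lemma norm_spineProd_le {h : E d → ℂ} (hh : ∀ x, ‖h x‖ ≤ 1) (m K : ℕ) (ω : SpineSpace d)
    (x : E d) : ‖spineProd h m K ω x‖ ≤ 1 := by
  rw [spineProd, norm_prod]
  refine Finset.prod_le_one (fun _ _ => norm_nonneg _) fun k _ => ?_
  rw [norm_prod]
  exact Finset.prod_le_one (fun _ _ => norm_nonneg _) fun _ _ => norm_genProd_le hh _ _ _

/-! ### The law of a spine particle -/

variable {μ : PMF ℕ} (hμ : Critical μ)

lemma spineStep_map_fst : (spineStep μ hμ).map Prod.fst = sizeBiased μ hμ := by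
  rw [spineStep, PMF.map_bind]
  conv_rhs => rw [← PMF.bind_pure (sizeBiased μ hμ)]
  congr 1
  funext k
  split_ifs with h
  · rw [PMF.map_comp, ← PMF.map_const (PMF.uniformOfFinset (Finset.range k) h) k]
    rfl
  · rw [PMF.pure_map]

lemma lt_of_mem_support_spineStep {p : ℕ × ℕ} (hp : p ∈ (spineStep μ hμ).support) :
    p.2 < p.1 := by
  rw [spineStep, PMF.mem_support_bind_iff] at hp
  obtain ⟨k, hk, hp⟩ := hp
  split_ifs at hp with h
  · rw [PMF.mem_support_map_iff] at hp
    obtain ⟨j, hj, rfl⟩ := hp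
    simpa using hj
  · exfalso
    have : k = 0 := by
      by_contra h0
      exact h (Finset.nonempty_range_iff.2 h0)
    subst this
    rw [PMF.mem_support_iff] at hk
    apply hk
    change ((0 : ℕ) : ℝ≥0∞) * μ 0 = 0
    simp

/-- The chosen index is almost surely one of the children, so erasing it leaves `k - 1` brothers,
and the size bias produces `∑ k μ(k) w^{k-1} = F'(w)`. -/
lemma integral_spineStep {w : ℂ} (hw : ‖w‖ ≤ 1) :
    ∫ p, w ^ ((Finset.range p.1).erase p.2).card ∂(spineStep μ hμ).toMeasure =
      genSlope μ w w := by
  have h0 : ∀ n : ℕ, ‖w ^ n‖ ≤ 1 := fun n => by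
    rw [norm_pow]; exact pow_le_one₀ (norm_nonneg _) hw
  have h1 : ∀ᵐ p ∂(spineStep μ hμ).toMeasure,
      w ^ ((Finset.range p.1).erase p.2).card = w ^ (p.1 - 1) := by
    have : ∀ᵐ p ∂(spineStep μ hμ).toMeasure, p ∈ (spineStep μ hμ).support := by
      rw [ae_iff]
      exact (PMF.toMeasure_apply_eq_zero_iff _ (Set.to_countable _).measurableSet).2
        (Set.disjoint_left.2 fun p h1 h2 => h2 h1)
    filter_upwards [this] with p hp
    rw [Finset.card_erase_of_mem (Finset.mem_range.2 (lt_of_mem_support_spineStep hμ hp)),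
      Finset.card_range]
  rw [integral_congr_ae h1]
  have h2 : (spineStep μ hμ).toMeasure.map Prod.fst = _ :=
    PMF.toMeasure_map (spineStep μ hμ) (f := Prod.fst) measurable_fst
  rw [spineStep_map_fst] at h2
  have h3 := integral_map (μ := (spineStep μ hμ).toMeasure) measurable_fst.aemeasurable
    (f := fun k : ℕ => w ^ (k - 1)) (by fun_prop)
  rw [h2] at h3
  rw [← h3, PMF.integral_eq_tsum _ _ (integrable_of_bound (by fun_prop) fun k => h0 _),
    genSlope_self]
  refine tsum_congr fun k => ?_
  rw [show sizeBiased μ hμ k = (k : ℝ≥0∞) * μ k from rfl, ENNReal.toReal_mul,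
    ENNReal.toReal_natCast, Complex.real_smul]
  push_cast
  ring

instance (P : Measure (E d)) [IsProbabilityMeasure P] :
    IsProbabilityMeasure (spineLaw μ hμ P) := by
  unfold spineLaw; infer_instance

variable (P : Measure (E d)) [IsProbabilityMeasure P]

/-- The index `j` need not be below `k`: it is absent from the erased range in any case, so the
factors depend on distinct coordinates and the integral factorises. -/
lemma integral_tree_prod {Λ : MarkedTree d → ℂ} (hΛ : Measurable Λ)
    {Ξ : MarkedTree d → ℂ} (hΞ : Measurable Ξ) (k j : ℕ) :
    ∫ S, (∏ i ∈ (Finset.range k).erase j, Λ (S i)) * Ξ (S j)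
      ∂(Measure.infinitePi fun _ : ℕ => treeLaw μ P) =
      (∫ T, Λ T ∂treeLaw μ P) ^ ((Finset.range k).erase j).card * ∫ T, Ξ T ∂treeLaw μ P := by
  classical
  have h1 := integral_infinitePi_prod (treeLaw μ P) (insert j ((Finset.range k).erase j))
    (fun i => if i = j then Ξ else Λ) (fun i => by split_ifs <;> assumption)
  simp_rw [Finset.prod_insert (Finset.notMem_erase j _), if_true] at h1
  rw [mul_comm (_ ^ _), ← Finset.prod_const, Finset.prod_congr rfl (g := fun i =>
    ∫ x, (if i = j then Ξ else Λ) x ∂treeLaw μ P)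
    (fun i hi => by rw [if_neg (Finset.ne_of_mem_erase hi)]), ← h1]
  refine integral_congr_ae (.of_forall fun S => ?_)
  beta_reduce
  rw [mul_comm]
  congr 1
  exact Finset.prod_congr rfl fun i hi => by rw [if_neg (Finset.ne_of_mem_erase hi)]

/-- The spine version of `integral_root`. Given the displacement of the root, each brother of `w_1`
contributes the mean of `Λ`, the number of brothers has generating function `F'`, and the chosen
subtree with the later spine steps is again a size-biased process, independent of the rest. -/
lemma integral_spine_root {Λ : MarkedTree d → E d → ℂ}
    (hΛ : Measurable fun p : _ × _ => Λ p.1 p.2) (hΛ1 : ∀ T x, ‖Λ T x‖ ≤ 1)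
    {Ξ : SpineSpace d → E d → ℂ} (hΞ : Measurable fun p : _ × _ => Ξ p.1 p.2)
    (hΞ1 : ∀ ω x, ‖Ξ ω x‖ ≤ 1) {y : E d → E d} (hy : Measurable y) :
    ∫ ω, (∏ i ∈ (Finset.range (ω.2 0).1).erase (ω.2 0).2,
        Λ (subtree ω.1 [i]) (y (ω.1 []).2)) * Ξ (shift ω) (y (ω.1 []).2) ∂spineLaw μ hμ P =
      ∫ ρ, genSlope μ (∫ T, Λ T (y ρ) ∂treeLaw μ P) (∫ T, Λ T (y ρ) ∂treeLaw μ P) *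
        ∫ ω, Ξ ω (y ρ) ∂spineLaw μ hμ P ∂P := by
  set τ := Measure.infinitePi fun _ : ℕ => treeLaw μ P with hτ
  set κ := Measure.infinitePi fun _ : ℕ => (spineStep μ hμ).toMeasure with hκ
  have hmp := (measurePreserving_root μ P).prod
    (measurePreserving_nat_cons (spineStep μ hμ).toMeasure)
  set Ψ : (((ℕ × E d) × (ℕ → MarkedTree d)) × ((ℕ × ℕ) × (ℕ → ℕ × ℕ))) → ℂ := fun q =>
    (∏ i ∈ (Finset.range q.2.1.1).erase q.2.1.2, Λ (q.1.2 i) (y q.1.1.2)) *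
      Ξ (q.1.2 q.2.1.2, q.2.2) (y q.1.1.2) with hΨ
  have hyq : Measurable fun q : ((ℕ × E d) × (ℕ → MarkedTree d)) × ((ℕ × ℕ) × (ℕ → ℕ × ℕ)) =>
      y q.1.1.2 := hy.comp measurable_fst.fst.snd
  have hΨm : Measurable Ψ := by
    refine (measurable_prod_erase measurable_snd.fst.fst measurable_snd.fst.snd
      fun i => ?_).mul ?_
    · have h1 : Measurable fun q : ((ℕ × E d) × (ℕ → MarkedTree d)) × ((ℕ × ℕ) × (ℕ → ℕ × ℕ)) =>
        (q.1.2 i, y q.1.1.2) := ((measurable_pi_apply i).comp measurable_fst.snd).prodMk hyq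
      exact hΛ.comp h1
    · have h0 : Measurable fun p : ℕ × (ℕ → MarkedTree d) => p.2 p.1 :=
        measurable_from_prod_countable_right fun n => measurable_pi_apply n
      have h2 : Measurable fun q : ((ℕ × E d) × (ℕ → MarkedTree d)) ×
          ((ℕ × ℕ) × (ℕ → ℕ × ℕ)) => (q.2.1.2, q.1.2) :=
        measurable_snd.fst.snd.prodMk measurable_fst.snd
      have h1 : Measurable fun q : ((ℕ × E d) × (ℕ → MarkedTree d)) ×
          ((ℕ × ℕ) × (ℕ → ℕ × ℕ)) => ((q.1.2 q.2.1.2, q.2.2), y q.1.1.2) :=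
        ((h0.comp h2).prodMk measurable_snd.snd).prodMk hyq
      exact hΞ.comp h1
  have hΨb : ∀ q, ‖Ψ q‖ ≤ 1 := fun q => by
    rw [hΨ, norm_mul, norm_prod]
    exact mul_le_one₀ (Finset.prod_le_one (fun _ _ => norm_nonneg _) fun _ _ => hΛ1 _ _)
      (norm_nonneg _) (hΞ1 _ _)
  have h1 := integral_map (μ := spineLaw μ hμ P) hmp.measurable.aemeasurable (f := Ψ)
    hΨm.aestronglyMeasurable
  rw [spineLaw] at h1
  rw [hmp.map_eq] at h1
  refine h1.symm.trans ?_
  have hlm : Measurable fun x => ∫ T, Λ T x ∂treeLaw μ P :=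
    (hΛ.comp measurable_swap).stronglyMeasurable.integral_prod_right'.measurable
  have hξm : Measurable fun x => ∫ ω, Ξ ω x ∂spineLaw μ hμ P :=
    (hΞ.comp measurable_swap).stronglyMeasurable.integral_prod_right'.measurable
  -- the four sources of randomness, one after the other
  rw [integral_prod _ (integrable_of_bound hΨm hΨb)]
  have h2 : ∀ r, ∫ s, Ψ (r, s) ∂((spineStep μ hμ).toMeasure.prod κ) =
      ∫ p, ∫ σ, Ψ (r, (p, σ)) ∂κ ∂(spineStep μ hμ).toMeasure := fun r =>
    integral_prod _ (integrable_of_bound (hΨm.comp (measurable_const.prodMk measurable_id))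
      fun s => hΨb _)
  rw [integral_congr_ae (.of_forall h2)]
  have hmid : Measurable fun q : ((ℕ × E d) × (ℕ → MarkedTree d)) × (ℕ × ℕ) =>
      ∫ σ, Ψ (q.1, (q.2, σ)) ∂κ := by
    have : Measurable fun q : (((ℕ × E d) × (ℕ → MarkedTree d)) × (ℕ × ℕ)) × (ℕ → ℕ × ℕ) =>
        Ψ (q.1.1, (q.1.2, q.2)) := hΨm.comp (by fun_prop)
    exact this.stronglyMeasurable.integral_prod_right'.measurable
  have hint : Integrable (Function.uncurry fun (a : (ℕ × E d) × (ℕ → MarkedTree d)) (p : ℕ × ℕ) =>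
      ∫ σ, Ψ (a, p, σ) ∂κ)
      (((μ.toMeasure.prod P).prod τ).prod (spineStep μ hμ).toMeasure) :=
    integrable_of_bound hmid (C := 1)
      fun q => norm_integral_le_one (φ := fun σ => Ψ (q.1, q.2, σ)) fun σ => hΨb _
  -- The first spine step becomes the outer variable: once it is fixed, the brothers and the next
  -- spine particle are fixed distinct coordinates of the family of subtrees.
  rw [integral_integral_swap hint]
  have h3 : ∀ p : ℕ × ℕ, ∫ r, ∫ σ, Ψ (r, (p, σ)) ∂κ ∂((μ.toMeasure.prod P).prod τ) =
      ∫ ρ, (∫ T, Λ T (y ρ) ∂treeLaw μ P) ^ ((Finset.range p.1).erase p.2).card *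
        ∫ ω, Ξ ω (y ρ) ∂spineLaw μ hμ P ∂P := by
    intro p
    have hrp : Measurable fun r : (ℕ × E d) × (ℕ → MarkedTree d) => (r, p) :=
      measurable_id.prodMk measurable_const
    have hm : Measurable fun r : (ℕ × E d) × (ℕ → MarkedTree d) => ∫ σ, Ψ (r, (p, σ)) ∂κ := by
      have := hmid.comp hrp
      simp only [Function.comp_def] at this
      exact this
    have hint3 : Integrable (fun r : (ℕ × E d) × (ℕ → MarkedTree d) => ∫ σ, Ψ (r, (p, σ)) ∂κ)
        ((μ.toMeasure.prod P).prod τ) :=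
      integrable_of_bound hm (C := 1)
        fun q => norm_integral_le_one (φ := fun σ => Ψ (q, (p, σ))) fun σ => hΨb _
    rw [integral_prod _ hint3]
    have h4 : ∀ m : ℕ × E d, ∫ S, ∫ σ, Ψ ((m, S), (p, σ)) ∂κ ∂τ =
        (∫ T, Λ T (y m.2) ∂treeLaw μ P) ^ ((Finset.range p.1).erase p.2).card *
          ∫ ω, Ξ ω (y m.2) ∂spineLaw μ hμ P := by
      intro m
      have h5 : ∀ S : ℕ → MarkedTree d, ∫ σ, Ψ ((m, S), (p, σ)) ∂κ =
          (∏ i ∈ (Finset.range p.1).erase p.2, Λ (S i) (y m.2)) *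
            ∫ σ, Ξ (S p.2, σ) (y m.2) ∂κ := fun S => by rw [← integral_const_mul]
      simp_rw [h5]
      have hΞm : Measurable fun T => ∫ σ, Ξ (T, σ) (y m.2) ∂κ := by
        have : Measurable fun q : MarkedTree d × (ℕ → ℕ × ℕ) => Ξ q (y m.2) :=
          hΞ.comp (measurable_id.prodMk measurable_const)
        exact this.stronglyMeasurable.integral_prod_right'.measurable
      rw [integral_tree_prod P (Λ := fun T => Λ T (y m.2))
        (hΛ.comp (measurable_id.prodMk measurable_const)) hΞm]
      congr 1
      rw [spineLaw, integral_prod]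
      exact integrable_of_bound (hΞ.comp (measurable_id.prodMk measurable_const))
        fun ω => hΞ1 ω _
    simp_rw [h4]
    rw [integral_prod_symm]
    · simp
    · refine integrable_of_bound (C := 1) ?_ fun m => ?_
      · exact ((hlm.comp (hy.comp measurable_snd)).pow_const _).mul
          (hξm.comp (hy.comp measurable_snd))
      · rw [norm_mul, norm_pow]
        exact mul_le_one₀ (pow_le_one₀ (norm_nonneg _) (norm_integral_le_one fun T => hΛ1 T _))
          (norm_nonneg _) (norm_integral_le_one fun ω => hΞ1 ω _)
  simp_rw [h3]
  rw [integral_integral_swap]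
  · refine integral_congr_ae (.of_forall fun ρ => ?_)
    beta_reduce
    rw [integral_mul_const, integral_spineStep hμ (norm_integral_le_one fun T => hΛ1 T _)]
  · refine integrable_of_bound (C := 1) ?_ fun m => ?_
    · refine Measurable.mul ?_ (hξm.comp (hy.comp measurable_snd))
      exact (hlm.comp (hy.comp measurable_snd)).pow
        ((measurable_of_countable fun p : ℕ × ℕ =>
          ((Finset.range p.1).erase p.2).card).comp measurable_fst)
    · simp only [Function.uncurry]
      rw [norm_mul, norm_pow]
      exact mul_le_one₀ (pow_le_one₀ (norm_nonneg _) (norm_integral_le_one fun T => hΛ1 T _))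
        (norm_nonneg _) (norm_integral_le_one fun ω => hΞ1 ω _)

/-- The functions `b_{m,0} = 1`, `b_{m,K+1}(x) = ∫ F'(avg U_m (x - ρ)) b_{m+1,K}(x - ρ) P(dρ)`. -/
noncomputable def spineExp (μ : PMF ℕ) (P : Measure (E d)) (h : E d → ℂ) :
    ℕ → ℕ → E d → ℂ
  | _, 0 => fun _ => 1
  | m, K + 1 => fun x => ∫ ρ, genSlope μ (avg P (genExp μ P h m) (x - ρ))
      (avg P (genExp μ P h m) (x - ρ)) * spineExp μ P h (m + 1) K (x - ρ) ∂P

lemma integral_spineProd {h : E d → ℂ} (hh : Measurable h) (hh1 : ∀ x, ‖h x‖ ≤ 1) (m K : ℕ)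
    (x : E d) : ∫ ω, spineProd h m K ω x ∂spineLaw μ hμ P = spineExp μ P h m K x := by
  induction K generalizing m x with
  | zero => simp [spineProd, spineExp]
  | succ K ih =>
    simp_rw [spineProd_succ]
    rw [integral_spine_root hμ P (measurable_genProd hh m) (norm_genProd_le hh1 m)
      (measurable_spineProd hh (m + 1) K) (norm_spineProd_le hh1 (m + 1) K)
      (y := fun ρ => x - ρ) (by fun_prop)]
    simp_rw [integral_genProd hh hh1, ih]
    rfl

/-- Invariance of `Q*` under passing to `w_1`: the case `Λ = 1` of `integral_spine_root`, where
`F'(1) = 1` by criticality. -/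
lemma integral_comp_shift {Ξ : SpineSpace d → ℂ} (hΞ : Measurable Ξ) (hΞ1 : ∀ ω, ‖Ξ ω‖ ≤ 1) :
    ∫ ω, Ξ (shift ω) ∂spineLaw μ hμ P = ∫ ω, Ξ ω ∂spineLaw μ hμ P := by
  have h1 := integral_spine_root hμ P (Λ := fun _ _ => 1) (Ξ := fun ω _ => Ξ ω) (by fun_prop)
    (by simp) (hΞ.comp measurable_fst) (fun ω _ => hΞ1 ω) (y := fun _ => 0) (by fun_prop)
  simp only [Finset.prod_const_one, one_mul, integral_const, probReal_univ, one_smul] at h1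
  rw [h1]
  have h2 : genSlope μ 1 1 = 1 := by
    rw [genSlope_self]
    have := congrArg (fun x : ℝ => (x : ℂ)) (tsum_mean hμ)
    simpa [Complex.ofReal_tsum] using this
  rw [h2, one_mul]

end Spine

/-! ### The weights that interpolate between "no particle in `A`" and "no constraint" -/

section Weight

variable {d : ℕ}

open Classical in
/-- The weight `s^{1_A(y)} exp (f y)`. -/
noncomputable def wt (A : Set (E d)) (f : E d → ℂ) (s : ℝ) (y : E d) : ℂ :=
  (if y ∈ A then (s : ℂ) else 1) * Complex.exp (f y)

variable {A : Set (E d)} {f : E d → ℂ}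

lemma norm_exp_le_one_of_re_nonpos {z : ℂ} (hz : z.re ≤ 0) : ‖Complex.exp z‖ ≤ 1 := by
  rw [Complex.norm_exp]
  exact Real.exp_le_one_iff.2 hz

lemma Admissible.re_nonpos (hf : Admissible A f) (y : E d) : (f y).re ≤ 0 := by
  rcases hf.values y with h | h
  · exact h.2
  · exact h.le

lemma Admissible.eq_zero (hf : Admissible A f) {y : E d} (hy : y ∉ A) : f y = 0 :=
  image_eq_zero_of_notMem_tsupport fun h => hy (hf.support h)

lemma measurable_wt (hA : MeasurableSet A) (hf : Measurable f) :
    Measurable fun p : ℝ × E d => wt A f p.1 p.2 := by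
  classical
  unfold wt
  refine Measurable.mul ?_ (by fun_prop)
  exact Measurable.ite (hA.preimage measurable_snd) (by fun_prop) measurable_const

lemma measurable_wt_right (hA : MeasurableSet A) (hf : Measurable f) (s : ℝ) :
    Measurable (wt A f s) :=
  (measurable_wt hA hf).comp (measurable_const.prodMk measurable_id)

lemma norm_wt_le (hf : ∀ y, (f y).re ≤ 0) {s : ℝ} (hs : s ∈ Set.Icc (0 : ℝ) 1) (y : E d) :
    ‖wt A f s y‖ ≤ 1 := by
  rw [wt, norm_mul]
  refine mul_le_one₀ ?_ (norm_nonneg _) (norm_exp_le_one_of_re_nonpos (hf y))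
  split_ifs
  · rw [Complex.norm_real, Real.norm_of_nonneg hs.1]; exact hs.2
  · simp

lemma prod_wt (T : MarkedTree d) (n : ℕ) (x : E d) (s : ℝ) :
    ∏ u ∈ gen T n, wt A f s (x + pos T u) =
      (s : ℂ) ^ count T n {z | x + z ∈ A} *
        Complex.exp (sumOver T n fun z => f (x + z)) := by
  classical
  simp_rw [wt]
  rw [Finset.prod_mul_distrib, sumOver, Complex.exp_sum, Finset.prod_ite, Finset.prod_const_one,
    mul_one, Finset.prod_const, count]
  rfl

/-- With `N` particles in the shifted ball, `1{N ≥ 1} = 1^N - 0^N`, where `0^0 = 1`. The weights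
with `s = 1` and `s = 0` realise the two powers. -/
lemma keyExpectation_eq (μ : PMF ℕ) (P : Measure (E d)) [IsProbabilityMeasure P]
    (hA : MeasurableSet A) (hfm : Measurable f) (hf : ∀ y, (f y).re ≤ 0) (n : ℕ) (x : E d) :
    keyExpectation μ P A f n x =
      genExp μ P (wt A f 1) n x - genExp μ P (wt A f 0) n x := by
  have hm : ∀ s : ℝ, Measurable fun T : MarkedTree d =>
      ∏ u ∈ gen T n, wt A f s (x + pos T u) := by
    intro s
    cases n with
    | zero => simp [gen, pos]
    | succ n =>
      have h1 : ∀ T : MarkedTree d, ∏ u ∈ gen T (n + 1), wt A f s (x + pos T u) =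
          ∏ i ∈ Finset.range (T []).1, genProd (wt A f s) n (subtree T [i]) x := by
        intro T
        rw [prod_gen_succ]
        refine Finset.prod_congr rfl fun i _ => Finset.prod_congr rfl fun v _ => ?_
        rw [pos_append_singleton, show subtree T [i] [] = T [i] from rfl, add_assoc]
      simp_rw [h1]
      refine measurable_prod_range (measurable_pi_apply []).fst fun i => ?_
      have h2 := (measurable_genProd (measurable_wt_right hA hfm s) n).comp
        ((measurable_subtree [i]).prodMk (measurable_const (a := x)))
      simp only [Function.comp_def] at h2
      exact h2
  have hi : ∀ s ∈ Set.Icc (0 : ℝ) 1, Integrable (fun T : MarkedTree d =>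
      ∏ u ∈ gen T n, wt A f s (x + pos T u)) (treeLaw μ P) := fun s hs =>
    integrable_of_bound (hm s) (C := 1) fun T => by
      rw [norm_prod]
      exact Finset.prod_le_one (fun _ _ => norm_nonneg _) fun _ _ => norm_wt_le hf hs _
  rw [← integral_prod_gen (measurable_wt_right hA hfm 1) (norm_wt_le hf (by simp)),
    ← integral_prod_gen (measurable_wt_right hA hfm 0) (norm_wt_le hf (by simp)),
    ← integral_sub (hi 1 (by simp)) (hi 0 (by simp)), keyExpectation]
  refine integral_congr_ae (.of_forall fun T => ?_)
  beta_reduce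
  rw [prod_wt, prod_wt]
  simp_rw [add_comm x]
  rw [← sub_mul]
  congr 1
  rcases Nat.eq_zero_or_pos (count T n {z | z + x ∈ A}) with h | h
  · simp [h]
  · rw [if_pos (Nat.succ_le_of_lt h), Complex.ofReal_zero, zero_pow h.ne']
    simp

/-! ### Spine products of the weights and truncations of `G`. -/

lemma genProd_wt (T : MarkedTree d) (n : ℕ) (x : E d) (s : ℝ) :
    genProd (wt A f s) n T x = (s : ℂ) ^ count T n {z | x + (T []).2 + z ∈ A} *
      Complex.exp (sumOver T n fun z => f (x + (T []).2 + z)) :=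
  prod_wt T n (x + (T []).2) s

lemma spineProd_shift_wt (ω : SpineSpace d) (K : ℕ) (y : E d) (s : ℝ) :
    spineProd (wt A f s) 0 K (shift ω) y =
      (s : ℂ) ^ (∑ k ∈ Finset.range K, Ytilde A ω (k + 1) (y - spinePos ω (k + 1))) *
      Complex.exp (∑ k ∈ Finset.range K, Yftilde f ω (k + 1) (y - spinePos ω (k + 1))) := by
  rw [← prod_brothers_shift, ← Finset.prod_pow_eq_pow_sum, Complex.exp_sum,
    ← Finset.prod_mul_distrib]
  refine Finset.prod_congr rfl fun k _ => ?_
  simp_rw [genProd_wt]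
  rw [Finset.prod_mul_distrib, Finset.prod_pow_eq_pow_sum, ← Complex.exp_sum]
  rfl

/-- The integrand of `G`, with the two series truncated. -/
noncomputable def truncIntegrand (A : Set (E d)) (f : E d → ℂ) (K : ℕ) (y : E d)
    (ω : SpineSpace d) : ℂ :=
  (((1 + ∑ k ∈ Finset.range K,
      (Ytilde A ω (k + 1) (y - spinePos ω (k + 1)) : ℝ≥0∞))⁻¹).toReal : ℂ) *
    Complex.exp (∑ k ∈ Finset.range (K + 1), Yftilde f ω k (y - spinePos ω k))

/-- The denominator of `G` arises from `∫ s^N ds = 1/(N+1)` over `[0, 1]`, with `N` the number of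
descendants of brothers that fall in `A`. The factor `exp (f y)` is the term `k = 0` of the
exponent, the spine particle itself. -/
lemma truncIntegrand_eq (ω : SpineSpace d) (K : ℕ) (y : E d) :
    truncIntegrand A f K y ω =
      Complex.exp (f y) * ∫ s in (0 : ℝ)..1, spineProd (wt A f s) 0 K (shift ω) y := by
  simp_rw [spineProd_shift_wt]
  rw [intervalIntegral.integral_mul_const]
  have h1 : ∀ N : ℕ, ∫ s in (0 : ℝ)..1, (s : ℂ) ^ N = ((((N : ℝ) + 1)⁻¹ : ℝ) : ℂ) := by
    intro N
    have := integral_pow (a := 0) (b := 1) N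
    rw [one_pow, zero_pow (Nat.succ_ne_zero N), sub_zero, one_div] at this
    rw [← this, ← intervalIntegral.integral_ofReal]
    simp
  rw [h1, truncIntegrand, Finset.sum_range_succ', Complex.exp_add,
    show Yftilde f ω 0 (y - spinePos ω 0) = f y by simp [Yftilde, spinePos_zero]]
  set N := ∑ k ∈ Finset.range K, Ytilde A ω (k + 1) (y - spinePos ω (k + 1)) with hN
  have h2 : ∑ k ∈ Finset.range K, (Ytilde A ω (k + 1) (y - spinePos ω (k + 1)) : ℝ≥0∞) =
      (N : ℝ≥0∞) := by rw [hN]; push_cast; rfl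
  have h3 : ((1 + (N : ℝ≥0∞))⁻¹).toReal = ((N : ℝ) + 1)⁻¹ := by
    rw [ENNReal.toReal_inv, ENNReal.toReal_add (by simp) (by simp)]
    simp [add_comm]
  rw [h2, h3]
  ring

lemma norm_truncIntegrand_le (hf : ∀ y, (f y).re ≤ 0) (ω : SpineSpace d) (K : ℕ) (y : E d) :
    ‖truncIntegrand A f K y ω‖ ≤ 1 := by
  rw [truncIntegrand_eq, norm_mul]
  refine mul_le_one₀ (norm_exp_le_one_of_re_nonpos (hf y)) (norm_nonneg _) ?_
  refine (intervalIntegral.norm_integral_le_of_norm_le_const (C := 1) fun s hs => ?_).trans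
    (by simp)
  rw [Set.uIoc_of_le zero_le_one] at hs
  exact norm_spineProd_le (norm_wt_le hf ⟨hs.1.le, hs.2⟩) _ _ _ _

lemma Yftilde_eq_zero (hf : ∀ y ∉ A, f y = 0) (ω : SpineSpace d) (k : ℕ) (z : E d)
    (h : Ytilde A ω (k + 1) z = 0) : Yftilde f ω (k + 1) z = 0 := by
  classical
  rw [Ytilde, Finset.sum_eq_zero_iff] at h
  refine Finset.sum_eq_zero fun u hu => Finset.sum_eq_zero fun v hv => ?_
  have h1 := h u hu
  rw [count, Finset.card_eq_zero, Finset.filter_eq_empty_iff] at h1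
  exact hf _ (h1 hv)

lemma tendsto_truncIntegrand (hf : ∀ y, (f y).re ≤ 0) (hf0 : ∀ y ∉ A, f y = 0)
    (ω : SpineSpace d) (y : E d) :
    Tendsto (fun K => truncIntegrand A f K y ω) atTop (𝓝
      ((((1 + ∑' k : ℕ, (Ytilde A ω (k + 1) (y - spinePos ω (k + 1)) : ℝ≥0∞))⁻¹).toReal : ℂ) *
        Complex.exp (∑' k : ℕ, Yftilde f ω k (y - spinePos ω k)))) := by
  set N : ℕ → ℕ := fun k => Ytilde A ω (k + 1) (y - spinePos ω (k + 1)) with hN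
  set φ : ℕ → ℂ := fun k => Yftilde f ω k (y - spinePos ω k) with hφ
  have hφN : ∀ k, N k = 0 → φ (k + 1) = 0 := fun k hk => Yftilde_eq_zero hf0 ω k _ hk
  have hre : ∀ k, (φ k).re ≤ 0 := by
    intro k
    cases k with
    | zero => exact hf _
    | succ k =>
      simp only [hφ, Yftilde, sumOver, Complex.re_sum]
      exact Finset.sum_nonpos fun u _ => Finset.sum_nonpos fun v _ => hf _
  have h1 : Tendsto (fun K => (((1 + ∑ k ∈ Finset.range K, (N k : ℝ≥0∞))⁻¹).toReal : ℂ)) atTop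
      (𝓝 ((((1 + ∑' k : ℕ, (N k : ℝ≥0∞))⁻¹).toReal : ℂ))) := by
    have h2 : Tendsto (fun K => (1 + ∑ k ∈ Finset.range K, (N k : ℝ≥0∞))⁻¹) atTop
        (𝓝 (1 + ∑' k : ℕ, (N k : ℝ≥0∞))⁻¹) :=
      tendsto_inv_iff.2
        ((ENNReal.tendsto_nat_tsum fun k => (N k : ℝ≥0∞)).const_add 1)
    have h3 : (1 + ∑' k : ℕ, (N k : ℝ≥0∞))⁻¹ ≠ ∞ := by simp
    exact (Complex.continuous_ofReal.tendsto _).comp ((ENNReal.tendsto_toReal h3).comp h2)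
  -- If the count is infinite, the prefactor tends to `0` against an exponential of modulus at most
  -- `1`, so the value of the second series does not matter. If it is finite, its integer terms
  -- vanish eventually, hence so do those of the second series.
  by_cases htop : ∑' k : ℕ, (N k : ℝ≥0∞) = ∞
  · rw [htop] at h1 ⊢
    simp only [add_top, ENNReal.inv_top, ENNReal.toReal_zero, Complex.ofReal_zero,
      zero_mul] at h1 ⊢
    refine squeeze_zero_norm (fun K => ?_) (tendsto_norm_zero.comp h1)
    rw [truncIntegrand, norm_mul]
    refine mul_le_of_le_one_right (norm_nonneg _) (norm_exp_le_one_of_re_nonpos ?_)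
    rw [Complex.re_sum]
    exact Finset.sum_nonpos fun k _ => hre k
  · refine h1.mul ?_
    have h2 : Tendsto (fun k => (N k : ℝ≥0∞)) cofinite (𝓝 0) :=
      ENNReal.tendsto_cofinite_zero_of_tsum_ne_top htop
    rw [Nat.cofinite_eq_atTop] at h2
    have h3 : ∀ᶠ k in atTop, N k = 0 := by
      filter_upwards [h2.eventually (gt_mem_nhds (zero_lt_one (α := ℝ≥0∞)))] with k hk
      have : N k < 1 := by exact_mod_cast hk
      omega
    obtain ⟨K₀, hK₀⟩ := eventually_atTop.1 h3
    have h4 : ∀ k ∉ Finset.range (K₀ + 1), φ k = 0 := by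
      intro k hk
      rw [Finset.mem_range, not_lt] at hk
      obtain ⟨j, rfl⟩ : ∃ j, k = j + 1 := ⟨k - 1, by omega⟩
      exact hφN j (hK₀ j (by omega))
    refine (Complex.continuous_exp.tendsto _).comp ?_
    exact ((hasSum_sum_of_ne_finset_zero h4).summable.hasSum.tendsto_sum_nat).comp
      (tendsto_add_atTop_nat 1)

/-! ### The functional `G` as a limit of integrals over the interpolation parameter -/

variable {μ : PMF ℕ} (hμ : Critical μ) {P : Measure (E d)} [IsProbabilityMeasure P]

lemma continuous_spineProd_wt (K m : ℕ) (ω : SpineSpace d) (y : E d) :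
    Continuous fun s : ℝ => spineProd (wt A f s) m K ω y := by
  classical
  unfold spineProd genProd wt
  refine continuous_finsetProd _ fun k _ => continuous_finsetProd _ fun u _ =>
    continuous_finsetProd _ fun v _ => ?_
  split_ifs <;> fun_prop

/-- Joint measurability follows from continuity in `s` for fixed `ω` and measurability in `ω` for
fixed `s`. -/
lemma measurable_spineProd_wt_shift (hA : MeasurableSet A) (hfm : Measurable f) (K : ℕ) (y : E d) :
    Measurable fun p : ℝ × SpineSpace d => spineProd (wt A f p.1) 0 K (shift p.2) y := by
  have h := stronglyMeasurable_uncurry_of_continuous_of_stronglyMeasurable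
    (u := fun (s : ℝ) (ω : SpineSpace d) => spineProd (wt A f s) 0 K (shift ω) y)
    (fun ω => continuous_spineProd_wt K 0 (shift ω) y) (fun s => by
      have h1 := (measurable_spineProd (measurable_wt_right hA hfm s) 0 K).comp
        (measurable_shift.prodMk (measurable_const (a := y)))
      simp only [Function.comp_def] at h1
      exact h1.stronglyMeasurable)
  exact h.measurable

/-- Fubini in `(s, ω)`, then the invariance of `Q*` under `shift`, which turns the functional of the
shifted process into `spineExp`. -/
lemma integral_truncIntegrand (hA : MeasurableSet A) (hfm : Measurable f)
    (hf : ∀ y, (f y).re ≤ 0) (K : ℕ) (y : E d) :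
    ∫ ω, truncIntegrand A f K y ω ∂spineLaw μ hμ P =
      Complex.exp (f y) * ∫ s in (0 : ℝ)..1, spineExp μ P (wt A f s) 0 K y := by
  simp_rw [truncIntegrand_eq]
  rw [integral_const_mul]
  congr 1
  simp_rw [intervalIntegral.integral_of_le (zero_le_one (α := ℝ))]
  have hb : ∀ᵐ p ∂((volume.restrict (Set.Ioc (0 : ℝ) 1)).prod (spineLaw μ hμ P)),
      ‖spineProd (wt A f p.1) 0 K (shift p.2) y‖ ≤ 1 := by
    have h1 : ∀ᵐ s ∂volume.restrict (Set.Ioc (0 : ℝ) 1), s ∈ Set.Ioc (0 : ℝ) 1 :=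
      ae_restrict_mem measurableSet_Ioc
    have h2 := Measure.quasiMeasurePreserving_fst
      (μ := volume.restrict (Set.Ioc (0 : ℝ) 1)) (ν := spineLaw μ hμ P)
    filter_upwards [h2.ae h1] with p hp
    exact norm_spineProd_le (norm_wt_le hf ⟨hp.1.le, hp.2⟩) _ _ _ _
  have hint : Integrable (Function.uncurry fun (s : ℝ) (ω : SpineSpace d) =>
      spineProd (wt A f s) 0 K (shift ω) y)
      ((volume.restrict (Set.Ioc (0 : ℝ) 1)).prod (spineLaw μ hμ P)) :=
    .of_bound (measurable_spineProd_wt_shift hA hfm K y).aestronglyMeasurable 1 hb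
  rw [← integral_integral_swap hint]
  refine setIntegral_congr_fun measurableSet_Ioc fun s hs => ?_
  have hs' : s ∈ Set.Icc (0 : ℝ) 1 := ⟨hs.1.le, hs.2⟩
  beta_reduce
  rw [← integral_spineProd hμ P (measurable_wt_right hA hfm s) (norm_wt_le hf hs')]
  refine integral_comp_shift hμ P (Ξ := fun ω => spineProd (wt A f s) 0 K ω y) ?_
    fun ω => norm_spineProd_le (norm_wt_le hf hs') _ _ _ _
  have h1 := (measurable_spineProd (measurable_wt_right hA hfm s) 0 K).comp
    (measurable_id.prodMk (measurable_const (a := y)))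
  simp only [Function.comp_def] at h1
  exact h1

lemma tendsto_G (hA : MeasurableSet A) (hfm : Measurable f)
    (hf : ∀ y, (f y).re ≤ 0) (hf0 : ∀ y ∉ A, f y = 0) (y : E d) :
    Tendsto (fun K => Complex.exp (f y) * ∫ s in (0 : ℝ)..1, spineExp μ P (wt A f s) 0 K y) atTop
      (𝓝 (G μ hμ P A f y)) := by
  simp_rw [← integral_truncIntegrand hμ hA hfm hf]
  refine tendsto_integral_of_dominated_convergence (fun _ => 1) (fun K => ?_)
    (integrable_const 1) (fun K => .of_forall fun ω => norm_truncIntegrand_le hf ω K y)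
    (.of_forall fun ω => tendsto_truncIntegrand hf hf0 ω y)
  have h0 : truncIntegrand A f K y = fun ω => Complex.exp (f y) *
      ∫ s in (0 : ℝ)..1, spineProd (wt A f s) 0 K (shift ω) y :=
    funext fun ω => truncIntegrand_eq ω K y
  simp_rw [h0, intervalIntegral.integral_of_le (zero_le_one (α := ℝ))]
  have h1 : Measurable fun p : SpineSpace d × ℝ => spineProd (wt A f p.2) 0 K (shift p.1) y :=
    by
      have h2 := (measurable_spineProd_wt_shift hA hfm K y).comp
        (measurable_snd.prodMk (measurable_fst (α := SpineSpace d) (β := ℝ)))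
      simp only [Function.comp_def] at h2
      exact h2
  exact (measurable_const.mul h1.stronglyMeasurable.integral_prod_right'.measurable).aestronglyMeasurable

lemma measurable_avg_param {φ : ℝ → E d → ℂ} (hφ : Measurable fun p : ℝ × E d => φ p.1 p.2) :
    Measurable fun p : ℝ × E d => avg P (φ p.1) p.2 := by
  have : Measurable fun q : (ℝ × E d) × E d => φ q.1.1 (q.1.2 + q.2) :=
    hφ.comp (measurable_fst.fst.prodMk (measurable_fst.snd.add measurable_snd))
  exact this.stronglyMeasurable.integral_prod_right'.measurable

lemma measurable_genExp_wt (hA : MeasurableSet A) (hfm : Measurable f) (n : ℕ) :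
    Measurable fun p : ℝ × E d => genExp μ P (wt A f p.1) n p.2 := by
  induction n with
  | zero => exact measurable_wt hA hfm
  | succ n ih => exact measurable_genFun.comp (measurable_avg_param
    (φ := fun s => genExp μ P (wt A f s) n) ih)

lemma measurable_spineExp_wt (hA : MeasurableSet A) (hfm : Measurable f) (m K : ℕ) :
    Measurable fun p : ℝ × E d => spineExp μ P (wt A f p.1) m K p.2 := by
  induction K generalizing m with
  | zero => exact measurable_const
  | succ K ih =>
    have h1 := measurable_avg_param (P := P) (φ := fun s => genExp μ P (wt A f s) m)
      (measurable_genExp_wt hA hfm m)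
    have h2 : Measurable fun q : (ℝ × E d) × E d => (q.1.1, q.1.2 - q.2) :=
      measurable_fst.fst.prodMk (measurable_fst.snd.sub measurable_snd)
    have h3 := h1.comp h2
    exact (((measurable_genSlope (μ := μ)).comp (h3.prodMk h3)).mul
      ((ih (m + 1)).comp h2)).stronglyMeasurable.integral_prod_right'.measurable

lemma norm_spineExp_le (hμ : Critical μ) {h : E d → ℂ} (hh : ∀ x, ‖h x‖ ≤ 1) (m K : ℕ) (x : E d) :
    ‖spineExp μ P h m K x‖ ≤ 1 := by
  induction K generalizing m x with
  | zero => simp [spineExp]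
  | succ K ih =>
    refine norm_integral_le_one fun ρ => ?_
    rw [norm_mul]
    exact mul_le_one₀ (norm_genSlope_le hμ (norm_avg_le (norm_genExp_le hh m) _)
      (norm_avg_le (norm_genExp_le hh m) _)) (norm_nonneg _) (ih _ _)

lemma norm_integral_spineExp_le (hμ : Critical μ) (hf : ∀ y, (f y).re ≤ 0) (K : ℕ) (y : E d) :
    ‖Complex.exp (f y) * ∫ s in (0 : ℝ)..1, spineExp μ P (wt A f s) 0 K y‖ ≤ 1 := by
  rw [norm_mul]
  refine mul_le_one₀ (norm_exp_le_one_of_re_nonpos (hf y)) (norm_nonneg _) ?_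
  refine (intervalIntegral.norm_integral_le_of_norm_le_const (C := 1) fun s hs => ?_).trans
    (by simp)
  rw [Set.uIoc_of_le zero_le_one] at hs
  exact norm_spineExp_le hμ (norm_wt_le hf ⟨hs.1.le, hs.2⟩) _ _ _

lemma tendsto_integral_G (hA : MeasurableSet A) (hfm : Measurable f)
    (hf : ∀ y, (f y).re ≤ 0) (hf0 : ∀ y ∉ A, f y = 0) (ℓ : Measure (E d)) (hℓ : ℓ A ≠ ∞) :
    Tendsto (fun K => ∫ y in A, (Complex.exp (f y) *
        ∫ s in (0 : ℝ)..1, spineExp μ P (wt A f s) 0 K y) ∂ℓ) atTop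
      (𝓝 (∫ y in A, G μ hμ P A f y ∂ℓ)) := by
  have : IsFiniteMeasure (ℓ.restrict A) := ⟨by rw [Measure.restrict_apply_univ]; exact hℓ.lt_top⟩
  refine tendsto_integral_of_dominated_convergence (fun _ => 1) (fun K => ?_)
    (integrable_const 1) (fun K => .of_forall fun y => norm_integral_spineExp_le hμ hf K y)
    (.of_forall fun y => tendsto_G hμ hA hfm hf hf0 y)
  simp_rw [intervalIntegral.integral_of_le (zero_le_one (α := ℝ))]
  have h1 : Measurable fun p : E d × ℝ => spineExp μ P (wt A f p.2) 0 K p.1 :=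
    (measurable_spineExp_wt hA hfm 0 K).comp measurable_swap
  exact ((Complex.measurable_exp.comp hfm).mul
    h1.stronglyMeasurable.integral_prod_right'.measurable).aestronglyMeasurable

end Weight

/-! ### Random walk and comparison of the expectations with those of a random walk -/

section Walk

variable {d : ℕ}

/-- The law of the `n`-th position of the random walk with step law `P`. -/
noncomputable def walk (P : Measure (E d)) : ℕ → Measure (E d)
  | 0 => Measure.dirac 0
  | n + 1 => P.conv (walk P n)

instance (P : Measure (E d)) [IsProbabilityMeasure P] (n : ℕ) :
    IsProbabilityMeasure (walk P n) := by
  induction n with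
  | zero => unfold walk; infer_instance
  | succ n ih => unfold walk; infer_instance

/-- The probability that the random walk started from `x` is in `A` at time `n`. -/
noncomputable def hit (P : Measure (E d)) (A : Set (E d)) (n : ℕ) (x : E d) : ℝ :=
  ∫ z, A.indicator 1 (x + z) ∂walk P n

variable {P : Measure (E d)} [IsProbabilityMeasure P] {A : Set (E d)}

lemma hit_eq (hA : MeasurableSet A) (n : ℕ) (x : E d) :
    hit P A n x = (walk P n).real {z | x + z ∈ A} := by
  have : MeasurableSet {z | x + z ∈ A} := hA.preimage (measurable_const_add x)
  rw [← integral_indicator_one this]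
  rfl

lemma hit_zero (hA : MeasurableSet A) (x : E d) : hit P A 0 x = A.indicator 1 x := by
  rw [hit, walk, integral_dirac']
  · rw [add_zero]
  · exact ((measurable_one.indicator hA).comp (measurable_const_add x)).stronglyMeasurable

lemma hit_nonneg (n : ℕ) (x : E d) : 0 ≤ hit P A n x :=
  integral_nonneg fun _ => Set.indicator_nonneg (fun _ _ => zero_le_one) _

lemma hit_le_one (n : ℕ) (x : E d) : hit P A n x ≤ 1 := by
  have h := norm_integral_le_of_norm_le_const (μ := walk P n)
    (f := fun z => A.indicator (1 : E d → ℝ) (x + z)) (C := 1) (.of_forall fun z => by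
      by_cases h : x + z ∈ A <;> simp [h])
  rw [probReal_univ, mul_one] at h
  exact (le_abs_self _).trans h

lemma measurable_hit (hA : MeasurableSet A) (n : ℕ) : Measurable (hit P A n) := by
  have : Measurable fun p : E d × E d => A.indicator (1 : E d → ℝ) (p.1 + p.2) :=
    (measurable_one.indicator hA).comp measurable_add
  exact this.stronglyMeasurable.integral_prod_right'.measurable

lemma integral_walk_succ {F : Type*} [NormedAddCommGroup F] [NormedSpace ℝ F] {φ : E d → F} {n : ℕ}
    (hφ : Integrable φ (walk P (n + 1))) :
    ∫ z, φ z ∂walk P (n + 1) = ∫ ρ, ∫ z, φ (ρ + z) ∂walk P n ∂P := by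
  rw [walk]
  exact integral_conv hφ

lemma integral_hit_add (hA : MeasurableSet A) (n : ℕ) (x : E d) :
    ∫ ρ, hit P A n (x + ρ) ∂P = hit P A (n + 1) x := by
  rw [hit, integral_walk_succ]
  · simp_rw [hit, add_assoc]
  · refine .of_bound ((measurable_one.indicator hA).comp
      (measurable_const_add x)).aestronglyMeasurable 1 (.of_forall fun z => ?_)
    by_cases h : x + z ∈ A <;> simp [h]

lemma integrable_hit_add (hA : MeasurableSet A) (n : ℕ) (x : E d) :
    Integrable (fun ρ => hit P A n (x + ρ)) P :=
  .of_bound ((measurable_hit hA n).comp (measurable_const_add x)).aestronglyMeasurable 1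
    (.of_forall fun ρ => by
      rw [Real.norm_of_nonneg (hit_nonneg _ _)]; exact hit_le_one _ _)

lemma avg_avg_walk {φ : E d → ℂ} (hφ : Measurable φ) {C : ℝ} (hC : ∀ x, ‖φ x‖ ≤ C) (n : ℕ)
    (x : E d) : avg P (avg (walk P n) φ) x = avg (walk P (n + 1)) φ x := by
  conv_rhs => rw [avg]
  rw [integral_walk_succ]
  · simp_rw [avg, add_assoc]
  · exact integrable_of_bound (hφ.comp (measurable_const_add x)) fun z => hC _

lemma avg_walk_zero {φ : E d → ℂ} (hφ : Measurable φ) (x : E d) :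
    avg (walk P 0) φ x = φ x := by
  rw [avg, walk, integral_dirac']
  · rw [add_zero]
  · exact (hφ.comp (measurable_const_add x)).stronglyMeasurable

lemma norm_avg_le_of_le {φ : E d → ℂ} {ψ : E d → ℝ} (hψ : ∀ x, Integrable (fun ρ => ψ (x + ρ)) P)
    (h : ∀ x, ‖φ x‖ ≤ ψ x) (x : E d) : ‖avg P φ x‖ ≤ ∫ ρ, ψ (x + ρ) ∂P :=
  norm_integral_le_of_norm_le (hψ x) (.of_forall fun _ => h _)

lemma norm_avg_le_hit (hA : MeasurableSet A) {φ : E d → ℂ} {c : ℝ} {n : ℕ}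
    (h : ∀ x, ‖φ x‖ ≤ c * hit P A n x) (x : E d) : ‖avg P φ x‖ ≤ c * hit P A (n + 1) x := by
  rw [← integral_hit_add hA, ← integral_const_mul]
  exact norm_avg_le_of_le (ψ := fun x => c * hit P A n x)
    (fun x => (integrable_hit_add hA n x).const_mul c) h x

lemma avg_sub {φ ψ : E d → ℂ} (hφ : Measurable φ) (hψ : Measurable ψ) {C : ℝ}
    (hφC : ∀ x, ‖φ x‖ ≤ C) (hψC : ∀ x, ‖ψ x‖ ≤ C) (x : E d) :
    avg P (fun x => φ x - ψ x) x = avg P φ x - avg P ψ x :=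
  integral_sub (integrable_of_bound (hφ.comp (measurable_const_add x)) fun _ => hφC _)
    (integrable_of_bound (hψ.comp (measurable_const_add x)) fun _ => hψC _)

/-! ### Domination by hitting probabilities of the random walk. -/

variable {f : E d → ℂ} {μ : PMF ℕ}

/-- At time `0` the weight is `1` off `A` and has modulus at most `1` on `A`, whence the `2`. A step
of the recursion preserves the bound because `F` fixes `1` and, by criticality, is `1`-Lipschitz on
the unit disc, while `hit` is transported exactly by the random walk. -/
lemma norm_one_sub_genExp_le (hμ : Critical μ) (hA : MeasurableSet A) (hfm : Measurable f)
    (hf : ∀ y, (f y).re ≤ 0)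
    (hf0 : ∀ y ∉ A, f y = 0) {s : ℝ} (hs : s ∈ Set.Icc (0 : ℝ) 1) (n : ℕ) (x : E d) :
    ‖1 - genExp μ P (wt A f s) n x‖ ≤ 2 * hit P A n x := by
  induction n generalizing x with
  | zero =>
    rw [hit_zero hA, genExp]
    by_cases hx : x ∈ A
    · have h1 := norm_sub_le (1 : ℂ) (wt A f s x)
      have h2 := norm_wt_le (A := A) hf hs x
      simp only [Set.indicator_of_mem hx, Pi.one_apply]
      rw [norm_one] at h1
      linarith
    · simp [wt, hx, hf0 x hx]
  | succ n ih =>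
    have h1 := norm_genFun_sub_le hμ (a := 1) (by simp)
      (norm_avg_le (P := P) (norm_genExp_le (μ := μ) (P := P) (norm_wt_le (A := A) hf hs) n) x)
    rw [genFun_one] at h1
    refine h1.trans ?_
    have h2 := avg_sub (P := P) (φ := fun _ => 1) (C := 1) measurable_const
      (measurable_genExp (μ := μ) (P := P) (measurable_wt_right hA hfm s) n) (by simp)
      (norm_genExp_le (norm_wt_le hf hs) n) x
    rw [show avg P (fun _ => (1 : ℂ)) x = 1 by simp [avg]] at h2
    rw [← h2]
    exact norm_avg_le_hit hA ih x

lemma norm_one_sub_avg_genExp_le (hμ : Critical μ) (hA : MeasurableSet A) (hfm : Measurable f)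
    (hf : ∀ y, (f y).re ≤ 0)
    (hf0 : ∀ y ∉ A, f y = 0) {s : ℝ} (hs : s ∈ Set.Icc (0 : ℝ) 1) (n : ℕ) (x : E d) :
    ‖1 - avg P (genExp μ P (wt A f s) n) x‖ ≤ 2 * hit P A (n + 1) x := by
  have h2 := avg_sub (P := P) (φ := fun _ => 1) (C := 1) measurable_const
    (measurable_genExp (μ := μ) (P := P) (measurable_wt_right hA hfm s) n) (by simp)
    (norm_genExp_le (norm_wt_le hf hs) n) x
  rw [show avg P (fun _ => (1 : ℂ)) x = 1 by simp [avg]] at h2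
  rw [← h2]
  exact norm_avg_le_hit hA (norm_one_sub_genExp_le hμ hA hfm hf hf0 hs n) x

lemma norm_genExp_sub_le (hμ : Critical μ) (hA : MeasurableSet A) (hfm : Measurable f)
    (hf : ∀ y, (f y).re ≤ 0) {s t : ℝ} (hs : s ∈ Set.Icc (0 : ℝ) 1)
    (ht : t ∈ Set.Icc (0 : ℝ) 1) (n : ℕ) (x : E d) :
    ‖genExp μ P (wt A f s) n x - genExp μ P (wt A f t) n x‖ ≤ |s - t| * hit P A n x := by
  induction n generalizing x with
  | zero =>
    rw [hit_zero hA, genExp, genExp]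
    by_cases hx : x ∈ A
    · simp only [wt, hx, if_true, Set.indicator_of_mem hx, Pi.one_apply, mul_one]
      rw [← sub_mul, norm_mul, ← Complex.ofReal_sub, Complex.norm_real, Real.norm_eq_abs]
      exact mul_le_of_le_one_right (abs_nonneg _) (norm_exp_le_one_of_re_nonpos (hf x))
    · simp [wt, hx]
  | succ n ih =>
    refine (norm_genFun_sub_le hμ
      (norm_avg_le (norm_genExp_le (norm_wt_le hf hs) n) x)
      (norm_avg_le (norm_genExp_le (norm_wt_le hf ht) n) x)).trans ?_
    rw [← avg_sub (C := 1) (measurable_genExp (measurable_wt_right hA hfm s) n)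
      (measurable_genExp (measurable_wt_right hA hfm t) n)
      (norm_genExp_le (norm_wt_le hf hs) n) (norm_genExp_le (norm_wt_le hf ht) n)]
    exact norm_avg_le_hit hA ih x

/-- `E_n(x) = U_n^1(x) - U_n^0(x)`. -/
noncomputable def keyDiff (μ : PMF ℕ) (P : Measure (E d)) (A : Set (E d)) (f : E d → ℂ) (n : ℕ)
    (x : E d) : ℂ :=
  genExp μ P (wt A f 1) n x - genExp μ P (wt A f 0) n x

lemma measurable_keyDiff (hA : MeasurableSet A) (hfm : Measurable f) (n : ℕ) :
    Measurable (keyDiff μ P A f n) :=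
  (measurable_genExp (measurable_wt_right hA hfm 1) n).sub
    (measurable_genExp (measurable_wt_right hA hfm 0) n)

lemma norm_keyDiff_le (hμ : Critical μ) (hA : MeasurableSet A) (hfm : Measurable f)
    (hf : ∀ y, (f y).re ≤ 0) (n : ℕ) (x : E d) :
    ‖keyDiff μ P A f n x‖ ≤ hit P A n x := by
  have := norm_genExp_sub_le (P := P) hμ hA hfm hf (s := 1) (t := 0) (by simp) (by simp) n x
  simpa [keyDiff] using this

lemma keyDiff_succ (hμ : Critical μ) (hA : MeasurableSet A) (hfm : Measurable f)
    (hf : ∀ y, (f y).re ≤ 0) (n : ℕ) (x : E d) :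
    keyDiff μ P A f (n + 1) x =
      genSlope μ (avg P (genExp μ P (wt A f 1) n) x) (avg P (genExp μ P (wt A f 0) n) x) *
        avg P (keyDiff μ P A f n) x := by
  have h1 : (1 : ℝ) ∈ Set.Icc (0 : ℝ) 1 := by simp
  have h0 : (0 : ℝ) ∈ Set.Icc (0 : ℝ) 1 := by simp
  have h := avg_sub (P := P) (C := 1)
    (measurable_genExp (μ := μ) (P := P) (measurable_wt_right hA hfm 1) n)
    (measurable_genExp (μ := μ) (P := P) (measurable_wt_right hA hfm 0) n)
    (norm_genExp_le (norm_wt_le hf h1) n) (norm_genExp_le (norm_wt_le hf h0) n) x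
  rw [show avg P (keyDiff μ P A f n) x = _ from h]
  exact genFun_sub_genFun hμ (norm_avg_le (norm_genExp_le (norm_wt_le hf h1) n) x)
    (norm_avg_le (norm_genExp_le (norm_wt_le hf h0) n) x)

/-- If the slopes are close to `1`, the expectation evolves almost as for a random walk. -/
lemma norm_keyDiff_sub_avg_le (hμ : Critical μ) (hA : MeasurableSet A) (hfm : Measurable f)
    (hf : ∀ y, (f y).re ≤ 0) {ε : ℕ → ℝ} (hε : ∀ n x,
      ‖1 - genSlope μ (avg P (genExp μ P (wt A f 1) n) x)
        (avg P (genExp μ P (wt A f 0) n) x)‖ ≤ ε n) (K j : ℕ) (x : E d) :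
    ‖keyDiff μ P A f (K + j) x - avg (walk P j) (keyDiff μ P A f K) x‖ ≤
      (∑ i ∈ Finset.range j, ε (K + i)) * hit P A (K + j) x := by
  have hb : ∀ n x, ‖keyDiff μ P A f n x‖ ≤ 1 := fun n x =>
    (norm_keyDiff_le hμ hA hfm hf n x).trans (hit_le_one _ _)
  have hbw : ∀ j x, ‖avg (walk P j) (keyDiff μ P A f K) x‖ ≤ 1 := fun j x => norm_avg_le (hb K) x
  induction j generalizing x with
  | zero =>
    rw [avg_walk_zero (measurable_keyDiff hA hfm K)]
    simp
  | succ j ih =>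
    have hD := keyDiff_succ (P := P) hμ hA hfm hf (K + j) x
    have h1 := norm_avg_le_hit hA (P := P) (c := 1) (φ := keyDiff μ P A f (K + j)) (n := K + j)
      (fun x => by rw [one_mul]; exact norm_keyDiff_le hμ hA hfm hf _ x) x
    rw [one_mul] at h1
    have h2 := norm_avg_le_hit hA ih x
    rw [avg_sub (C := 1) (measurable_keyDiff hA hfm _)
      (measurable_avg (measurable_keyDiff hA hfm _)) (hb _) (hbw j),
      avg_avg_walk (measurable_keyDiff hA hfm _) (hb K)] at h2
    set D := genSlope μ (avg P (genExp μ P (wt A f 1) (K + j)) x)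
      (avg P (genExp μ P (wt A f 0) (K + j)) x)
    -- The old error, averaged over a step, plus the new defect of the slope. As `hit` at time `n`
    -- averages to `hit` at time `n + 1`, both are measured against the same function and the
    -- relative errors simply add up.
    have h3 : keyDiff μ P A f (K + (j + 1)) x - avg (walk P (j + 1)) (keyDiff μ P A f K) x =
        (avg P (keyDiff μ P A f (K + j)) x - avg (walk P (j + 1)) (keyDiff μ P A f K) x) -
          (1 - D) * avg P (keyDiff μ P A f (K + j)) x := by
      rw [← add_assoc, hD]; ring
    rw [h3, Finset.sum_range_succ, add_mul]
    refine (norm_sub_le _ _).trans (add_le_add h2 ?_)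
    rw [norm_mul]
    exact mul_le_mul (hε _ x) h1 (norm_nonneg _) ((norm_nonneg _).trans (hε _ x))

end Walk

/-! ### Differentiation with respect to the interpolation parameter -/

section Derivative

variable {d : ℕ} {P : Measure (E d)} [IsProbabilityMeasure P] {A : Set (E d)} {f : E d → ℂ}
  {μ : PMF ℕ}

/-- The point `a s` may lie on the unit circle, where `F` need not be holomorphic. The difference
quotient of `F` is `genSlope`, which is continuous on the closed bidisc, and this suffices along
paths that stay in the disc. -/
lemma hasDerivAt_genFun_comp (hμ : Critical μ) {a : ℝ → ℂ} {a' : ℂ} {s : ℝ}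
    (ha : HasDerivAt a a' s) (hb : ∀ᶠ t in 𝓝 s, ‖a t‖ ≤ 1) :
    HasDerivAt (fun t => genFun μ (a t)) (genSlope μ (a s) (a s) * a') s := by
  have hs : ‖a s‖ ≤ 1 := hb.self_of_nhds
  rw [hasDerivAt_iff_tendsto_slope] at ha ⊢
  have h1 : Tendsto (fun t => genSlope μ (a t) (a s)) (𝓝[≠] s) (𝓝 (genSlope μ (a s) (a s))) := by
    have h2 : Tendsto (fun p : ℂ × ℂ => genSlope μ p.1 p.2)
        (𝓝[Metric.closedBall 0 1 ×ˢ Metric.closedBall 0 1] (a s, a s))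
        (𝓝 (genSlope μ (a s) (a s))) := continuousOn_genSlope hμ (a s, a s) (by simp [hs])
    have hca : ContinuousAt a s := (hasDerivAt_iff_tendsto_slope.2 ha).continuousAt
    have h3 : Tendsto (fun t => (a t, a s)) (𝓝[≠] s)
        (𝓝[Metric.closedBall 0 1 ×ˢ Metric.closedBall 0 1] (a s, a s)) := by
      refine tendsto_nhdsWithin_iff.2 ⟨?_, ?_⟩
      · exact (hca.tendsto.mono_left nhdsWithin_le_nhds).prodMk_nhds tendsto_const_nhds
      · filter_upwards [hb.filter_mono nhdsWithin_le_nhds] with t ht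
        simp [ht, hs]
    have h4 := h2.comp h3
    simp only [Function.comp_def] at h4
    exact h4
  refine (h1.mul ha).congr' ?_
  filter_upwards [hb.filter_mono nhdsWithin_le_nhds] with t ht
  rw [slope_def_module, slope_def_module, genFun_sub_genFun hμ ht hs, mul_smul_comm]

/-- The derivatives `V_0 = 1_A exp f`, `V_{n+1} = F'(avg U_n) avg V_n`. -/
noncomputable def genDeriv (μ : PMF ℕ) (P : Measure (E d)) (A : Set (E d)) (f : E d → ℂ) (s : ℝ) :
    ℕ → E d → ℂ
  | 0 => A.indicator fun y => Complex.exp (f y)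
  | n + 1 => fun x => genSlope μ (avg P (genExp μ P (wt A f s) n) x)
      (avg P (genExp μ P (wt A f s) n) x) * avg P (genDeriv μ P A f s n) x

lemma measurable_genDeriv (hA : MeasurableSet A) (hfm : Measurable f) (n : ℕ) :
    Measurable fun p : ℝ × E d => genDeriv μ P A f p.1 n p.2 := by
  induction n with
  | zero =>
    exact ((Complex.measurable_exp.comp hfm).indicator hA).comp measurable_snd
  | succ n ih =>
    have h1 := measurable_avg_param (P := P) (φ := fun s => genExp μ P (wt A f s) n)
      (measurable_genExp_wt hA hfm n)
    exact ((measurable_genSlope (μ := μ)).comp (h1.prodMk h1)).mul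
      (measurable_avg_param (φ := fun s => genDeriv μ P A f s n) ih)

lemma measurable_genDeriv_right (hA : MeasurableSet A) (hfm : Measurable f) (s : ℝ) (n : ℕ) :
    Measurable (genDeriv μ P A f s n) :=
  (measurable_genDeriv hA hfm n).comp (measurable_const.prodMk measurable_id)

lemma norm_genDeriv_le (hμ : Critical μ) (hA : MeasurableSet A)
    (hf : ∀ y, (f y).re ≤ 0) {s : ℝ} (hs : s ∈ Set.Icc (0 : ℝ) 1) (n : ℕ) (x : E d) :
    ‖genDeriv μ P A f s n x‖ ≤ hit P A n x := by
  induction n generalizing x with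
  | zero =>
    rw [hit_zero hA, genDeriv]
    by_cases hx : x ∈ A
    · simpa [hx] using norm_exp_le_one_of_re_nonpos (hf x)
    · simp [hx]
  | succ n ih =>
    rw [genDeriv, norm_mul]
    have h1 := norm_avg_le_hit hA (P := P) (c := 1) (fun x => by rw [one_mul]; exact ih x) x
    rw [one_mul] at h1
    refine (mul_le_of_le_one_left (norm_nonneg _) (norm_genSlope_le hμ ?_ ?_)).trans h1 <;>
      exact norm_avg_le (norm_genExp_le (norm_wt_le hf hs) n) x

lemma lipschitzOnWith_genExp (hμ : Critical μ) (hA : MeasurableSet A) (hfm : Measurable f)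
    (hf : ∀ y, (f y).re ≤ 0) (n : ℕ) (x : E d) :
    LipschitzOnWith 1 (fun s => genExp μ P (wt A f s) n x) (Set.Icc (0 : ℝ) 1) := by
  refine LipschitzOnWith.of_dist_le_mul fun s hs t ht => ?_
  rw [dist_eq_norm, Real.dist_eq, NNReal.coe_one, one_mul]
  refine (norm_genExp_sub_le hμ hA hfm hf hs ht n x).trans ?_
  exact mul_le_of_le_one_right (abs_nonneg _) (hit_le_one _ _)

lemma hasDerivAt_genExp (hμ : Critical μ) (hA : MeasurableSet A) (hfm : Measurable f)
    (hf : ∀ y, (f y).re ≤ 0) {s : ℝ} (hs : s ∈ Set.Ioo (0 : ℝ) 1) (n : ℕ) (x : E d) :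
    HasDerivAt (fun s => genExp μ P (wt A f s) n x) (genDeriv μ P A f s n x) s := by
  induction n generalizing x with
  | zero =>
    simp only [genExp, genDeriv, wt]
    by_cases hx : x ∈ A
    · simp only [hx, if_true, Set.indicator_of_mem hx]
      simpa using (Complex.ofRealCLM.hasDerivAt (x := s)).mul_const (Complex.exp (f x))
    · simp only [hx, if_false, Set.indicator_of_notMem hx]
      exact hasDerivAt_const _ _
  | succ n ih =>
    have hnhds : Set.Icc (0 : ℝ) 1 ∈ 𝓝 s := Icc_mem_nhds hs.1 hs.2
    have h1 := (hasDerivAt_integral_of_dominated_loc_of_lip (μ := P) (x₀ := s)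
      (F := fun t ρ => genExp μ P (wt A f t) n (x + ρ))
      (F' := fun ρ => genDeriv μ P A f s n (x + ρ)) (bound := fun _ => 1) hnhds
      (.of_forall fun t => ((measurable_genExp (measurable_wt_right hA hfm t) n).comp
        (measurable_const_add x)).aestronglyMeasurable)
      (integrable_of_bound ((measurable_genExp (measurable_wt_right hA hfm s) n).comp
        (measurable_const_add x)) fun ρ =>
          norm_genExp_le (norm_wt_le hf (Set.Ioo_subset_Icc_self hs)) n _)
      ((measurable_genDeriv_right hA hfm s n).comp (measurable_const_add x)).aestronglyMeasurable
      (.of_forall fun ρ => by simpa using lipschitzOnWith_genExp hμ hA hfm hf n (x + ρ))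
      (integrable_const 1) (.of_forall fun ρ => ih (x + ρ))).2
    refine hasDerivAt_genFun_comp hμ h1 ?_
    filter_upwards [hnhds] with t ht
    exact norm_avg_le (norm_genExp_le (norm_wt_le hf ht) n) x

/-- The fundamental theorem of calculus needs the derivative only for `0 < s < 1`, where a
neighbourhood of `s` stays in the range in which the weights are bounded by `1`; continuity covers
the endpoints. -/
lemma keyDiff_eq_integral (hμ : Critical μ) (hA : MeasurableSet A) (hfm : Measurable f)
    (hf : ∀ y, (f y).re ≤ 0) (n : ℕ) (x : E d) :
    keyDiff μ P A f n x = ∫ s in (0 : ℝ)..1, genDeriv μ P A f s n x := by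
  refine (intervalIntegral.integral_eq_sub_of_hasDerivAt_of_le zero_le_one
    (lipschitzOnWith_genExp hμ hA hfm hf n x).continuousOn
    (fun s hs => hasDerivAt_genExp hμ hA hfm hf hs n x) ?_).symm
  rw [intervalIntegrable_iff_integrableOn_Ioc_of_le zero_le_one]
  refine Measure.integrableOn_of_bounded (M := 1) (by simp)
    ((measurable_genDeriv hA hfm n).comp (measurable_id.prodMk
      measurable_const)).aestronglyMeasurable ?_
  filter_upwards [ae_restrict_mem measurableSet_Ioc] with s hs
  exact (norm_genDeriv_le hμ hA hf ⟨hs.1.le, hs.2⟩ n x).trans (hit_le_one _ _)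

end Derivative

/-! ### Duality -/

section Duality

variable {d : ℕ} {P : Measure (E d)} [IsProbabilityMeasure P] {ℓ : Measure (E d)} [SFinite ℓ]

lemma integrable_comp_add {F : Type*} [NormedAddCommGroup F] {v : E d → F} (hv : Integrable v ℓ)
    (hvm : StronglyMeasurable v) (hℓ : ∀ᵐ ρ ∂P, ℓ.map (· + ρ) = ℓ) :
    Integrable (fun p : E d × E d => v (p.1 + p.2)) (ℓ.prod P) := by
  have hm : StronglyMeasurable fun p : E d × E d => v (p.1 + p.2) :=
    hvm.comp_measurable measurable_add
  refine (integrable_prod_iff' hm.aestronglyMeasurable).2 ⟨?_, ?_⟩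
  · filter_upwards [hℓ] with ρ hρ
    have : Integrable v (ℓ.map (· + ρ)) := by rwa [hρ]
    exact this.comp_measurable (measurable_add_const ρ)
  · have h1 : ∀ᵐ ρ ∂P, ∫ x, ‖v (x + ρ)‖ ∂ℓ = ∫ x, ‖v x‖ ∂ℓ := by
      filter_upwards [hℓ] with ρ hρ
      rw [← integral_map (φ := (· + ρ)) (f := fun x => ‖v x‖)
        (measurable_add_const ρ).aemeasurable hvm.norm.aestronglyMeasurable, hρ]
    exact (integrable_const _).congr (h1.mono fun ρ hρ => hρ.symm)

lemma integral_integral_add {F : Type*} [NormedAddCommGroup F] [NormedSpace ℝ F]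
    [CompleteSpace F] {v : E d → F}
    (hv : Integrable v ℓ) (hvm : StronglyMeasurable v) (hℓ : ∀ᵐ ρ ∂P, ℓ.map (· + ρ) = ℓ) :
    ∫ x, ∫ ρ, v (x + ρ) ∂P ∂ℓ = ∫ x, v x ∂ℓ := by
  rw [integral_integral_swap (integrable_comp_add hv hvm hℓ)]
  have h1 : ∀ᵐ ρ ∂P, ∫ x, v (x + ρ) ∂ℓ = ∫ x, v x ∂ℓ := by
    filter_upwards [hℓ] with ρ hρ
    rw [← integral_map (φ := (· + ρ)) (f := v)
      (measurable_add_const ρ).aemeasurable hvm.aestronglyMeasurable, hρ]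
  rw [integral_congr_ae h1]
  simp

/-- By Fubini and the substitution `x ↦ x - ρ`, the adjoint of averaging over `x + ρ` is averaging
over `x - ρ`. Invariance of `ℓ` is asked only under the steps that `P` charges, so the counting
measure of a lattice qualifies. -/
lemma integral_mul_avg {u v : E d → ℂ} (hu : Measurable u) {C : ℝ} (huC : ∀ x, ‖u x‖ ≤ C)
    (hv : Integrable v ℓ) (hvm : Measurable v) (hℓ : ∀ᵐ ρ ∂P, ℓ.map (· + ρ) = ℓ) :
    ∫ x, u x * avg P v x ∂ℓ = ∫ x, (∫ ρ, u (x - ρ) ∂P) * v x ∂ℓ := by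
  have hint := integrable_comp_add hv hvm.stronglyMeasurable hℓ
  have hint1 : Integrable (fun p : E d × E d => u p.1 * v (p.1 + p.2)) (ℓ.prod P) :=
    hint.bdd_mul (hu.comp measurable_fst).aestronglyMeasurable (.of_forall fun p => huC _)
  have hint2 : Integrable (fun p : E d × E d => u (p.1 - p.2) * v p.1) (ℓ.prod P) :=
    (hv.comp_fst P).bdd_mul (hu.comp measurable_sub).aestronglyMeasurable
      (.of_forall fun p => huC _)
  have e1 : ∀ x, u x * avg P v x = ∫ ρ, u x * v (x + ρ) ∂P := fun x => by
    rw [avg, integral_const_mul]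
  have e2 : ∀ x, (∫ ρ, u (x - ρ) ∂P) * v x = ∫ ρ, u (x - ρ) * v x ∂P := fun x => by
    rw [integral_mul_const]
  rw [integral_congr_ae (.of_forall e1), integral_congr_ae (.of_forall e2),
    integral_integral_swap (f := fun x ρ => u x * v (x + ρ)) hint1,
    integral_integral_swap (f := fun x ρ => u (x - ρ) * v x) hint2]
  refine integral_congr_ae ?_
  filter_upwards [hℓ] with ρ hρ
  have h1 := integral_map (μ := ℓ) (φ := (· + ρ)) (f := fun x => u (x - ρ) * v x)
    (measurable_add_const ρ).aemeasurable
    (((hu.comp (measurable_sub_const ρ)).mul hvm).aestronglyMeasurable)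
  rw [hρ] at h1
  simp only [add_sub_cancel_right] at h1
  exact h1.symm

variable {A : Set (E d)} {f : E d → ℂ} {μ : PMF ℕ}

lemma integrable_hit (hA : MeasurableSet A) (hℓA : ℓ A ≠ ∞) (hℓ : ∀ᵐ ρ ∂P, ℓ.map (· + ρ) = ℓ)
    (n : ℕ) : Integrable (hit P A n) ℓ := by
  induction n with
  | zero =>
    have : hit P A 0 = A.indicator 1 := funext fun x => hit_zero hA x
    rw [this]
    exact (integrable_indicator_iff hA).2 (integrableOn_const hℓA)
  | succ n ih =>
    have h := (integrable_comp_add ih (measurable_hit hA n).stronglyMeasurable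
      hℓ).integral_prod_left
    exact h.congr (.of_forall fun x => integral_hit_add hA n x)

lemma integrable_genDeriv (hμ : Critical μ) (hA : MeasurableSet A) (hfm : Measurable f)
    (hf : ∀ y, (f y).re ≤ 0) (hℓA : ℓ A ≠ ∞) (hℓ : ∀ᵐ ρ ∂P, ℓ.map (· + ρ) = ℓ)
    {s : ℝ} (hs : s ∈ Set.Icc (0 : ℝ) 1) (n : ℕ) : Integrable (genDeriv μ P A f s n) ℓ :=
  (integrable_hit hA hℓA hℓ n).mono' (measurable_genDeriv_right hA hfm s n).aestronglyMeasurable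
    (.of_forall fun x => norm_genDeriv_le hμ hA hf hs n x)

lemma integrable_keyDiff (hμ : Critical μ) (hA : MeasurableSet A) (hfm : Measurable f)
    (hf : ∀ y, (f y).re ≤ 0) (hℓA : ℓ A ≠ ∞) (hℓ : ∀ᵐ ρ ∂P, ℓ.map (· + ρ) = ℓ)
    (n : ℕ) : Integrable (keyDiff μ P A f n) ℓ :=
  (integrable_hit hA hℓA hℓ n).mono' (measurable_keyDiff hA hfm n).aestronglyMeasurable
    (.of_forall fun x => norm_keyDiff_le hμ hA hfm hf n x)

lemma measurable_spineExp_right (hA : MeasurableSet A) (hfm : Measurable f) (s : ℝ) (m K : ℕ) :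
    Measurable (spineExp μ P (wt A f s) m K) :=
  (measurable_spineExp_wt hA hfm m K).comp (measurable_const.prodMk measurable_id)

/-- Each induction step transposes one operator `F'(avg U_m) · avg`, moving it from the derivative
to the spine functional. For `m = 0` only `V_0 = 1_A exp f` is left on the side of the derivative:
the spine is the line of descent read backwards from the particle in `A`. -/
lemma integral_genDeriv_mul_spineExp (hμ : Critical μ) (hA : MeasurableSet A)
    (hfm : Measurable f) (hf : ∀ y, (f y).re ≤ 0) (hℓA : ℓ A ≠ ∞)
    (hℓ : ∀ᵐ ρ ∂P, ℓ.map (· + ρ) = ℓ) {s : ℝ} (hs : s ∈ Set.Icc (0 : ℝ) 1) (m K : ℕ) :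
    ∫ x, spineExp μ P (wt A f s) m K x * genDeriv μ P A f s m x ∂ℓ =
      ∫ x, genDeriv μ P A f s (m + K) x ∂ℓ := by
  induction K generalizing m with
  | zero => simp [spineExp]
  | succ K ih =>
    have h1 : ∀ x, ‖avg P (genExp μ P (wt A f s) m) x‖ ≤ 1 := fun x =>
      norm_avg_le (norm_genExp_le (norm_wt_le hf hs) m) x
    have h2 := measurable_avg (P := P) (measurable_genExp (μ := μ) (P := P)
      (measurable_wt_right hA hfm s) m)
    have h3 := integral_mul_avg (P := P) (ℓ := ℓ) (u := fun x =>
      genSlope μ (avg P (genExp μ P (wt A f s) m) x) (avg P (genExp μ P (wt A f s) m) x) *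
        spineExp μ P (wt A f s) (m + 1) K x) (v := genDeriv μ P A f s m) (C := 1)
      (((measurable_genSlope (μ := μ)).comp (h2.prodMk h2)).mul
        (measurable_spineExp_right hA hfm s _ _))
      (fun x => by
        rw [norm_mul]
        exact mul_le_one₀ (norm_genSlope_le hμ (h1 x) (h1 x)) (norm_nonneg _)
          (norm_spineExp_le hμ (norm_wt_le hf hs) _ _ _))
      (integrable_genDeriv hμ hA hfm hf hℓA hℓ hs m) (measurable_genDeriv_right hA hfm s m) hℓ
    rw [show m + (K + 1) = m + 1 + K by ring, ← ih (m + 1)]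
    refine h3.symm.trans (integral_congr_ae (.of_forall fun x => ?_))
    simp only [genDeriv]
    ring

lemma integral_keyDiff (hμ : Critical μ) (hA : MeasurableSet A) (hfm : Measurable f)
    (hf : ∀ y, (f y).re ≤ 0) (hℓA : ℓ A ≠ ∞) (hℓ : ∀ᵐ ρ ∂P, ℓ.map (· + ρ) = ℓ) (K : ℕ) :
    ∫ x, keyDiff μ P A f K x ∂ℓ =
      ∫ y in A, (Complex.exp (f y) * ∫ s in (0 : ℝ)..1, spineExp μ P (wt A f s) 0 K y) ∂ℓ := by
  have : IsFiniteMeasure (ℓ.restrict A) := ⟨by rw [Measure.restrict_apply_univ]; exact hℓA.lt_top⟩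
  simp_rw [keyDiff_eq_integral hμ hA hfm hf, intervalIntegral.integral_of_le (zero_le_one (α := ℝ))]
  have hIoc : ∀ {ℓ' : Measure (E d)} [SFinite ℓ'],
      ∀ᵐ p ∂ℓ'.prod (volume.restrict (Set.Ioc (0 : ℝ) 1)), p.2 ∈ Set.Ioc (0 : ℝ) 1 := by
    intro ℓ' _
    exact (Measure.quasiMeasurePreserving_snd (μ := ℓ')
      (ν := volume.restrict (Set.Ioc (0 : ℝ) 1))).ae (ae_restrict_mem measurableSet_Ioc)
  have hint1 : Integrable (Function.uncurry fun (x : E d) (s : ℝ) => genDeriv μ P A f s K x)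
      (ℓ.prod (volume.restrict (Set.Ioc (0 : ℝ) 1))) := by
    refine ((integrable_hit (P := P) hA hℓA hℓ K).comp_fst _).mono'
      ((measurable_genDeriv hA hfm K).comp measurable_swap).aestronglyMeasurable ?_
    filter_upwards [hIoc] with p hp
    exact norm_genDeriv_le hμ hA hf ⟨hp.1.le, hp.2⟩ K p.1
  have hint2 : Integrable (Function.uncurry fun (y : E d) (s : ℝ) =>
      Complex.exp (f y) * spineExp μ P (wt A f s) 0 K y)
      ((ℓ.restrict A).prod (volume.restrict (Set.Ioc (0 : ℝ) 1))) := by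
    refine Integrable.of_bound (((Complex.measurable_exp.comp hfm).comp measurable_fst).mul
      ((measurable_spineExp_wt hA hfm 0 K).comp measurable_swap)).aestronglyMeasurable 1 ?_
    filter_upwards [hIoc] with p hp
    simp only [Function.uncurry, norm_mul]
    exact mul_le_one₀ (norm_exp_le_one_of_re_nonpos (hf _)) (norm_nonneg _)
      (norm_spineExp_le hμ (norm_wt_le hf ⟨hp.1.le, hp.2⟩) _ _ _)
  simp_rw [← integral_const_mul]
  rw [integral_integral_swap hint1, integral_integral_swap hint2]
  refine setIntegral_congr_fun measurableSet_Ioc fun s hs => ?_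
  have hs' : s ∈ Set.Icc (0 : ℝ) 1 := ⟨hs.1.le, hs.2⟩
  have h := integral_genDeriv_mul_spineExp (P := P) (ℓ := ℓ) hμ hA hfm hf hℓA hℓ hs' 0 K
  rw [zero_add] at h
  beta_reduce
  rw [← h, ← integral_indicator hA]
  refine integral_congr_ae (.of_forall fun x => ?_)
  by_cases hx : x ∈ A
  · simp only [genDeriv, Set.indicator_of_mem hx]
    ring
  · simp [genDeriv, Set.indicator_of_notMem hx]

end Duality

/-! ### From local limit theorems to the asymptotics of the branching random walk -/

section Main

variable {d : ℕ} {P : Measure (E d)} [IsProbabilityMeasure P] {ℓ : Measure (E d)} [SFinite ℓ]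
  {A : Set (E d)} {f : E d → ℂ} {μ : PMF ℕ}

/-- A local limit theorem for the random walk with step law `P`: `ℓ` is the reference measure,
`n^{-θ} g_n` the local asymptotics in the domains `D_n`. -/
structure LocalLimit (P : Measure (E d)) (A : Set (E d)) (ℓ : Measure (E d)) (θ : ℝ)
    (D : ℕ → Set (E d)) (g : ℕ → E d → ℝ) : Prop where
  invariant : ∀ᵐ ρ ∂P, ℓ.map (· + ρ) = ℓ
  concentration : ∃ C : ℝ, ∀ (n : ℕ) x, hit P A (n + 1) x ≤ C * ((n : ℝ) + 1) ^ (-θ)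
  bounded : ∃ C : ℝ, ∀ n, ∀ x ∈ D n, |g n x| ≤ C
  positive : ∃ c : ℝ, 0 < c ∧ ∀ᶠ n in atTop, ∀ x ∈ D n, c ≤ g n x
  zero_mem : ∀ n, 0 ∈ D n
  limit : ∀ V : E d → ℂ, Measurable V → Integrable V ℓ → ∀ (K : ℕ) (x : ℕ → E d),
    (∀ n, x n ∈ D n) → Tendsto (fun n : ℕ => ((n : ℝ) ^ θ : ℝ) * avg (walk P (n - K)) V (x n) -
      g n (x n) * ∫ y, V y ∂ℓ) atTop (𝓝 0)

/-- The moment condition `∑ k^{1+γ} μ(k) < ∞` in terms of real numbers. -/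
lemma summable_moment {γ : ℝ}
    (h : ∑' k : ℕ, (k : ℝ≥0∞) ^ (1 + γ) * μ k < ∞) :
    Summable fun k : ℕ => (μ k).toReal * (k : ℝ) ^ (1 + γ) := by
  refine (ENNReal.summable_toReal h.ne).congr fun k => ?_
  rw [ENNReal.toReal_mul, ← ENNReal.toReal_rpow, ENNReal.toReal_natCast, mul_comm]

/-- Hitting probabilities of order `n^{-θ}` make `1 - slope` of order `n^{-θγ}`. The condition `θγ >
1` is where the dimension enters: it reads `d > 2` for finite variance and `d > α/γ` for stable
motion. -/
lemma exists_slope_bound (hμ : Critical μ) (hA : MeasurableSet A) (hfm : Measurable f)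
    (hf : ∀ y, (f y).re ≤ 0) (hf0 : ∀ y ∉ A, f y = 0) {γ θ : ℝ} (hγ0 : 0 < γ) (hγ1 : γ ≤ 1)
    (hm : Summable fun k : ℕ => (μ k).toReal * (k : ℝ) ^ (1 + γ)) (hθ : 1 < θ * γ)
    (hc : ∃ C : ℝ, ∀ (n : ℕ) x, hit P A (n + 1) x ≤ C * ((n : ℝ) + 1) ^ (-θ)) :
    ∃ ε : ℕ → ℝ, Summable ε ∧ ∀ n x, ‖1 - genSlope μ (avg P (genExp μ P (wt A f 1) n) x)
      (avg P (genExp μ P (wt A f 0) n) x)‖ ≤ ε n := by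
  obtain ⟨C, hC⟩ := hc
  have hC0 : 0 ≤ C := by
    have h1 := (hit_nonneg (P := P) (A := A) 1 0).trans (hC 0 0)
    simpa using h1
  set M := ∑' k : ℕ, (μ k).toReal * (k : ℝ) ^ (1 + γ)
  refine ⟨fun n => 2 * M * (2 * (C * ((n : ℝ) + 1) ^ (-θ))) ^ γ, ?_, fun n x => ?_⟩
  · have h1 : Summable fun n : ℕ => ((n + 1 : ℕ) : ℝ) ^ (-(θ * γ)) :=
      (summable_nat_add_iff 1).2 (Real.summable_nat_rpow.2 (by linarith))
    refine (h1.mul_left (2 * M * (2 * C) ^ γ)).congr fun n => ?_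
    have hn : (0 : ℝ) < (n : ℝ) + 1 := by positivity
    rw [← mul_assoc 2 C, Real.mul_rpow (x := 2 * C) (by positivity) (by positivity),
      ← Real.rpow_mul hn.le, neg_mul, Nat.cast_succ, mul_assoc]
  · have h1 : (1 : ℝ) ∈ Set.Icc (0 : ℝ) 1 := by simp
    have h0 : (0 : ℝ) ∈ Set.Icc (0 : ℝ) 1 := by simp
    have hle : 2 * hit P A (n + 1) x ≤ 2 * (C * ((n : ℝ) + 1) ^ (-θ)) := by
      linarith [hC n x]
    exact norm_one_sub_genSlope_le hμ hγ0 hγ1 hm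
      (norm_avg_le (norm_genExp_le (norm_wt_le hf h1) n) x)
      (norm_avg_le (norm_genExp_le (norm_wt_le hf h0) n) x)
      ((norm_one_sub_avg_genExp_le hμ hA hfm hf hf0 h1 n x).trans hle)
      ((norm_one_sub_avg_genExp_le hμ hA hfm hf hf0 h0 n x).trans hle)

lemma tendsto_integral_keyDiff (hμ : Critical μ) (hA : MeasurableSet A) (hfm : Measurable f)
    (hf : ∀ y, (f y).re ≤ 0) (hf0 : ∀ y ∉ A, f y = 0) (hℓA : ℓ A ≠ ∞)
    (hℓ : ∀ᵐ ρ ∂P, ℓ.map (· + ρ) = ℓ) :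
    Tendsto (fun K => ∫ x, keyDiff μ P A f K x ∂ℓ) atTop (𝓝 (∫ y in A, G μ hμ P A f y ∂ℓ)) := by
  simp_rw [integral_keyDiff hμ hA hfm hf hℓA hℓ]
  exact tendsto_integral_G hμ hA hfm hf hf0 ℓ hℓA

/-- Compare with the random walk started from the profile `D_K`. Replacing the branching after time
`K` costs `C` times the tail of `ε`, and replacing `∫ D_K dℓ` by its limit costs `B` times their
distance. Both are small for a suitable `K`, which is fixed first; the error of the local limit
theorem vanishes as `n → ∞`. -/
theorem tendsto_keyDiff (hμ : Critical μ) (hA : MeasurableSet A) (hfm : Measurable f)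
    (hf : ∀ y, (f y).re ≤ 0) (hf0 : ∀ y ∉ A, f y = 0) (hℓA : ℓ A ≠ ∞) {γ θ : ℝ} (hγ0 : 0 < γ)
    (hγ1 : γ ≤ 1) (hm : Summable fun k : ℕ => (μ k).toReal * (k : ℝ) ^ (1 + γ))
    (hθ : 1 < θ * γ) {D : ℕ → Set (E d)} {g : ℕ → E d → ℝ} (hL : LocalLimit P A ℓ θ D g)
    {x : ℕ → E d} (hx : ∀ n, x n ∈ D n) :
    Tendsto (fun n : ℕ => ((n : ℝ) ^ θ : ℝ) * keyDiff μ P A f n (x n) -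
      g n (x n) * ∫ y in A, G μ hμ P A f y ∂ℓ) atTop (𝓝 0) := by
  set I := ∫ y in A, G μ hμ P A f y ∂ℓ
  obtain ⟨ε, hεs, hε⟩ := exists_slope_bound (P := P) hμ hA hfm hf hf0 hγ0 hγ1 hm hθ hL.concentration
  have hε0 : ∀ n, 0 ≤ ε n := fun n => (norm_nonneg _).trans (hε n 0)
  obtain ⟨C, hC⟩ := hL.concentration
  obtain ⟨B, hB⟩ := hL.bounded
  have hC0 : 0 ≤ C := by
    have h1 := (hit_nonneg (P := P) (A := A) 1 0).trans (hC 0 0)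
    simpa using h1
  have hB0 : 0 ≤ B := (abs_nonneg _).trans (hB 0 _ (hx 0))
  have hJ := tendsto_integral_keyDiff (P := P) hμ hA hfm hf hf0 hℓA hL.invariant
  rw [Metric.tendsto_atTop]
  intro η hη
  have ht : Tendsto (fun K => C * (∑' i, ε (i + K)) +
      B * ‖(∫ x, keyDiff μ P A f K x ∂ℓ) - I‖) atTop (𝓝 (C * 0 + B * 0)) :=
    ((tendsto_sum_nat_add ε).const_mul C).add
      ((tendsto_iff_norm_sub_tendsto_zero.1 hJ).const_mul B)
  rw [mul_zero, mul_zero, add_zero] at ht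
  obtain ⟨K, hK⟩ := (ht.eventually (gt_mem_nhds (half_pos hη))).exists
  have hV := hL.limit _ (measurable_keyDiff hA hfm K)
    (integrable_keyDiff (P := P) hμ hA hfm hf hℓA hL.invariant K) K x hx
  rw [Metric.tendsto_atTop] at hV
  obtain ⟨N, hN⟩ := hV (η / 2) (half_pos hη)
  -- Requiring `n ≥ K + 1` ensures `n ≥ 1`, since the concentration bound does not cover time `0`.
  refine ⟨max N (K + 1), fun n hn => ?_⟩
  have hnN : N ≤ n := (le_max_left _ _).trans hn
  have hnK : K + 1 ≤ n := (le_max_right _ _).trans hn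
  have h1 := hN n hnN
  rw [dist_zero_right] at h1 ⊢
  obtain ⟨j, rfl⟩ : ∃ j, n = K + j := ⟨n - K, by omega⟩
  rw [Nat.add_sub_cancel_left] at h1
  have h2 := norm_keyDiff_sub_avg_le (P := P) hμ hA hfm hf hε K j (x (K + j))
  have h3 : ∑ i ∈ Finset.range j, ε (K + i) ≤ ∑' i, ε (i + K) := by
    simp_rw [add_comm K]
    exact ((summable_nat_add_iff K).2 hεs).sum_le_tsum _ fun i _ => hε0 _
  have h4 : ((K + j : ℕ) : ℝ) ^ θ * hit P A (K + j) (x (K + j)) ≤ C := by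
    obtain ⟨m, hm⟩ : ∃ m, K + j = m + 1 := ⟨K + j - 1, by omega⟩
    rw [hm]
    have hpos : (0 : ℝ) < (m : ℝ) + 1 := by positivity
    have h5 := mul_le_mul_of_nonneg_left (hC m (x (m + 1))) (Real.rpow_nonneg hpos.le θ)
    rw [mul_left_comm, ← Real.rpow_add hpos, add_neg_cancel, Real.rpow_zero, mul_one] at h5
    push_cast
    exact h5
  have hpow : 0 ≤ ((K + j : ℕ) : ℝ) ^ θ := by positivity
  have hhit := hit_nonneg (P := P) (A := A) (K + j) (x (K + j))
  have hsum0 : 0 ≤ ∑' i, ε (i + K) := tsum_nonneg fun i => hε0 _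
  have e1 : ((((K + j : ℕ) : ℝ) ^ θ : ℝ) : ℂ) * keyDiff μ P A f (K + j) (x (K + j)) -
      g (K + j) (x (K + j)) * I =
      ((((K + j : ℕ) : ℝ) ^ θ : ℝ) : ℂ) * (keyDiff μ P A f (K + j) (x (K + j)) -
        avg (walk P j) (keyDiff μ P A f K) (x (K + j))) +
      ((((((K + j : ℕ) : ℝ) ^ θ : ℝ) : ℂ) * avg (walk P j) (keyDiff μ P A f K) (x (K + j)) -
        g (K + j) (x (K + j)) * ∫ y, keyDiff μ P A f K y ∂ℓ) +
      g (K + j) (x (K + j)) * ((∫ y, keyDiff μ P A f K y ∂ℓ) - I)) := by ring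
  rw [e1]
  refine (norm_add_le _ _).trans_lt ?_
  have h5 : ‖((((K + j : ℕ) : ℝ) ^ θ : ℝ) : ℂ) * (keyDiff μ P A f (K + j) (x (K + j)) -
      avg (walk P j) (keyDiff μ P A f K) (x (K + j)))‖ ≤ C * ∑' i, ε (i + K) := by
    rw [norm_mul, Complex.norm_real, Real.norm_of_nonneg hpow]
    calc _ ≤ ((K + j : ℕ) : ℝ) ^ θ * ((∑' i, ε (i + K)) * hit P A (K + j) (x (K + j))) := by
          gcongr
          exact h2.trans (mul_le_mul_of_nonneg_right h3 hhit)
      _ = (((K + j : ℕ) : ℝ) ^ θ * hit P A (K + j) (x (K + j))) * ∑' i, ε (i + K) := by ring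
      _ ≤ _ := mul_le_mul_of_nonneg_right h4 hsum0
  have h6 : ‖(g (K + j) (x (K + j)) : ℂ) * ((∫ y, keyDiff μ P A f K y ∂ℓ) - I)‖ ≤
      B * ‖(∫ x, keyDiff μ P A f K x ∂ℓ) - I‖ := by
    rw [norm_mul, Complex.norm_real]
    exact mul_le_mul_of_nonneg_right (hB _ _ (hx _)) (norm_nonneg _)
  have h7 := norm_add_le (((((K + j : ℕ) : ℝ) ^ θ : ℝ) : ℂ) *
    avg (walk P j) (keyDiff μ P A f K) (x (K + j)) -
        g (K + j) (x (K + j)) * ∫ y, keyDiff μ P A f K y ∂ℓ)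
      (g (K + j) (x (K + j)) * ((∫ y, keyDiff μ P A f K y ∂ℓ) - I))
  linarith

theorem uniformAsymp_keyExpectation (hμ : Critical μ) (hA : MeasurableSet A) (hfm : Measurable f)
    (hf : ∀ y, (f y).re ≤ 0) (hf0 : ∀ y ∉ A, f y = 0) (hℓA : ℓ A ≠ ∞) {γ θ : ℝ} (hγ0 : 0 < γ)
    (hγ1 : γ ≤ 1) (hm : Summable fun k : ℕ => (μ k).toReal * (k : ℝ) ^ (1 + γ))
    (hθ : 1 < θ * γ) {D : ℕ → Set (E d)} {g : ℕ → E d → ℝ} (hL : LocalLimit P A ℓ θ D g) :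
    UniformAsymp D (keyExpectation μ P A f) (fun n x => (n : ℝ) ^ (-θ) * g n x)
      (∫ y in A, G μ hμ P A f y ∂ℓ) := by
  set I := ∫ y in A, G μ hμ P A f y ∂ℓ
  intro ε hε
  obtain ⟨c, hc, hg⟩ := hL.positive
  by_contra hcon
  rw [not_eventually] at hcon
  classical
  set bad : ℕ → E d → Prop := fun n x => x ∈ D n ∧ ¬ ∃ δ : ℂ, ‖δ‖ ≤ ε ∧
    keyExpectation μ P A f n x = (((n : ℝ) ^ (-θ) * g n x : ℝ) : ℂ) * (I + δ)
  -- Uniformity is obtained from sequences: choose a point violating the claim whenever there is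
  -- one, and the admissible point `0` otherwise.
  set x : ℕ → E d := fun n => if h : ∃ y, bad n y then h.choose else 0 with hxdef
  have hx : ∀ n, x n ∈ D n := by
    intro n
    simp only [hxdef]
    split_ifs with h
    · exact h.choose_spec.1
    · exact hL.zero_mem n
  have ht := tendsto_keyDiff hμ hA hfm hf hf0 hℓA hγ0 hγ1 hm hθ hL hx
  rw [Metric.tendsto_nhds] at ht
  have h1 := (ht (ε * c) (mul_pos hε hc)).and (hg.and (eventually_gt_atTop 0))
  obtain ⟨n, hn, h2, h3, h4⟩ := (hcon.and_eventually h1).exists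
  have hex : ∃ y, bad n y := by
    by_contra hne
    exact hn fun y hy => by
      by_contra hδ
      exact hne ⟨y, hy, hδ⟩
  have hbad : bad n (x n) := by
    have : x n = hex.choose := by simp only [hxdef]; rw [dif_pos hex]
    rw [this]; exact hex.choose_spec
  have hgn : c ≤ g n (x n) := h3 _ (hx n)
  have hgpos : 0 < g n (x n) := hc.trans_le hgn
  have hgne : (g n (x n) : ℂ) ≠ 0 := by exact_mod_cast hgpos.ne'
  have hnpos : (0 : ℝ) < n := by exact_mod_cast h4
  -- This `δ` is the solution of the required equation; the lower bound `c` for `g` makes it at most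
  -- `ε`.
  refine hbad.2 ⟨((n : ℝ) ^ θ : ℝ) * keyDiff μ P A f n (x n) / g n (x n) - I, ?_, ?_⟩
  · have e1 : (((n : ℝ) ^ θ : ℝ) : ℂ) * keyDiff μ P A f n (x n) / g n (x n) - I =
        ((((n : ℝ) ^ θ : ℝ) : ℂ) * keyDiff μ P A f n (x n) - g n (x n) * I) / g n (x n) := by
      field_simp
    rw [dist_zero_right] at h2
    rw [e1, norm_div, Complex.norm_real, Real.norm_of_nonneg hgpos.le, div_le_iff₀ hgpos]
    exact h2.le.trans (by gcongr)
  · rw [keyExpectation_eq μ P hA hfm hf, add_sub_cancel, Real.rpow_neg hnpos.le]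
    have hp : (((n : ℝ) ^ θ : ℝ) : ℂ) ≠ 0 := by
      exact_mod_cast (Real.rpow_pos_of_pos hnpos θ).ne'
    push_cast
    rw [keyDiff]
    field_simp

lemma UniformAsymp.uniformEquiv {D : ℕ → Set (E d)} {F : ℕ → E d → ℂ} {g : ℕ → E d → ℝ} {I : ℂ}
    (h : UniformAsymp D F g I) (hI : I ≠ 0) : UniformEquiv D F g I := by
  intro ε hε
  have hI' : 0 < ‖I‖ := norm_pos_iff.2 hI
  filter_upwards [h (ε * ‖I‖) (mul_pos hε hI')] with n hn x hx
  obtain ⟨δ, hδ, he⟩ := hn x hx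
  refine ⟨δ / I, ?_, ?_⟩
  · rwa [norm_div, div_le_iff₀ hI']
  · rw [he]
    field_simp

end Main

/-! ### Positivity of the constant for real `f` -/

section Positivity

variable {d : ℕ} {P : Measure (E d)} [IsProbabilityMeasure P] {ℓ : Measure (E d)} [SFinite ℓ]
  {A : Set (E d)} {f : E d → ℂ} {μ : PMF ℕ}

lemma genFun_ofReal {r : ℝ} (h0 : 0 ≤ r) (h1 : r ≤ 1) :
    ∃ t : ℝ, 0 ≤ t ∧ (0 < r → 0 < t) ∧ genFun μ r = t := by
  have hs : Summable fun k => (μ k).toReal * r ^ k :=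
    (summable_toReal μ).of_nonneg_of_le (fun k => by positivity)
      fun k => mul_le_of_le_one_right ENNReal.toReal_nonneg (pow_le_one₀ h0 h1)
  refine ⟨∑' k, (μ k).toReal * r ^ k, tsum_nonneg fun k => by positivity, fun hr => ?_, ?_⟩
  · obtain ⟨k, hk⟩ : ∃ k, μ k ≠ 0 := by
      obtain ⟨k, hk⟩ := μ.support_nonempty
      exact ⟨k, hk⟩
    exact hs.tsum_pos (fun k => by positivity) k
      (mul_pos (ENNReal.toReal_pos hk (μ.apply_ne_top k)) (by positivity))
  · rw [Complex.ofReal_tsum, genFun]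
    push_cast
    rfl

lemma genSlope_ofReal (hμ : Critical μ) {a b : ℝ} (ha0 : 0 ≤ a) (ha1 : a ≤ 1) (hb0 : 0 ≤ b)
    (hb1 : b ≤ 1) : ∃ t : ℝ, 0 ≤ t ∧ (0 < a → 0 < t) ∧ genSlope μ a b = t := by
  have hle : ∀ k, ∑ j ∈ Finset.range k, a ^ j * b ^ (k - 1 - j) ≤ k := fun k => by
    refine (Finset.sum_le_sum (g := fun _ => (1 : ℝ)) fun j _ => ?_).trans (by simp)
    exact mul_le_one₀ (pow_le_one₀ ha0 ha1) (by positivity) (pow_le_one₀ hb0 hb1)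
  have hs : Summable fun k => (μ k).toReal * ∑ j ∈ Finset.range k, a ^ j * b ^ (k - 1 - j) :=
    (summable_mean hμ).of_nonneg_of_le (fun k => by positivity)
      fun k => mul_le_mul_of_nonneg_left (hle k) ENNReal.toReal_nonneg
  refine ⟨∑' k, (μ k).toReal * ∑ j ∈ Finset.range k, a ^ j * b ^ (k - 1 - j),
    tsum_nonneg fun k => by positivity, fun hr => ?_, ?_⟩
  · obtain ⟨k, hk⟩ : ∃ k : ℕ, (k : ℝ≥0∞) * μ k ≠ 0 := by
      by_contra! h
      have h1 : ∑' k : ℕ, (k : ℝ≥0∞) * μ k = 1 := hμ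
      simp [h] at h1
    have hk0 : k ≠ 0 := by rintro rfl; simp at hk
    have hk1 : μ k ≠ 0 := fun h => hk (by rw [h, mul_zero])
    refine hs.tsum_pos (fun k => by positivity) k
      (mul_pos (ENNReal.toReal_pos hk1 (μ.apply_ne_top k)) ?_)
    -- The term `j = k - 1` is `a^{k-1}` and does not involve `b`, so positivity of `a` is enough.
    refine Finset.sum_pos' (fun j _ => by positivity)
      ⟨k - 1, Finset.mem_range.2 (by omega), ?_⟩
    rw [Nat.sub_self, pow_zero, mul_one]
    positivity
  · rw [Complex.ofReal_tsum, genSlope]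
    push_cast
    rfl

lemma avg_ofReal (r : E d → ℝ) (x : E d) :
    avg P (fun y => (r y : ℂ)) x = ((∫ ρ, r (x + ρ) ∂P : ℝ) : ℂ) :=
  integral_ofReal

/-- Strict positivity is claimed only for `s = 1`, because the weight with `s = 0` vanishes on `A`.
By `genSlope_ofReal` this already makes the slope between the two positive. -/
lemma genExp_wt_ofReal (hA : MeasurableSet A) (hfm : Measurable f) (hf : ∀ y, (f y).re ≤ 0)
    (hfr : ∀ y, (f y).im = 0) {s : ℝ} (hs : s ∈ Set.Icc (0 : ℝ) 1) (n : ℕ) :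
    ∃ r : E d → ℝ, (∀ x, genExp μ P (wt A f s) n x = r x) ∧ (∀ x, 0 ≤ r x) ∧ (∀ x, r x ≤ 1) ∧
      (s = 1 → ∀ x, 0 < ∫ ρ, r (x + ρ) ∂P) ∧ ∀ x, avg P (genExp μ P (wt A f s) n) x =
        ((∫ ρ, r (x + ρ) ∂P : ℝ) : ℂ) := by
  have hle : ∀ {r : E d → ℝ} {n : ℕ}, (∀ x, genExp μ P (wt A f s) n x = r x) → ∀ x, r x ≤ 1 := by
    intro r n hr x
    have := norm_genExp_le (μ := μ) (P := P) (norm_wt_le (A := A) hf hs) n x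
    rw [hr x, Complex.norm_real] at this
    exact (le_abs_self _).trans this
  have hpos : ∀ {r : E d → ℝ} {n : ℕ}, (∀ x, genExp μ P (wt A f s) n x = r x) →
      (∀ x, 0 < r x) → ∀ x, 0 < ∫ ρ, r (x + ρ) ∂P := by
    intro r n hr h0 x
    have hrm : Measurable r := by
      have : r = fun x => (genExp μ P (wt A f s) n x).re := funext fun x => by simp [hr x]
      rw [this]
      exact Complex.measurable_re.comp (measurable_genExp (measurable_wt_right hA hfm s) n)
    have hi : Integrable (fun ρ => r (x + ρ)) P :=
      .of_bound (hrm.comp (measurable_const_add x)).aestronglyMeasurable 1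
        (.of_forall fun ρ => by
          rw [Real.norm_of_nonneg (h0 _).le]; exact hle hr _)
    rw [integral_pos_iff_support_of_nonneg (fun ρ => (h0 _).le) hi]
    have : Function.support (fun ρ => r (x + ρ)) = Set.univ :=
      Set.eq_univ_of_forall fun ρ => (h0 _).ne'
    rw [this, measure_univ]
    exact one_pos
  have hmain : ∃ r : E d → ℝ, (∀ x, genExp μ P (wt A f s) n x = r x) ∧ (∀ x, 0 ≤ r x) ∧
      (s = 1 → ∀ x, 0 < r x) := by
    induction n with
    | zero =>
      classical
      refine ⟨fun x => (if x ∈ A then s else 1) * Real.exp (f x).re, fun x => ?_, fun x => ?_,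
        fun hs1 x => ?_⟩
      · have : f x = ((f x).re : ℂ) := Complex.ext (by simp) (by simp [hfr x])
        simp only [genExp, wt]
        conv_lhs => rw [this]
        split_ifs <;> push_cast <;> rfl
      · have := hs.1
        dsimp only
        split_ifs <;> positivity
      · rw [hs1]
        simp [Real.exp_pos]
    | succ n ih =>
      obtain ⟨r, hr, hr0, hrp⟩ := ih
      have hU : genExp μ P (wt A f s) n = fun x => (r x : ℂ) := funext hr
      have h0 : ∀ x, 0 ≤ ∫ ρ, r (x + ρ) ∂P := fun x => integral_nonneg fun _ => hr0 _
      have h1 : ∀ x, ∫ ρ, r (x + ρ) ∂P ≤ 1 := fun x => by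
        have h := norm_avg_le (P := P) (norm_genExp_le (μ := μ) (P := P)
          (norm_wt_le (A := A) hf hs) n) x
        rw [hU, avg_ofReal, Complex.norm_real] at h
        exact (le_abs_self _).trans h
      choose t ht0 htp ht using fun x => genFun_ofReal (μ := μ) (h0 x) (h1 x)
      refine ⟨t, fun x => ?_, ht0, fun hs1 x => htp x (hpos hr (hrp hs1) x)⟩
      simp only [genExp]
      rw [hU, avg_ofReal, ht]
  obtain ⟨r, hr, hr0, hrp⟩ := hmain
  refine ⟨r, hr, hr0, hle hr, fun hs1 => hpos hr (hrp hs1), fun x => ?_⟩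
  rw [show genExp μ P (wt A f s) n = fun x => (r x : ℂ) from funext hr, avg_ofReal]

lemma exists_real_slope (hμ : Critical μ) (hA : MeasurableSet A) (hfm : Measurable f)
    (hf : ∀ y, (f y).re ≤ 0) (hfr : ∀ y, (f y).im = 0) (n : ℕ) (x : E d) :
    ∃ t : ℝ, 0 < t ∧ t ≤ 1 ∧ genSlope μ (avg P (genExp μ P (wt A f 1) n) x)
      (avg P (genExp μ P (wt A f 0) n) x) = t := by
  have h1 : (1 : ℝ) ∈ Set.Icc (0 : ℝ) 1 := by simp
  have h0 : (0 : ℝ) ∈ Set.Icc (0 : ℝ) 1 := by simp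
  obtain ⟨r, hr, hr0, hr1, hrp, hra⟩ :=
    genExp_wt_ofReal (μ := μ) (P := P) hA hfm hf hfr h1 n
  obtain ⟨q, hq, hq0, hq1, -, hqa⟩ :=
    genExp_wt_ofReal (μ := μ) (P := P) hA hfm hf hfr h0 n
  have hb : ∀ {s : ℝ}, s ∈ Set.Icc (0 : ℝ) 1 →
      ‖avg P (genExp μ P (wt A f s) n) x‖ ≤ 1 := fun hs =>
    norm_avg_le (norm_genExp_le (norm_wt_le hf hs) n) x
  have hn := norm_genSlope_le hμ (hb h1) (hb h0)
  have e1 := hb h1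
  have e0 := hb h0
  rw [hra, Complex.norm_real] at e1
  rw [hqa, Complex.norm_real] at e0
  obtain ⟨t, -, htp, ht⟩ := genSlope_ofReal hμ (integral_nonneg fun ρ => hr0 (x + ρ))
    ((le_abs_self _).trans e1) (integral_nonneg fun ρ => hq0 (x + ρ))
    ((le_abs_self _).trans e0)
  rw [← hra, ← hqa] at ht
  refine ⟨t, htp (hrp rfl x), ?_, ht⟩
  rw [ht, Complex.norm_real] at hn
  exact (le_abs_self _).trans hn

/-- The constant is the limit of `J_n = ∫ D_n dℓ`. For real `f` the slopes lie in `(0, 1]`, so `J`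
is positive and nonincreasing, and `J_{n+1} ≥ (1 - ε_n) J_n` with `∑ ε_n < ∞` prevents it from
tending to `0`. -/
theorem integral_G_ne_zero (hμ : Critical μ) (hA : MeasurableSet A) (hfm : Measurable f)
    (hf : ∀ y, (f y).re ≤ 0) (hf0 : ∀ y ∉ A, f y = 0) (hfr : ∀ y, (f y).im = 0)
    (hℓA : ℓ A ≠ ∞) (hℓA0 : ℓ A ≠ 0) {γ θ : ℝ}
    (hγ0 : 0 < γ) (hγ1 : γ ≤ 1) (hm : Summable fun k : ℕ => (μ k).toReal * (k : ℝ) ^ (1 + γ))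
    (hθ : 1 < θ * γ) (hℓ : ∀ᵐ ρ ∂P, ℓ.map (· + ρ) = ℓ)
    (hc : ∃ C : ℝ, ∀ (n : ℕ) x, hit P A (n + 1) x ≤ C * ((n : ℝ) + 1) ^ (-θ)) :
    ∫ y in A, G μ hμ P A f y ∂ℓ ≠ 0 := by
  obtain ⟨ε, hεs, hε⟩ := exists_slope_bound (P := P) hμ hA hfm hf hf0 hγ0 hγ1 hm hθ hc
  have hε0 : ∀ n, 0 ≤ ε n := fun n => (norm_nonneg _).trans (hε n 0)
  choose t ht0 ht1 ht using exists_real_slope (P := P) hμ hA hfm hf hfr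
  set e : ℕ → E d → ℝ := fun n x => (keyDiff μ P A f n x).re with he
  have hem : ∀ n, Measurable (e n) := fun n =>
    Complex.measurable_re.comp (measurable_keyDiff hA hfm n)
  have hei : ∀ n, Integrable (e n) ℓ := fun n =>
    (integrable_keyDiff (P := P) hμ hA hfm hf hℓA hℓ n).re
  have hstep : ∀ n x, e (n + 1) x = t n x * ∫ ρ, e n (x + ρ) ∂P := by
    intro n x
    have h1 : (avg P (keyDiff μ P A f n) x).re = ∫ ρ, e n (x + ρ) ∂P := by
      have hi : Integrable (fun ρ => keyDiff μ P A f n (x + ρ)) P :=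
        integrable_of_bound ((measurable_keyDiff hA hfm n).comp (measurable_const_add x))
          (C := 1) fun ρ => (norm_keyDiff_le hμ hA hfm hf n _).trans (hit_le_one _ _)
      exact (integral_re hi).symm
    simp only [he] at h1 ⊢
    rw [keyDiff_succ hμ hA hfm hf, ht, Complex.re_ofReal_mul, h1]
  have he0 : ∀ x, e 0 x = A.indicator (fun y => Real.exp (f y).re) x := by
    intro x
    have : f x = ((f x).re : ℂ) := Complex.ext (by simp) (by simp [hfr x])
    simp only [he, keyDiff, genExp, wt]
    by_cases hx : x ∈ A
    · rw [if_pos hx, if_pos hx, Set.indicator_of_mem hx, this]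
      simp [Complex.exp_ofReal_re]
    · simp [hx]
  have hnn : ∀ n x, 0 ≤ e n x := by
    intro n
    induction n with
    | zero =>
      intro x
      rw [he0]
      exact Set.indicator_nonneg (fun _ _ => (Real.exp_pos _).le) _
    | succ n ih =>
      intro x
      rw [hstep]
      exact mul_nonneg (ht0 n x).le (integral_nonneg fun _ => ih _)
  set J : ℕ → ℝ := fun n => ∫ x, e n x ∂ℓ with hJ
  have hconv : ∀ n, ∫ x, ∫ ρ, e n (x + ρ) ∂P ∂ℓ = J n := fun n =>
    integral_integral_add (hei n) (hem n).stronglyMeasurable hℓ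
  have hconvi : ∀ n, Integrable (fun x => ∫ ρ, e n (x + ρ) ∂P) ℓ := fun n =>
    (integrable_comp_add (hei n) (hem n).stronglyMeasurable hℓ).integral_prod_left
  have hcnn : ∀ n x, 0 ≤ ∫ ρ, e n (x + ρ) ∂P := fun n x => integral_nonneg fun _ => hnn n _
  have hJpos : ∀ n, 0 < J n := by
    intro n
    induction n with
    | zero =>
      simp only [hJ]
      rw [integral_pos_iff_support_of_nonneg (hnn 0) (hei 0)]
      refine (pos_iff_ne_zero.2 hℓA0).trans_le (measure_mono fun x hx => ?_)
      rw [Function.mem_support, he0, Set.indicator_of_mem hx]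
      exact (Real.exp_pos _).ne'
    | succ n ih =>
      -- If `J (n + 1)` vanished, the positive slopes would force the average of `e n` to vanish
      -- almost everywhere, and its integral is `J n`.
      refine (integral_nonneg (hnn (n + 1))).lt_of_ne' fun h0 => ih.ne' ?_
      rw [integral_eq_zero_iff_of_nonneg (hnn (n + 1)) (hei (n + 1))] at h0
      rw [← hconv n, integral_eq_zero_iff_of_nonneg (hcnn n) (hconvi n)]
      filter_upwards [h0] with x hx
      rw [hstep] at hx
      exact (mul_eq_zero.1 hx).resolve_left (ht0 n x).ne'
  have hdec : ∀ n, J (n + 1) ≤ J n := fun n => by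
    rw [← hconv n]
    refine integral_mono (hei _) (hconvi n) fun x => ?_
    rw [hstep]
    exact mul_le_of_le_one_left (hcnn n x) (ht1 n x)
  have hinc : ∀ n, (1 - ε n) * J n ≤ J (n + 1) := fun n => by
    rw [← hconv n, ← integral_const_mul]
    refine integral_mono ((hconvi n).const_mul _) (hei _) fun x => ?_
    simp only [hstep]
    refine mul_le_mul_of_nonneg_right ?_ (hcnn n x)
    have h1 := hε n x
    rw [ht, ← Complex.ofReal_one, ← Complex.ofReal_sub, Complex.norm_real] at h1
    linarith [(le_abs_self _).trans h1]
  -- From a time where the remaining sum of `ε` is below `1/2`, at most half of `J K` can be lost.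
  obtain ⟨K, hK⟩ := ((tendsto_sum_nat_add ε).eventually
    (gt_mem_nhds (one_half_pos (α := ℝ)))).exists
  have hanti : Antitone J := antitone_nat_of_succ_le hdec
  have hlow : ∀ j, (1 - ∑ i ∈ Finset.range j, ε (i + K)) * J K ≤ J (j + K) := by
    intro j
    induction j with
    | zero => simp
    | succ j ih =>
      rw [Finset.sum_range_succ, Nat.add_right_comm]
      have h1 := hinc (j + K)
      have h2 : ε (j + K) * J (j + K) ≤ ε (j + K) * J K :=
        mul_le_mul_of_nonneg_left (hanti (by omega)) (hε0 _)
      linarith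
  have hhalf : ∀ j, J K / 2 ≤ J (j + K) := by
    intro j
    have h1 : ∑ i ∈ Finset.range j, ε (i + K) ≤ ∑' i, ε (i + K) :=
      ((summable_nat_add_iff K).2 hεs).sum_le_tsum _ fun i _ => hε0 _
    have h2 := hlow j
    have h3 := (hJpos K).le
    nlinarith
  have hlim := tendsto_integral_keyDiff (P := P) hμ hA hfm hf hf0 hℓA hℓ
  have hlim' : Tendsto J atTop (𝓝 (∫ y in A, G μ hμ P A f y ∂ℓ).re) := by
    refine ((Complex.continuous_re.tendsto _).comp hlim).congr fun n => ?_
    exact (integral_re (integrable_keyDiff (P := P) hμ hA hfm hf hℓA hℓ n)).symm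
  have hge : J K / 2 ≤ (∫ y in A, G μ hμ P A f y ∂ℓ).re :=
    ge_of_tendsto' ((tendsto_add_atTop_iff_nat K).2 hlim') hhalf
  intro h0
  rw [h0, Complex.zero_re] at hge
  linarith [hJpos K]

end Positivity

/-! ### Local limit theorems from asymptotics of densities -/

section Density

variable {d : ℕ}

lemma tendsto_sub_of_continuous {L : E d → ℝ} (hL : Continuous L) {u v : ℕ → E d} {R : ℝ}
    (hu : ∀ᶠ n in atTop, ‖u n‖ ≤ R) (huv : Tendsto (fun n => v n - u n) atTop (𝓝 0)) :
    Tendsto (fun n => L (v n) - L (u n)) atTop (𝓝 0) := by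
  have hc : UniformContinuousOn L (Metric.closedBall 0 (R + 1)) :=
    (isCompact_closedBall _ _).uniformContinuousOn_of_continuous hL.continuousOn
  rw [Metric.tendsto_atTop]
  intro ε hε
  obtain ⟨δ, hδ, h⟩ := Metric.uniformContinuousOn_iff.1 hc ε hε
  have h1 := (Metric.tendsto_nhds.1 huv) (min δ 1) (lt_min hδ one_pos)
  obtain ⟨N, hN⟩ := eventually_atTop.1 (hu.and h1)
  refine ⟨N, fun n hn => ?_⟩
  obtain ⟨h2, h3⟩ := hN n hn
  rw [dist_zero_right, lt_min_iff] at h3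
  rw [dist_zero_right, ← dist_eq_norm]
  have h4 : ‖v n‖ ≤ R + 1 := by
    have := norm_add_le (v n - u n) (u n)
    rw [sub_add_cancel] at this
    linarith
  exact h _ (by simpa using h4) _ (by simp; linarith) (by rw [dist_eq_norm]; exact h3.1)

lemma tendsto_natCast_div_sub (K : ℕ) :
    Tendsto (fun n : ℕ => (n : ℝ) / ((n - K : ℕ) : ℝ)) atTop (𝓝 1) := by
  rw [← tendsto_add_atTop_iff_nat K]
  have h1 : Tendsto (fun n : ℕ => 1 + (K : ℝ) / (n : ℝ)) atTop (𝓝 (1 + 0)) :=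
    (tendsto_const_div_atTop_nhds_zero_nat (K : ℝ)).const_add 1
  rw [add_zero] at h1
  refine h1.congr' ?_
  filter_upwards [eventually_gt_atTop 0] with n hn
  have : (n : ℝ) ≠ 0 := by exact_mod_cast hn.ne'
  rw [Nat.add_sub_cancel]
  push_cast
  field_simp

/-- For fixed `y` and `K`, passing from time `n` to `n - K` and from `x` to `x - y` moves the
rescaled point by `o(1)`, so the kernel is asymptotically `L(x / n^a)`, by evenness of `L`. The
kernel is bounded and `V` is integrable, hence dominated convergence applies. The set `X` (the whole
space or the lattice) is where the density asymptotics hold, and it must contain the differences `y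
- x`. -/
theorem localLimit_of_density {P : Measure (E d)} [IsProbabilityMeasure P] {A : Set (E d)}
    {ℓ : Measure (E d)} {θ a B M : ℝ} (ha : 0 < a) (hM : 0 < M) {X : Set (E d)} (hX0 : 0 ∈ X)
    (hX : ∀ x ∈ X, ∀ y ∈ X, y - x ∈ X) (hXℓ : ∀ᵐ y ∂ℓ, y ∈ X)
    (hinv : ∀ᵐ ρ ∂P, ℓ.map (· + ρ) = ℓ)
    (hconc : ∃ C : ℝ, ∀ (n : ℕ) x, hit P A (n + 1) x ≤ C * ((n : ℝ) + 1) ^ (-θ))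
    {L : E d → ℝ} (hLc : Continuous L) (hLpos : ∀ x, 0 < L x) (hLB : ∀ x, L x ≤ B)
    (hLe : ∀ x, L (-x) = L x) {p : ℕ → E d → ℝ} (hpm : ∀ n, Measurable (p n))
    (hp : ∀ V : E d → ℂ, Measurable V → Integrable V ℓ → ∀ n : ℕ, 0 < n → ∀ x ∈ X,
      avg (walk P n) V x = ∫ y, V y * (p n (y - x) : ℂ) ∂ℓ)
    (hunif : ∀ ε : ℝ, 0 < ε → ∀ᶠ n : ℕ in atTop, ∀ z ∈ X,
      |(n : ℝ) ^ θ * p n z - L (((n : ℝ) ^ a)⁻¹ • z)| ≤ ε) :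
    LocalLimit P A ℓ θ (fun n => {x | ‖x‖ ≤ M * (n : ℝ) ^ a ∧ x ∈ X})
      (fun n x => L (((n : ℝ) ^ a)⁻¹ • x)) := by
  have hB0 : 0 ≤ B := (hLpos 0).le.trans (hLB 0)
  have hball : ∀ n : ℕ, 0 < n → ∀ x : E d, ‖x‖ ≤ M * (n : ℝ) ^ a → ‖((n : ℝ) ^ a)⁻¹ • x‖ ≤ M := by
    intro n hn x hx
    have hpos : 0 < (n : ℝ) ^ a := Real.rpow_pos_of_pos (by exact_mod_cast hn) a
    rw [norm_smul, norm_inv, Real.norm_of_nonneg hpos.le, inv_mul_le_iff₀ hpos, mul_comm]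
    exact hx
  refine ⟨hinv, hconc, ⟨B, fun n x _ => ?_⟩, ?_, fun n => ⟨?_, hX0⟩, ?_⟩
  · rw [abs_of_pos (hLpos _)]; exact hLB _
  · obtain ⟨x₀, -, hx₀⟩ := (isCompact_closedBall (0 : E d) M).exists_isMinOn
      ⟨0, by simp [hM.le]⟩ hLc.continuousOn
    refine ⟨L x₀, hLpos x₀, ?_⟩
    filter_upwards [eventually_gt_atTop 0] with n hn x hx
    exact hx₀ (by simpa using hball n hn x hx.1)
  · rw [norm_zero]; positivity
  · intro V hVm hV K x hx
    set r : ℕ → ℝ := fun n => (n : ℝ) / ((n - K : ℕ) : ℝ) with hr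
    have hr1 : Tendsto r atTop (𝓝 1) := tendsto_natCast_div_sub K
    have hsub : Tendsto (fun n : ℕ => n - K) atTop atTop := tendsto_sub_atTop_nat K
    set q : ℕ → E d → ℝ := fun n z => ((n - K : ℕ) : ℝ) ^ θ * p (n - K) z with hq
    have hrθ : Tendsto (fun n => r n ^ θ) atTop (𝓝 1) := by
      simpa using hr1.rpow_const (p := θ) (Or.inl one_ne_zero)
    have hra : Tendsto (fun n => r n ^ a) atTop (𝓝 1) := by
      simpa using hr1.rpow_const (p := a) (Or.inl one_ne_zero)
    have hpt : ∀ y ∈ X, Tendsto (fun n : ℕ => r n ^ θ * q n (y - x n) -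
        L (((n : ℝ) ^ a)⁻¹ • x n)) atTop (𝓝 0) := by
      intro y hy
      have h1 : Tendsto (fun n => q n (y - x n) -
          L ((((n - K : ℕ) : ℝ) ^ a)⁻¹ • (y - x n))) atTop (𝓝 0) := by
        rw [Metric.tendsto_nhds]
        intro ε hε
        filter_upwards [hsub.eventually (hunif (ε / 2) (half_pos hε))] with n hn
        rw [dist_zero_right, Real.norm_eq_abs]
        exact (hn _ (hX _ (hx n).2 _ hy)).trans_lt (half_lt_self hε)
      have h2 : Tendsto (fun n => L ((((n - K : ℕ) : ℝ) ^ a)⁻¹ • (y - x n)) -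
          L (-(((n : ℝ) ^ a)⁻¹ • x n))) atTop (𝓝 0) := by
        refine tendsto_sub_of_continuous hLc (R := M) ?_ ?_
        · filter_upwards [eventually_gt_atTop 0] with n hn
          rw [norm_neg]
          exact hball n hn _ (hx n).1
        · have h3 : Tendsto (fun n : ℕ => (((n - K : ℕ) : ℝ) ^ a)⁻¹ • y) atTop (𝓝 0) := by
            have : Tendsto (fun n : ℕ => (((n - K : ℕ) : ℝ) ^ a)⁻¹) atTop (𝓝 0) :=
              ((tendsto_rpow_atTop ha).comp (tendsto_natCast_atTop_atTop.comp
                hsub)).inv_tendsto_atTop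
            simpa using this.smul_const y
          -- The change of scale multiplies a point of norm at most `M` by a factor tending to `1`.
          have h4 : Tendsto (fun n : ℕ => (r n ^ a - 1) • (((n : ℝ) ^ a)⁻¹ • x n)) atTop
              (𝓝 0) := by
            refine squeeze_zero_norm' (a := fun n => |r n ^ a - 1| * M) ?_ ?_
            · filter_upwards [eventually_gt_atTop 0] with n hn
              rw [norm_smul, Real.norm_eq_abs]
              exact mul_le_mul_of_nonneg_left (hball n hn _ (hx n).1) (abs_nonneg _)
            · have : Tendsto (fun n => |r n ^ a - 1| * M) atTop (𝓝 (|(1 : ℝ) - 1| * M)) :=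
                ((hra.sub_const 1).abs).mul_const M
              simpa using this
          have h5 := h3.sub h4
          rw [sub_zero] at h5
          refine h5.congr' ?_
          filter_upwards [eventually_gt_atTop K] with n hn
          have hn1 : (0 : ℝ) < n := by exact_mod_cast (Nat.zero_le K).trans_lt hn
          have hn2 : (0 : ℝ) < ((n - K : ℕ) : ℝ) := by
            exact_mod_cast Nat.sub_pos_of_lt hn
          have e1 : r n ^ a * ((n : ℝ) ^ a)⁻¹ = (((n - K : ℕ) : ℝ) ^ a)⁻¹ := by
            rw [hr, Real.div_rpow hn1.le hn2.le]
            have := (Real.rpow_pos_of_pos hn1 a).ne'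
            field_simp
          rw [smul_sub, sub_neg_eq_add, sub_smul, one_smul, smul_smul, e1]
          abel
      have h3 : Tendsto (fun n => q n (y - x n) - L (((n : ℝ) ^ a)⁻¹ • x n)) atTop (𝓝 0) := by
        have := h1.add h2
        simp only [hLe, add_zero, sub_add_sub_cancel] at this
        exact this
      have h4 : Tendsto (fun n => (r n ^ θ - 1) * L (((n : ℝ) ^ a)⁻¹ • x n)) atTop (𝓝 0) := by
        refine squeeze_zero_norm (a := fun n => |r n ^ θ - 1| * B) (fun n => ?_) ?_
        · rw [norm_mul, Real.norm_eq_abs, Real.norm_of_nonneg (hLpos _).le]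
          exact mul_le_mul_of_nonneg_left (hLB _) (abs_nonneg _)
        · have : Tendsto (fun n => |r n ^ θ - 1| * B) atTop (𝓝 (|(1 : ℝ) - 1| * B)) :=
            ((hrθ.sub_const 1).abs).mul_const B
          simpa using this
      have h5 := (hrθ.mul h3).add h4
      simp only [mul_zero, add_zero] at h5
      exact h5.congr fun n => by ring
    -- Eventually `r^θ < 2`, and `q` is within `1` of a value of `L`, hence at most `B + 1`.
    have hbound : ∀ᶠ n in atTop, ∀ z ∈ X, |r n ^ θ * q n z| ≤ 2 * (B + 1) := by
      filter_upwards [hsub.eventually (hunif 1 one_pos),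
        hrθ.eventually (gt_mem_nhds one_lt_two), eventually_ge_atTop K] with n h1 h2 h3 z hz
      have hr0 : 0 ≤ r n ^ θ := Real.rpow_nonneg (by positivity) _
      rw [abs_mul, abs_of_nonneg hr0]
      have h4 : |q n z| ≤ B + 1 := by
        have h5 := abs_le.1 (h1 z hz)
        have h6 := hLpos ((((n - K : ℕ) : ℝ) ^ a)⁻¹ • z)
        have h7 := hLB ((((n - K : ℕ) : ℝ) ^ a)⁻¹ • z)
        rw [abs_le]
        constructor <;> simp only [hq] <;> linarith [h5.1, h5.2]
      exact mul_le_mul h2.le h4 (abs_nonneg _) zero_le_two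
    have hD : Tendsto (fun n => ∫ y, V y * ((r n ^ θ * q n (y - x n) -
        L (((n : ℝ) ^ a)⁻¹ • x n) : ℝ) : ℂ) ∂ℓ) atTop (𝓝 (∫ _, (0 : ℂ) ∂ℓ)) := by
      refine tendsto_integral_filter_of_dominated_convergence
        (fun y => ‖V y‖ * (2 * (B + 1) + B)) ?_ ?_ (hV.norm.mul_const _) ?_
      · refine .of_forall fun n => (hVm.mul (Complex.measurable_ofReal.comp ?_)).aestronglyMeasurable
        exact (measurable_const.mul (measurable_const.mul
          ((hpm _).comp (measurable_sub_const _)))).sub measurable_const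
      · filter_upwards [hbound] with n hn
        filter_upwards [hXℓ] with y hy
        rw [norm_mul, Complex.norm_real]
        have h6 := norm_sub_le (r n ^ θ * q n (y - x n)) (L (((n : ℝ) ^ a)⁻¹ • x n))
        rw [Real.norm_eq_abs (r n ^ θ * _), Real.norm_of_nonneg (hLpos _).le] at h6
        exact mul_le_mul_of_nonneg_left
          (h6.trans (add_le_add (hn _ (hX _ (hx n).2 _ hy)) (hLB _))) (norm_nonneg _)
      · filter_upwards [hXℓ] with y hy
        have h1 := (Complex.continuous_ofReal.tendsto _).comp (hpt y hy)
        rw [Complex.ofReal_zero] at h1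
        simpa using h1.const_mul (V y)
    rw [integral_zero] at hD
    refine hD.congr' ?_
    filter_upwards [eventually_gt_atTop K, hbound] with n hn hbn
    have hn1 : (0 : ℝ) < n := by exact_mod_cast (Nat.zero_le K).trans_lt hn
    have hn2 : (0 : ℝ) < ((n - K : ℕ) : ℝ) := by
      exact_mod_cast Nat.sub_pos_of_lt hn
    have hint : Integrable (fun y => V y * ((r n ^ θ * q n (y - x n) : ℝ) : ℂ)) ℓ := by
      refine hV.mul_bdd (c := 2 * (B + 1)) (Complex.measurable_ofReal.comp
        (measurable_const.mul (measurable_const.mul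
          ((hpm _).comp (measurable_sub_const _))))).aestronglyMeasurable ?_
      filter_upwards [hXℓ] with y hy
      rw [Complex.norm_real]
      exact hbn _ (hX _ (hx n).2 _ hy)
    have e1 : ∀ y, V y * ((r n ^ θ * q n (y - x n) - L (((n : ℝ) ^ a)⁻¹ • x n) : ℝ) : ℂ) =
        V y * ((r n ^ θ * q n (y - x n) : ℝ) : ℂ) - L (((n : ℝ) ^ a)⁻¹ • x n) * V y := by
      intro y
      push_cast
      ring
    simp_rw [e1]
    rw [integral_sub hint (hV.const_mul _), integral_const_mul,
      hp V hVm hV (n - K) (Nat.sub_pos_of_lt hn) (x n) (hx n).2]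
    refine congrArg (fun t : ℂ => t - L (((n : ℝ) ^ a)⁻¹ • x n) * ∫ y, V y ∂ℓ)
      ((integral_congr_ae (.of_forall fun y => ?_)).trans (integral_const_mul _ _))
    have e2 : r n ^ θ * q n (y - x n) = (n : ℝ) ^ θ * p (n - K) (y - x n) := by
      simp only [hr, hq]
      rw [Real.div_rpow hn1.le hn2.le]
      have := (Real.rpow_pos_of_pos hn2 θ).ne'
      field_simp
    simp only [e2]
    push_cast
    ring

end Density

/-! ### Densities of laws with integrable characteristic functions -/

section Inversion

open scoped FourierTransform

variable {d : ℕ}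

/-- The inversion formula `(2π)^{-d} ∫ φ(y) e^{-i⟨x, y⟩} dy`. -/
noncomputable def cfDensity (φ : E d → ℂ) (x : E d) : ℂ :=
  ((2 * Real.pi : ℝ) ^ d : ℝ)⁻¹ * ∫ y, φ y * Complex.exp (-(inner ℝ x y : ℝ) * Complex.I)

lemma norm_exp_neg_mul_I (t : ℝ) : ‖Complex.exp (-(t : ℂ) * Complex.I)‖ = 1 := by
  rw [← Complex.ofReal_neg, Complex.norm_exp_ofReal_mul_I]

lemma continuous_phase : Continuous fun p : E d × E d =>
    Complex.exp (-((inner ℝ p.1 p.2 : ℝ) : ℂ) * Complex.I) := by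
  fun_prop

lemma integrable_mul_phase {φ : E d → ℂ} (hφ : Integrable φ) (x : E d) :
    Integrable fun y => φ y * Complex.exp (-(inner ℝ x y : ℝ) * Complex.I) := by
  refine hφ.mul_bdd (c := 1) ?_ (.of_forall fun y => (norm_exp_neg_mul_I _).le)
  exact (continuous_phase.comp (Continuous.prodMk_right x)).aestronglyMeasurable

lemma norm_cfDensity_le {φ : E d → ℂ} (x : E d) :
    ‖cfDensity φ x‖ ≤ ((2 * Real.pi) ^ d)⁻¹ * ∫ y, ‖φ y‖ := by
  have hpi := Real.pi_pos
  rw [cfDensity, norm_mul, Complex.norm_real, Real.norm_of_nonneg (by positivity)]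
  refine mul_le_mul_of_nonneg_left ((norm_integral_le_integral_norm _).trans_eq ?_) (by positivity)
  simp_rw [norm_mul, norm_exp_neg_mul_I, mul_one]

lemma continuous_cfDensity {φ : E d → ℂ} (hφ : Integrable φ) : Continuous (cfDensity φ) := by
  refine continuous_const.mul (continuous_of_dominated (bound := fun y => ‖φ y‖)
    (fun x => (integrable_mul_phase hφ x).aestronglyMeasurable)
    (fun x => .of_forall fun y => ?_) hφ.norm (.of_forall fun y => ?_))
  · rw [norm_mul, norm_exp_neg_mul_I, mul_one]
  · exact continuous_const.mul (continuous_phase.comp (Continuous.prodMk_left y))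

/-- Fubini, with integrability asked of `h` alone. It serves three times: `h` is a Gaussian to
smooth a law, a rescaled stable transform to split the motion law, and the indicator of the cube to
read off lattice masses. -/
lemma cfDensity_mul_charFun {h : E d → ℂ} (hh : Integrable h) (μ : Measure (E d))
    [IsFiniteMeasure μ] (x : E d) :
    cfDensity (fun y => h y * charFun μ y) x = ∫ z, cfDensity h (x - z) ∂μ := by
  have hint : Integrable (Function.uncurry fun (y z : E d) =>
      h y * Complex.exp (-(inner ℝ (x - z) y : ℝ) * Complex.I)) (volume.prod μ) := by
    have h1 : Integrable (fun p : E d × E d => h p.1) (volume.prod μ) := hh.comp_fst μ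
    refine h1.mul_bdd (c := 1) ?_ (.of_forall fun p => (norm_exp_neg_mul_I _).le)
    have : Continuous fun p : E d × E d => (x - p.2, p.1) := by fun_prop
    exact (continuous_phase.comp this).aestronglyMeasurable
  simp only [cfDensity]
  rw [integral_const_mul, ← integral_integral_swap hint]
  congr 1
  refine integral_congr_ae (.of_forall fun y => ?_)
  simp only [charFun_apply]
  rw [mul_assoc, mul_comm (∫ z, _ ∂μ), ← integral_const_mul, ← integral_const_mul]
  refine integral_congr_ae (.of_forall fun z => ?_)
  simp only [← Complex.exp_add]
  rw [inner_sub_left]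
  congr 2
  push_cast
  ring

/-- The density of the Gaussian law with characteristic function `exp (-‖y‖² / c)`. -/
noncomputable def heat (d : ℕ) (c : ℝ) (x : E d) : ℝ :=
  ((2 * Real.pi) ^ d)⁻¹ * ((Real.pi * c) ^ ((d : ℝ) / 2) * Real.exp (-(c / 4) * ‖x‖ ^ 2))

lemma heat_nonneg {c : ℝ} (hc : 0 < c) (x : E d) : 0 ≤ heat d c x := by
  have := Real.pi_pos
  unfold heat
  positivity

lemma continuous_heat (c : ℝ) : Continuous (heat d c) := by
  unfold heat
  fun_prop

lemma cfDensity_gaussian {c : ℝ} (hc : 0 < c) (x : E d) :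
    cfDensity (fun y => Complex.exp (-(c : ℂ)⁻¹ * ‖y‖ ^ 2)) x = heat d c x := by
  have hb : 0 < ((c : ℂ)⁻¹).re := by
    rw [← Complex.ofReal_inv, Complex.ofReal_re]
    positivity
  have h := GaussianFourier.integral_cexp_neg_mul_sq_norm_add hb (-Complex.I) x
  have hcc : (c : ℂ) ≠ 0 := by exact_mod_cast hc.ne'
  simp only [cfDensity, heat, ← Complex.exp_add]
  push_cast
  congr 1
  have e1 : ∀ y : E d, -(c : ℂ)⁻¹ * ‖y‖ ^ 2 + -((inner ℝ x y : ℝ) : ℂ) * Complex.I =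
      -(c : ℂ)⁻¹ * ‖y‖ ^ 2 + -Complex.I * (inner ℝ x y : ℝ) := fun y => by ring
  simp_rw [e1]
  rw [h, finrank_euclideanSpace_fin]
  congr 1
  · rw [div_inv_eq_mul, Complex.ofReal_cpow (by have := Real.pi_pos; positivity)]
    push_cast
    rfl
  · congr 1
    rw [neg_sq, Complex.I_sq]
    field_simp

lemma integral_heat {c : ℝ} (hc : 0 < c) : ∫ x, heat d c x = 1 := by
  have hpi := Real.pi_pos
  simp only [heat]
  rw [integral_const_mul, integral_const_mul,
    GaussianFourier.integral_rexp_neg_mul_sq_norm (show 0 < c / 4 by positivity),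
    finrank_euclideanSpace_fin, ← Real.mul_rpow (by positivity) (by positivity)]
  have : Real.pi * c * (Real.pi / (c / 4)) = (2 * Real.pi) ^ 2 := by
    field_simp
    norm_num
  rw [this, ← Real.rpow_natCast (2 * Real.pi) 2, ← Real.rpow_mul (by positivity)]
  have h2 : ((2 : ℕ) : ℝ) * ((d : ℝ) / 2) = d := by push_cast; ring
  rw [h2, Real.rpow_natCast]
  exact inv_mul_cancel₀ (by positivity)

lemma integrable_heat {c : ℝ} (hc : 0 < c) : Integrable (heat d c) :=
  .of_integral_ne_zero (by rw [integral_heat hc]; exact one_ne_zero)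

lemma integrable_gaussian {c : ℝ} (hc : 0 < c) :
    Integrable fun y : E d => Complex.exp (-(c : ℂ)⁻¹ * ‖y‖ ^ 2) := by
  have hb : 0 < ((c : ℂ)⁻¹).re := by
    rw [← Complex.ofReal_inv, Complex.ofReal_re]
    positivity
  simpa using GaussianFourier.integrable_cexp_neg_mul_sq_norm_add hb 0 (0 : E d)

/-! ### Inversion for probability laws by Gaussian smoothing. -/

variable {μ : Measure (E d)} [IsProbabilityMeasure μ]

/-- Smoothing by a Gaussian multiplies the characteristic function by `exp (-‖y‖²/c)`, which tends
to `1` as `c` grows. It exhibits the inversion integral as a limit of nonnegative densities. -/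
lemma tendsto_integral_heat (hφ : Integrable (charFun μ)) (x : E d) :
    Tendsto (fun n : ℕ => ((∫ z, heat d ((n : ℝ) + 1) (x - z) ∂μ : ℝ) : ℂ)) atTop
      (𝓝 (cfDensity (charFun μ) x)) := by
  have hn : Tendsto (fun n : ℕ => (n : ℝ) + 1) atTop atTop :=
    tendsto_atTop_add_const_right _ _ tendsto_natCast_atTop_atTop
  have h := ((Real.tendsto_integral_cexp_sq_smul (integrable_mul_phase hφ x)).comp hn).const_mul
    ((((2 * Real.pi : ℝ) ^ d : ℝ)⁻¹ : ℝ) : ℂ)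
  refine h.congr fun n => ?_
  have hc : (0 : ℝ) < (n : ℝ) + 1 := by positivity
  rw [← integral_complex_ofReal]
  simp_rw [← cfDensity_gaussian hc]
  rw [← cfDensity_mul_charFun (integrable_gaussian hc), cfDensity]
  simp only [Function.comp_def, smul_eq_mul, mul_assoc, Complex.ofReal_inv]

lemma cfDensity_charFun_nonneg (hφ : Integrable (charFun μ)) (x : E d) :
    0 ≤ (cfDensity (charFun μ) x).re ∧ cfDensity (charFun μ) x = (cfDensity (charFun μ) x).re := by
  have h := tendsto_integral_heat hφ x
  have hre := (Complex.continuous_re.tendsto _).comp h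
  have him := (Complex.continuous_im.tendsto _).comp h
  simp only [Function.comp_def, Complex.ofReal_re, Complex.ofReal_im] at hre him
  refine ⟨ge_of_tendsto' hre fun n => integral_nonneg fun z => heat_nonneg (by positivity) _, ?_⟩
  apply Complex.ext
  · simp
  · simpa using (tendsto_nhds_unique him tendsto_const_nhds)

/-- Fatou's lemma: the smoothed densities are nonnegative, have mass at most `1` and converge
pointwise. -/
lemma integrable_cfDensity_charFun (hφ : Integrable (charFun μ)) :
    Integrable (cfDensity (charFun μ)) := by
  refine ⟨(continuous_cfDensity hφ).aestronglyMeasurable, ?_⟩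
  have hmeas : ∀ n : ℕ, Measurable fun p : E d × E d => heat d ((n : ℝ) + 1) (p.1 - p.2) :=
    fun n => ((continuous_heat _).comp continuous_sub).measurable
  have hm : ∀ n : ℕ, Measurable fun x => ENNReal.ofReal (∫ z, heat d ((n : ℝ) + 1) (x - z) ∂μ) :=
    fun n => ((hmeas n).stronglyMeasurable.integral_prod_right'.measurable).ennreal_ofReal
  have hlim : ∀ x, ‖cfDensity (charFun μ) x‖ₑ =
      liminf (fun n : ℕ => ENNReal.ofReal (∫ z, heat d ((n : ℝ) + 1) (x - z) ∂μ)) atTop := by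
    intro x
    have h := (Complex.continuous_re.tendsto _).comp (tendsto_integral_heat hφ x)
    simp only [Function.comp_def, Complex.ofReal_re] at h
    have h' := (ENNReal.continuous_ofReal.tendsto _).comp h
    simp only [Function.comp_def] at h'
    rw [h'.liminf_eq]
    obtain ⟨h1, h2⟩ := cfDensity_charFun_nonneg hφ x
    rw [h2, Complex.ofReal_re, ← ofReal_norm, Complex.norm_real, Real.norm_of_nonneg h1]
  have hone : ∀ n : ℕ, ∫⁻ x, ENNReal.ofReal (∫ z, heat d ((n : ℝ) + 1) (x - z) ∂μ) ≤ 1 := by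
    intro n
    have hc : (0 : ℝ) < (n : ℝ) + 1 := by positivity
    calc ∫⁻ x, ENNReal.ofReal (∫ z, heat d ((n : ℝ) + 1) (x - z) ∂μ)
        ≤ ∫⁻ x, ∫⁻ z, ENNReal.ofReal (heat d ((n : ℝ) + 1) (x - z)) ∂μ :=
          lintegral_mono fun x => by
            by_cases hi : Integrable (fun z => heat d ((n : ℝ) + 1) (x - z)) μ
            · rw [ofReal_integral_eq_lintegral_ofReal hi (.of_forall fun z => heat_nonneg hc _)]
            · rw [integral_undef hi]; simp
      _ = ∫⁻ z, (∫⁻ x, ENNReal.ofReal (heat d ((n : ℝ) + 1) (x - z))) ∂μ :=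
          lintegral_lintegral_swap (hmeas n).ennreal_ofReal.aemeasurable
      _ = ∫⁻ z, 1 ∂μ := by
          refine lintegral_congr fun z => ?_
          rw [lintegral_sub_right_eq_self (fun x => ENNReal.ofReal (heat d ((n : ℝ) + 1) x)) z,
            ← ofReal_integral_eq_lintegral_ofReal (integrable_heat hc)
              (.of_forall fun x => heat_nonneg hc _), integral_heat hc, ENNReal.ofReal_one]
      _ = 1 := by simp
  refine lt_of_le_of_lt ?_ ENNReal.one_lt_top
  calc ∫⁻ x, ‖cfDensity (charFun μ) x‖ₑ
      = ∫⁻ x, liminf (fun n : ℕ => ENNReal.ofReal (∫ z, heat d ((n : ℝ) + 1) (x - z) ∂μ)) atTop :=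
        lintegral_congr hlim
    _ ≤ liminf (fun n : ℕ => ∫⁻ x, ENNReal.ofReal (∫ z, heat d ((n : ℝ) + 1) (x - z) ∂μ)) atTop :=
        lintegral_liminf_le hm
    _ ≤ 1 := (liminf_le_liminf (.of_forall hone)).trans_eq (by simp)

/-- The inversion formula for an integrable continuous `φ`. -/
lemma integral_cfDensity_mul_exp {φ : E d → ℂ} (hφc : Continuous φ) (hφ : Integrable φ)
    (hL : Integrable (cfDensity φ)) (t : E d) :
    ∫ x, cfDensity φ x * Complex.exp ((inner ℝ x t : ℝ) * Complex.I) = φ t := by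
  have hpi := Real.pi_pos
  -- The dilation by `-2π` converts between characteristic functions and the Fourier transform with
  -- kernel `exp (-2πi⟨v, x⟩)`.
  set ψ : E d → ℂ := fun v => φ ((-(2 * Real.pi)) • v) with hψ
  have h1 : (𝓕⁻ ψ : E d → ℂ) = cfDensity φ := by
    funext x
    rw [Real.fourierInv_eq', cfDensity]
    have h := Measure.integral_comp_smul volume
      (fun y : E d => φ y * Complex.exp (-(inner ℝ x y : ℝ) * Complex.I)) (-(2 * Real.pi))
    rw [finrank_euclideanSpace_fin, abs_inv, abs_pow, abs_neg, abs_of_pos (by positivity),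
      Complex.real_smul] at h
    rw [← h]
    refine integral_congr_ae (.of_forall fun v => ?_)
    simp only [hψ, smul_eq_mul]
    rw [mul_comm, real_inner_smul_right, real_inner_comm]
    congr 3
    push_cast
    ring
  have hψc : Continuous ψ := hφc.comp (continuous_const_smul _)
  have hψi : Integrable ψ :=
    (integrable_comp_smul_iff volume φ (by simp [hpi.ne'])).2 hφ
  have h2 : (𝓕 ψ : E d → ℂ) = fun x => cfDensity φ (-x) := by
    funext x
    rw [← h1, Real.fourierInv_eq_fourier_neg, neg_neg]
  have h3 := hψc.fourier_fourierInv_eq hψi (by rw [h2]; exact hL.comp_neg)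
  have h4 := congrFun h3 ((-(2 * Real.pi))⁻¹ • t)
  rw [h1, Real.fourier_eq'] at h4
  simp only [hψ, smul_smul] at h4
  rw [mul_inv_cancel₀ (by simp [hpi.ne']), one_smul] at h4
  rw [← h4]
  refine integral_congr_ae (.of_forall fun x => ?_)
  simp only [smul_eq_mul]
  rw [mul_comm, real_inner_smul_right]
  congr 3
  push_cast
  field_simp

/-- A law with an integrable characteristic function has a continuous density. -/
theorem eq_withDensity_cfDensity (hφ : Integrable (charFun μ)) :
    μ = volume.withDensity fun x => ENNReal.ofReal (cfDensity (charFun μ) x).re := by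
  have hL := integrable_cfDensity_charFun hφ
  have hLre : Integrable fun x => (cfDensity (charFun μ) x).re := hL.re
  have : IsFiniteMeasure
      (volume.withDensity fun x => ENNReal.ofReal (cfDensity (charFun μ) x).re) :=
    isFiniteMeasure_withDensity_ofReal hLre.2
  refine Measure.ext_of_charFun (funext fun t => ?_)
  have hm : Measurable fun x => ENNReal.ofReal (cfDensity (charFun μ) x).re :=
    (Complex.continuous_re.comp (continuous_cfDensity hφ)).measurable.ennreal_ofReal
  rw [charFun_apply (μ := volume.withDensity _), integral_withDensity_eq_integral_toReal_smul hm
    (.of_forall fun x => ENNReal.ofReal_lt_top)]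
  rw [← integral_cfDensity_mul_exp continuous_charFun hφ hL t]
  refine integral_congr_ae (.of_forall fun x => ?_)
  obtain ⟨h1, h2⟩ := cfDensity_charFun_nonneg hφ x
  simp only [ENNReal.toReal_ofReal h1]
  rw [Complex.real_smul, ← h2]

end Inversion

/-! ### Rotation invariant stable laws -/

section Stable

variable {d : ℕ} {P : Measure (E d)} [IsProbabilityMeasure P]

lemma charFun_walk (n : ℕ) (t : E d) : charFun (walk P n) t = charFun P t ^ n := by
  induction n with
  | zero => rw [walk, charFun_dirac, pow_zero]; simp
  | succ n ih => rw [walk, charFun_conv, ih, pow_succ']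

lemma integrable_exp_neg_norm_rpow (hd : 0 < d) {κ α : ℝ} (hκ : 0 < κ) (hα : 0 < α) :
    Integrable fun y : E d => Real.exp (-(κ * ‖y‖ ^ α)) := by
  have : Nonempty (Fin d) := ⟨⟨0, hd⟩⟩
  rw [integrable_fun_norm_addHaar volume (f := fun r : ℝ => Real.exp (-(κ * r ^ α)))]
  have h := integrableOn_rpow_mul_exp_neg_mul_rpow (s := ((Module.finrank ℝ (E d) - 1 : ℕ) : ℝ))
    (p := α) (b := κ) (by have := Nat.cast_nonneg (α := ℝ) (Module.finrank ℝ (E d) - 1); linarith)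
    hα hκ
  refine h.congr_fun (fun x _ => ?_) measurableSet_Ioi
  simp [Real.rpow_natCast]

variable {α κ : ℝ}

/-- Self-similarity: `n κ ‖t‖^α = κ ‖n^{1/α} t‖^α`. -/
lemma walk_eq_map (hα : 0 < α)
    (hP : ∀ y, charFun P y = ((Real.exp (-(κ * ‖y‖ ^ α)) : ℝ) : ℂ)) {n : ℕ} (hn : 0 < n) :
    walk P n = P.map fun x => ((n : ℝ) ^ (1 / α)) • x := by
  have hn' : (0 : ℝ) < n := by exact_mod_cast hn
  have : IsProbabilityMeasure (P.map fun x => ((n : ℝ) ^ (1 / α)) • x) :=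
    Measure.isProbabilityMeasure_map (by fun_prop)
  refine Measure.ext_of_charFun (funext fun t => ?_)
  rw [charFun_walk, charFun_map_smul, hP, hP, ← Complex.ofReal_pow, ← Real.exp_nat_mul, norm_smul,
    Real.norm_of_nonneg (by positivity), Real.mul_rpow (by positivity) (norm_nonneg _),
    ← Real.rpow_mul hn'.le, one_div_mul_cancel hα.ne', Real.rpow_one]
  congr 3
  ring

lemma integral_walk_of_stable (hα : 0 < α)
    (hP : ∀ y, charFun P y = ((Real.exp (-(κ * ‖y‖ ^ α)) : ℝ) : ℂ)) {L : E d → ℝ}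
    (hLm : Measurable L) (hL0 : ∀ x, 0 ≤ L x)
    (hL : P = volume.withDensity fun x => ENNReal.ofReal (L x)) {n : ℕ} (hn : 0 < n)
    {F : Type*} [NormedAddCommGroup F] [NormedSpace ℝ F] {φ : E d → F}
    (hφ : StronglyMeasurable φ) :
    ∫ z, φ z ∂walk P n =
      ∫ z, ((n : ℝ) ^ (-((d : ℝ) / α)) * L (((n : ℝ) ^ (1 / α))⁻¹ • z)) • φ z := by
  have hn' : (0 : ℝ) < n := by exact_mod_cast hn
  set s := (n : ℝ) ^ (1 / α) with hs
  have hs0 : 0 < s := by positivity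
  rw [walk_eq_map hα hP hn, integral_map (by fun_prop) hφ.aestronglyMeasurable]
  conv_lhs => rw [hL]
  rw [integral_withDensity_eq_integral_toReal_smul hLm.ennreal_ofReal
    (.of_forall fun x => ENNReal.ofReal_lt_top)]
  have h := Measure.integral_comp_smul volume (fun z : E d => L (s⁻¹ • z) • φ z) s
  simp only [smul_smul, inv_mul_cancel₀ hs0.ne', one_smul] at h
  simp only [ENNReal.toReal_ofReal (hL0 _)]
  rw [h, ← integral_smul]
  refine integral_congr_ae (.of_forall fun z => ?_)
  simp only [smul_smul]
  congr 2
  rw [finrank_euclideanSpace_fin, abs_of_pos (by positivity), hs, ← Real.rpow_natCast,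
    ← Real.rpow_mul hn'.le, ← Real.rpow_neg hn'.le]
  congr 1
  ring

/-- By self-similarity the `n`-step density is exactly `n^{-d/α} L(n^{-1/α} z)`, so the uniform
asymptotics hold without error. The Gaussian law is the case `α = 2`, `κ = 1/2`. -/
theorem localLimit_of_stable (hα : 0 < α)
    (hP : ∀ y, charFun P y = ((Real.exp (-(κ * ‖y‖ ^ α)) : ℝ) : ℂ)) {L : E d → ℝ}
    (hLc : Continuous L) (hL0 : ∀ x, 0 < L x) (hLe : ∀ x, L (-x) = L x) {B : ℝ}
    (hLB : ∀ x, L x ≤ B) (hL : P = volume.withDensity fun x => ENNReal.ofReal (L x))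
    {A : Set (E d)} (hA : MeasurableSet A) (hAv : volume A ≠ ∞) {M : ℝ} (hM : 0 < M) :
    LocalLimit P A volume (d / α) (fun n => {x | ‖x‖ ≤ M * (n : ℝ) ^ (1 / α) ∧ x ∈ Set.univ})
      (fun n x => L (((n : ℝ) ^ (1 / α))⁻¹ • x)) := by
  have hB : 0 ≤ B := (hL0 0).le.trans (hLB 0)
  refine localLimit_of_density (B := B) (one_div_pos.2 hα) hM (Set.mem_univ _)
    (fun _ _ _ _ => Set.mem_univ _) (.of_forall fun _ => Set.mem_univ _)
    (.of_forall fun ρ => map_add_right_eq_self volume ρ) ⟨B * volume.real A, fun n x => ?_⟩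
    hLc hL0 hLB hLe
    (p := fun n z => (n : ℝ) ^ (-((d : ℝ) / α)) * L (((n : ℝ) ^ (1 / α))⁻¹ • z)) (fun n => ?_)
    (fun V hV _ n hn x _ => ?_) fun ε hε => ?_
  · have hm : Measurable fun z => A.indicator (1 : E d → ℝ) (x + z) :=
      (measurable_one.indicator hA).comp (measurable_const_add x)
    have hi : Integrable (A.indicator (1 : E d → ℝ)) :=
      (integrable_indicator_iff hA).2 (integrableOn_const hAv)
    rw [hit, integral_walk_of_stable hα hP hLc.measurable (fun x => (hL0 x).le) hL n.succ_pos
      hm.stronglyMeasurable]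
    have hc : (0 : ℝ) ≤ ((n + 1 : ℕ) : ℝ) ^ (-((d : ℝ) / α)) := by positivity
    calc _ ≤ ∫ z, (((n + 1 : ℕ) : ℝ) ^ (-((d : ℝ) / α)) * B) * A.indicator (1 : E d → ℝ) (x + z) := by
          refine integral_mono_of_nonneg (.of_forall fun z => ?_)
            ((hi.comp_add_left x).const_mul _) (.of_forall fun z => ?_)
          · exact mul_nonneg (mul_nonneg hc (hL0 _).le)
              (Set.indicator_nonneg (fun _ _ => zero_le_one) _)
          · exact mul_le_mul_of_nonneg_right (mul_le_mul_of_nonneg_left (hLB _) hc)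
              (Set.indicator_nonneg (fun _ _ => zero_le_one) _)
      _ = _ := by
          rw [integral_const_mul, integral_add_left_eq_self (A.indicator (1 : E d → ℝ)),
            integral_indicator_one hA]
          push_cast
          ring
  · exact measurable_const.mul (hLc.measurable.comp (measurable_const_smul _))
  · have hm : Measurable fun z => V (x + z) := hV.comp (measurable_const_add x)
    rw [avg, integral_walk_of_stable hα hP hLc.measurable (fun x => (hL0 x).le) hL hn
      hm.stronglyMeasurable]
    rw [← integral_sub_right_eq_self _ x]
    refine integral_congr_ae (.of_forall fun y => ?_)
    simp only [Complex.real_smul, add_sub_cancel]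
    rw [mul_comm]
  · filter_upwards [eventually_gt_atTop 0] with n hn z _
    have hn' : (0 : ℝ) < n := by exact_mod_cast hn
    rw [← mul_assoc, ← Real.rpow_add hn', add_neg_cancel, Real.rpow_zero, one_mul, sub_self,
      abs_zero]
    exact hε.le

end Stable

/-! ### Positivity of the stable densities -/

section StableDensity

variable {d : ℕ}

lemma cfDensity_comp_isometry {φ : E d → ℂ} (R : E d ≃ₗᵢ[ℝ] E d) (hφ : ∀ y, φ (R y) = φ y)
    (x : E d) : cfDensity φ (R x) = cfDensity φ x := by
  rw [cfDensity, cfDensity, ← R.measurePreserving.integral_comp R.toHomeomorph.measurableEmbedding]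
  simp only [hφ, LinearIsometryEquiv.inner_map_map]

lemma cfDensity_comp_smul {φ : E d → ℂ} {r : ℝ} (hr : 0 < r) (x : E d) :
    cfDensity (fun y => φ (r • y)) x = ((r ^ d)⁻¹ : ℝ) * cfDensity φ (r⁻¹ • x) := by
  have h := Measure.integral_comp_smul volume
    (fun y : E d => φ y * Complex.exp (-(inner ℝ (r⁻¹ • x) y : ℝ) * Complex.I)) r
  rw [finrank_euclideanSpace_fin, abs_of_pos (by positivity), Complex.real_smul] at h
  rw [cfDensity, cfDensity, ← mul_assoc, mul_comm (((r ^ d)⁻¹ : ℝ) : ℂ), mul_assoc, ← h]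
  simp only [real_inner_smul_left, real_inner_smul_right, ← mul_assoc,
    mul_inv_cancel₀ hr.ne', one_mul]

variable {P : Measure (E d)} [IsProbabilityMeasure P]

lemma measure_pos_of_mem_nhds {L : E d → ℝ} (hLc : Continuous L)
    (hL : P = volume.withDensity fun x => ENNReal.ofReal (L x)) {x : E d} (hx : 0 < L x)
    {U : Set (E d)} (hU : U ∈ 𝓝 x) : 0 < P U := by
  have h1 : U ∩ {y | 0 < L y} ∈ 𝓝 x := inter_mem hU (hLc.continuousAt.eventually (lt_mem_nhds hx))
  obtain ⟨V, hVU, hVo, hxV⟩ := mem_nhds_iff.1 h1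
  refine lt_of_lt_of_le ?_ (measure_mono fun y hy => (hVU hy).1)
  rw [pos_iff_ne_zero]
  intro h0
  rw [hL, withDensity_apply_eq_zero hLc.measurable.ennreal_ofReal] at h0
  refine (hVo.measure_pos volume ⟨x, hxV⟩).ne' (measure_mono_null (fun y (hy : y ∈ V) => ?_) h0)
  exact ⟨by simpa using (hVU hy).2, hy⟩

variable {α : ℝ}

/-- Split the law as that of `s^{1/α} X + (1-s)^{1/α} X'` with independent copies. The density at
`s^{1/α} u` is a mean over `X'` of the density of the first summand, which is positive near `X' =
0`, a region charged because the density at `0` is positive. -/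
lemma cfDensity_stable_pos_smul (hα : 0 < α)
    (hP : ∀ y, charFun P y = ((Real.exp (-‖y‖ ^ α) : ℝ) : ℂ)) (hφ : Integrable (charFun P))
    (h0 : 0 < (cfDensity (charFun P) 0).re) {u : E d} (hu : 0 < (cfDensity (charFun P) u).re)
    {s : ℝ} (hs0 : 0 < s) (hs1 : s < 1) :
    0 < (cfDensity (charFun P) (s ^ (1 / α) • u)).re := by
  have hs1' : 0 < 1 - s := by linarith
  have key : ∀ {r : ℝ}, 0 < r → ∀ y : E d,
      charFun P (r ^ (1 / α) • y) = ((Real.exp (-(r * ‖y‖ ^ α)) : ℝ) : ℂ) := by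
    intro r hr y
    rw [hP, norm_smul, Real.norm_of_nonneg (by positivity), Real.mul_rpow (by positivity)
      (norm_nonneg _), ← Real.rpow_mul hr.le, one_div_mul_cancel hα.ne', Real.rpow_one]
  set a := s ^ (1 / α) with ha
  set b := (1 - s) ^ (1 / α) with hb
  have ha0 : 0 < a := by positivity
  have hb0 : 0 < b := by positivity
  have : IsProbabilityMeasure (P.map fun x => b • x) :=
    Measure.isProbabilityMeasure_map (by fun_prop)
  set F : E d → ℝ := fun z => (cfDensity (fun y => charFun P (a • y)) z).re with hF
  have hh : Integrable fun y => charFun P (a • y) :=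
    (integrable_comp_smul_iff volume _ ha0.ne').2 hφ
  have hFeq : ∀ z, cfDensity (fun y => charFun P (a • y)) z = F z ∧
      F z = (a ^ d)⁻¹ * (cfDensity (charFun P) (a⁻¹ • z)).re := by
    intro z
    have h1 : F z = (a ^ d)⁻¹ * (cfDensity (charFun P) (a⁻¹ • z)).re := by
      rw [hF]
      simp only
      rw [cfDensity_comp_smul ha0, Complex.re_ofReal_mul]
    refine ⟨?_, h1⟩
    rw [h1, cfDensity_comp_smul ha0, Complex.ofReal_mul,
      ← (cfDensity_charFun_nonneg hφ (a⁻¹ • z)).2]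
  have hF0 : ∀ z, 0 ≤ F z := fun z => by
    rw [(hFeq z).2]
    exact mul_nonneg (by positivity) (cfDensity_charFun_nonneg hφ _).1
  have hFc : Continuous F := Complex.continuous_re.comp (continuous_cfDensity hh)
  have hconv : (cfDensity (charFun P) (a • u)).re = ∫ z, F (a • u - z) ∂P.map fun x => b • x := by
    have h1 : charFun P = fun y => charFun P (a • y) * charFun (P.map fun x => b • x) y := by
      funext y
      rw [charFun_map_smul, key hs0, key hs1', ← Complex.ofReal_mul, ← Real.exp_add, hP]
      congr 3
      ring
    conv_lhs => rw [h1]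
    rw [cfDensity_mul_charFun hh]
    simp_rw [(hFeq _).1]
    rw [integral_complex_ofReal, Complex.ofReal_re]
  rw [hconv]
  obtain ⟨B, hB⟩ : ∃ B, ∀ z, ‖F z‖ ≤ B :=
    ⟨_, fun z => (Complex.abs_re_le_norm _).trans (norm_cfDensity_le z)⟩
  have hFm : Continuous fun z => F (a • u - z) := hFc.comp (continuous_const.sub continuous_id)
  rw [integral_pos_iff_support_of_nonneg (fun z => hF0 _)
    (Integrable.of_bound hFm.aestronglyMeasurable B (.of_forall fun z => hB _)),
    Measure.map_apply (by fun_prop) (measurableSet_support hFm.measurable)]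
  refine measure_pos_of_mem_nhds (Complex.continuous_re.comp (continuous_cfDensity hφ))
    (eq_withDensity_cfDensity hφ) h0 ?_
  have hne : F (a • u - b • (0 : E d)) ≠ 0 := by
    rw [smul_zero, sub_zero, (hFeq _).2, smul_smul, inv_mul_cancel₀ ha0.ne', one_smul]
    exact (mul_pos (by positivity) hu).ne'
  have hc : Continuous fun x : E d => F (a • u - b • x) := hFm.comp (continuous_const_smul b)
  exact hc.continuousAt.eventually_ne hne

/-- A law carried by a bounded set satisfies `1 - Re φ(y) = O(‖y‖²)`, which contradicts `1 - exp
(-‖y‖^α) ≥ ‖y‖^α / 2` for small `y` because `α < 2`. -/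
lemma exists_density_pos_of_stable (hd : 0 < d) (hα : 0 < α) (hα2 : α < 2)
    (hP : ∀ y, charFun P y = ((Real.exp (-‖y‖ ^ α) : ℝ) : ℂ)) {L : E d → ℝ}
    (hLm : Measurable L)
    (hL : P = volume.withDensity fun x => ENNReal.ofReal (L x)) (R : ℝ) :
    ∃ u, R < ‖u‖ ∧ 0 < L u := by
  by_contra! hcon
  have hae : ∀ᵐ x ∂P, ‖x‖ ≤ R := by
    rw [hL, ae_withDensity_iff hLm.ennreal_ofReal]
    refine .of_forall fun x hx => ?_
    by_contra! hR
    exact hx (ENNReal.ofReal_eq_zero.2 (hcon x hR))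
  have hR0 : 0 ≤ R := by
    obtain ⟨x, hx⟩ := hae.exists
    exact (norm_nonneg x).trans hx
  have h1 : ∀ y : E d, 1 - Real.exp (-‖y‖ ^ α) ≤ (R * ‖y‖) ^ 2 / 2 := by
    intro y
    have hre : Real.exp (-‖y‖ ^ α) = ∫ x, Real.cos (inner ℝ x y) ∂P := by
      have h := congrArg Complex.re (hP y)
      rw [Complex.ofReal_re, charFun_apply] at h
      rw [← h, ← RCLike.re_eq_complex_re, ← integral_re]
      · refine integral_congr_ae (.of_forall fun x => ?_)
        simp only [RCLike.re_eq_complex_re, Complex.exp_ofReal_mul_I_re]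
      · refine Integrable.of_bound (C := 1) ?_ (.of_forall fun x => ?_)
        · exact (by fun_prop : Continuous fun x : E d =>
            Complex.exp ((inner ℝ x y : ℝ) * Complex.I)).aestronglyMeasurable
        · rw [Complex.norm_exp_ofReal_mul_I]
    have h2 : ∫ _, (1 - (R * ‖y‖) ^ 2 / 2) ∂P ≤ ∫ x, Real.cos (inner ℝ x y) ∂P := by
      refine integral_mono_ae (integrable_const _) ?_ ?_
      · refine Integrable.of_bound (C := 1) ?_ (.of_forall fun x => Real.abs_cos_le_one _)
        exact (by fun_prop : Continuous fun x : E d =>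
          Real.cos (inner ℝ x y)).aestronglyMeasurable
      · filter_upwards [hae] with x hx
        have h3 : |(inner ℝ x y : ℝ)| ≤ R * ‖y‖ := (abs_real_inner_le_norm x y).trans
          (mul_le_mul_of_nonneg_right hx (norm_nonneg _))
        have h4 : (inner ℝ x y : ℝ) ^ 2 ≤ (R * ‖y‖) ^ 2 := sq_le_sq' (abs_le.1 h3).1 (abs_le.1 h3).2
        linarith [Real.one_sub_sq_div_two_le_cos (x := (inner ℝ x y : ℝ))]
    rw [integral_const, probReal_univ, one_smul] at h2
    linarith
  have h2 : ∀ t : ℝ, 0 < t → t ≤ 1 → 1 ≤ R ^ 2 * t ^ (2 - α) := by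
    intro t ht ht1
    have h3 := h1 (EuclideanSpace.single ⟨0, hd⟩ t)
    rw [PiLp.norm_single, Real.norm_of_nonneg ht.le] at h3
    set w := t ^ α with hw
    have hw0 : 0 < w := by positivity
    have hw1 : w ≤ 1 := Real.rpow_le_one ht.le ht1 hα.le
    have h4 : w / 2 ≤ 1 - Real.exp (-w) := by
      have h5 : Real.exp (-w) ≤ (1 + w)⁻¹ := by
        rw [Real.exp_neg]
        exact inv_anti₀ (by positivity) (by linarith [Real.add_one_le_exp w])
      have h6 : (1 + w)⁻¹ ≤ 1 - w / 2 := by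
        rw [inv_le_iff_one_le_mul₀ (by positivity)]
        nlinarith
      linarith
    have h5 : w ≤ R ^ 2 * t ^ 2 := by nlinarith
    rw [Real.rpow_sub ht, ← mul_div_assoc, le_div_iff₀ (by positivity), one_mul, Real.rpow_two]
    exact h5
  have h3 : Tendsto (fun n : ℕ => R ^ 2 * (1 / ((n : ℝ) + 1)) ^ (2 - α)) atTop
      (𝓝 (R ^ 2 * 0 ^ (2 - α))) :=
    ((tendsto_one_div_add_atTop_nhds_zero_nat).rpow_const (Or.inr (by linarith))).const_mul _
  rw [Real.zero_rpow (by linarith), mul_zero] at h3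
  refine absurd (ge_of_tendsto' h3 fun n => h2 _ (by positivity) ?_) (by norm_num)
  rw [div_le_one (by positivity)]
  linarith [Nat.cast_nonneg (α := ℝ) n]

/-- The density is positive at `0`, as the integral of a positive function, and at points of
arbitrarily large norm. Contraction reaches every smaller positive norm, and rotation invariance
every direction. -/
theorem cfDensity_stable_pos (hd : 0 < d) (hα : 0 < α) (hα2 : α < 2)
    (hP : ∀ y, charFun P y = ((Real.exp (-‖y‖ ^ α) : ℝ) : ℂ)) (hφ : Integrable (charFun P))
    (x : E d) : 0 < (cfDensity (charFun P) x).re := by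
  have h0 : 0 < (cfDensity (charFun P) 0).re := by
    rw [cfDensity, Complex.re_ofReal_mul]
    simp only [inner_zero_left, Complex.ofReal_zero, neg_zero, zero_mul, Complex.exp_zero, mul_one,
      hP]
    rw [integral_complex_ofReal, Complex.ofReal_re]
    have hpi := Real.pi_pos
    refine mul_pos (by positivity) ?_
    refine integral_exp_pos ?_
    have h : Integrable fun y => (charFun P y).re := hφ.re
    simpa only [hP, Complex.ofReal_re] using h
  by_cases hx : x = 0
  · rwa [hx]
  obtain ⟨u, hu1, hu2⟩ := exists_density_pos_of_stable hd hα hα2 hP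
    (Complex.continuous_re.comp (continuous_cfDensity hφ)).measurable
    (eq_withDensity_cfDensity hφ) ‖x‖
  have hx0 : 0 < ‖x‖ := norm_pos_iff.2 hx
  have hu0 : 0 < ‖u‖ := hx0.trans hu1
  have h1 := cfDensity_stable_pos_smul hα hP hφ h0 hu2
    -- With this `s`, the contraction factor `s^{1/α}` brings `u` to the norm of `x`; a reflection
    -- then carries the contracted point to `x`.
    (s := (‖x‖ / ‖u‖) ^ α) (by positivity)
    (Real.rpow_lt_one (by positivity) ((div_lt_one hu0).2 hu1) hα)
  rw [← Real.rpow_mul (by positivity), mul_one_div_cancel hα.ne', Real.rpow_one] at h1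
  set v := (‖x‖ / ‖u‖) • u with hv
  have hnorm : ‖v‖ = ‖x‖ := by
    rw [hv, norm_smul, Real.norm_of_nonneg (by positivity), div_mul_cancel₀ _ hu0.ne']
  rw [← Submodule.reflection_sub hnorm, cfDensity_comp_isometry _ fun y => ?_]
  · exact h1
  · rw [hP, hP, LinearIsometryEquiv.norm_map]

end StableDensity

/-! ### The branching random walk with Gaussian and stable motion -/

section Continuous

variable {d : ℕ} {μ : PMF ℕ} {P : Measure (E d)} [IsProbabilityMeasure P]

/-- Both asymptotic relations, from a local limit theorem. -/
theorem LocalLimit.uniformAsymp_and_uniformEquiv {ℓ : Measure (E d)} [SFinite ℓ] (hμ : Critical μ)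
    {A : Set (E d)} (hA : MeasurableSet A) {f : E d → ℂ} (hf : Admissible A f) (hℓA : ℓ A ≠ ∞)
    (hℓA0 : ℓ A ≠ 0) {γ θ : ℝ} (hγ0 : 0 < γ) (hγ1 : γ ≤ 1)
    (hm : ∑' k : ℕ, (k : ℝ≥0∞) ^ (1 + γ) * μ k < ∞) (hθ : 1 < θ * γ) {D D' : ℕ → Set (E d)}
    {g F : ℕ → E d → ℝ} (hL : LocalLimit P A ℓ θ D g) (hD : ∀ n, D' n ⊆ D n)
    (hF : ∀ n : ℕ, 0 < n → ∀ x, F n x = (n : ℝ) ^ (-θ) * g n x) {I : ℂ}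
    (hI : I = ∫ y in A, G μ hμ P A f y ∂ℓ) :
    UniformAsymp D' (keyExpectation μ P A f) F I ∧
      ((∀ y, (f y).im = 0) ∨ I ≠ 0 → UniformEquiv D' (keyExpectation μ P A f) F I) := by
  have hfm := hf.continuous.measurable
  have hre := fun y => hf.re_nonpos y
  have h0 : ∀ y ∉ A, f y = 0 := fun y hy => hf.eq_zero hy
  have hm' := summable_moment hm
  have h : UniformAsymp D' (keyExpectation μ P A f) F I := by
    intro ε hε
    filter_upwards [uniformAsymp_keyExpectation hμ hA hfm hre h0 hℓA hγ0 hγ1 hm' hθ hL ε hε,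
      eventually_gt_atTop 0] with n hn hn0 x hx
    rw [hI, hF n hn0]
    exact hn x (hD n hx)
  refine ⟨h, fun hor => h.uniformEquiv ?_⟩
  rcases hor with hr | hne
  · rw [hI]
    exact integral_G_ne_zero hμ hA hfm hre h0 hr hℓA hℓA0 hγ0 hγ1 hm' hθ hL.invariant
      hL.concentration
  · exact hne

/-- The density of the centred Gaussian law with covariance matrix `S`. -/
noncomputable def gaussDensity (S : Matrix (Fin d) (Fin d) ℝ) (x : E d) : ℝ :=
  (2 * Real.pi) ^ (-(d : ℝ) / 2) * S.det ^ (-(1 : ℝ) / 2) *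
    Real.exp (-((x : Fin d → ℝ) ⬝ᵥ (S⁻¹ *ᵥ (x : Fin d → ℝ))) / 2)

lemma continuous_gaussDensity (S : Matrix (Fin d) (Fin d) ℝ) : Continuous (gaussDensity S) := by
  have h : Continuous fun x : E d => (x : Fin d → ℝ) := PiLp.continuous_ofLp 2 _
  have h2 : Continuous fun x : E d => (x : Fin d → ℝ) ⬝ᵥ (S⁻¹ *ᵥ (x : Fin d → ℝ)) :=
    h.dotProduct (Continuous.matrix_mulVec continuous_const h)
  unfold gaussDensity
  fun_prop

lemma gaussDensity_pos {S : Matrix (Fin d) (Fin d) ℝ} (hS : 0 < S.det) (x : E d) :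
    0 < gaussDensity S x := by
  have := Real.pi_pos
  unfold gaussDensity
  positivity

lemma gaussDensity_neg (S : Matrix (Fin d) (Fin d) ℝ) (x : E d) :
    gaussDensity S (-x) = gaussDensity S x := by
  simp only [gaussDensity, WithLp.ofLp_neg, Matrix.mulVec_neg, dotProduct_neg,
    neg_dotProduct, neg_neg]

lemma gaussFactor_eq (S : Matrix (Fin d) (Fin d) ℝ) {n : ℕ} (hn : 0 < n) (x : E d) :
    gaussFactor S n x =
      (n : ℝ) ^ (-((d : ℝ) / 2)) * gaussDensity S (((n : ℝ) ^ (1 / 2 : ℝ))⁻¹ • x) := by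
  have hn' : (0 : ℝ) < n := by exact_mod_cast hn
  have hpi := Real.pi_pos
  have hsq : (n : ℝ) ^ (1 / 2 : ℝ) * (n : ℝ) ^ (1 / 2 : ℝ) = n := by
    rw [← Real.sqrt_eq_rpow, Real.mul_self_sqrt hn'.le]
  have hs : (n : ℝ) ^ (1 / 2 : ℝ) ≠ 0 := by positivity
  rw [gaussFactor, gaussDensity, Real.mul_rpow (by positivity) hn'.le, ← neg_div, ← mul_assoc,
    ← mul_assoc, mul_comm ((n : ℝ) ^ (-(d : ℝ) / 2))]
  congr 2
  simp only [WithLp.ofLp_smul, Matrix.mulVec_smul, dotProduct_smul, smul_dotProduct, smul_eq_mul]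
  conv_lhs => rw [← hsq]
  field_simp

lemma gaussDensity_one (x : E d) : gaussDensity 1 x = heat d 2 x := by
  have hpi := Real.pi_pos
  have hx : (x : Fin d → ℝ) ⬝ᵥ (x : Fin d → ℝ) = ‖x‖ ^ 2 := by
    rw [EuclideanSpace.real_norm_sq_eq]
    simp [dotProduct, sq]
  rw [gaussDensity, heat, inv_one, Matrix.one_mulVec, Matrix.det_one, Real.one_rpow, mul_one, hx,
    mul_comm Real.pi 2, ← mul_assoc]
  congr 1
  · rw [← Real.rpow_natCast, ← Real.rpow_neg (by positivity), ← Real.rpow_add (by positivity)]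
    congr 1
    ring
  · congr 1
    ring

lemma FiniteSecondMoment.tsum_rpow_lt_top (h : FiniteSecondMoment μ) :
    ∑' k : ℕ, (k : ℝ≥0∞) ^ ((1 : ℝ) + 1) * μ k < ∞ := by
  refine lt_of_eq_of_lt (tsum_congr fun k => ?_) h
  rw [one_add_one_eq_two, ENNReal.rpow_ofNat]

lemma measure_closedBall_ne {c : E d} {r : ℝ} (hr : 0 < r) :
    volume (Metric.closedBall c r) ≠ ∞ ∧ volume (Metric.closedBall c r) ≠ 0 :=
  ⟨measure_closedBall_lt_top.ne, (Metric.measure_closedBall_pos volume c hr).ne'⟩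

theorem asymp_of_gaussian (hμ : Critical μ) (h : H1 μ P) {c : E d} {r : ℝ} (hr : 0 < r)
    {f : E d → ℂ} (hf : Admissible (Metric.closedBall c r) f) {M : ℝ} (hM : 0 < M) :
    UniformAsymp (fun n => {x | ‖x‖ ≤ M * Real.sqrt n})
      (keyExpectation μ P (Metric.closedBall c r) f) (gaussFactor 1)
      (Icont μ hμ P (Metric.closedBall c r) f) ∧
    ((∀ y, (f y).im = 0) ∨ Icont μ hμ P (Metric.closedBall c r) f ≠ 0 →
      UniformEquiv (fun n => {x | ‖x‖ ≤ M * Real.sqrt n})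
        (keyExpectation μ P (Metric.closedBall c r) f) (gaussFactor 1)
        (Icont μ hμ P (Metric.closedBall c r) f)) := by
  have hcf : ∀ y, charFun P y = Complex.exp (-((2 : ℝ) : ℂ)⁻¹ * ‖y‖ ^ 2) := by
    intro y
    rw [h.gaussian, charFun_stdGaussian]
    congr 1
    push_cast
    ring
  have hfun : charFun P = fun y => Complex.exp (-((2 : ℝ) : ℂ)⁻¹ * ‖y‖ ^ 2) := funext hcf
  have hint : Integrable (charFun P) := by
    rw [hfun]
    exact integrable_gaussian two_pos
  have hL : ∀ x, (cfDensity (charFun P) x).re = gaussDensity 1 x := fun x => by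
    rw [hfun, cfDensity_gaussian two_pos, Complex.ofReal_re, gaussDensity_one]
  have hP := eq_withDensity_cfDensity hint
  simp_rw [hL] at hP
  have hd : (3 : ℝ) ≤ d := by exact_mod_cast h.three_le
  obtain ⟨hv, hv0⟩ := measure_closedBall_ne (c := c) hr
  have hS : 0 < (1 : Matrix (Fin d) (Fin d) ℝ).det := by simp
  have hLL := localLimit_of_stable (P := P) (κ := 1 / 2) (α := 2) two_pos
    (fun y => by
      rw [hcf, Complex.ofReal_exp, Real.rpow_two]
      congr 1
      push_cast
      ring)
    (continuous_gaussDensity 1) (gaussDensity_pos hS) (gaussDensity_neg 1)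
    (fun x => (hL x).symm.trans_le ((Complex.re_le_norm _).trans (norm_cfDensity_le x))) hP
    (A := Metric.closedBall c r) Metric.isClosed_closedBall.measurableSet hv hM
  refine hLL.uniformAsymp_and_uniformEquiv hμ Metric.isClosed_closedBall.measurableSet hf hv hv0
    one_pos le_rfl h.secondMoment.tsum_rpow_lt_top (by linarith)
    (fun n x (hx : ‖x‖ ≤ _) => ⟨?_, Set.mem_univ x⟩)
    (fun n hn x => gaussFactor_eq 1 hn x) rfl
  rwa [← Real.sqrt_eq_rpow]

theorem asymp_of_stable (hμ : Critical μ) {α : ℝ} (h : H3 μ P α) :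
    ∃ L : E d → ℝ, Continuous L ∧ (∀ x, 0 ≤ L x) ∧
      P = volume.withDensity (fun x => ENNReal.ofReal (L x)) ∧
      ∀ (c : E d) (r : ℝ), 0 < r →
      ∀ f : E d → ℂ, Admissible (Metric.closedBall c r) f →
      ∀ M : ℝ, 0 < M →
        UniformAsymp (fun n => {x | ‖x‖ ≤ M * (n : ℝ) ^ (1 / α)})
          (keyExpectation μ P (Metric.closedBall c r) f) (stableFactor α L)
          (Icont μ hμ P (Metric.closedBall c r) f) ∧
        ((∀ y, (f y).im = 0) ∨ Icont μ hμ P (Metric.closedBall c r) f ≠ 0 →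
          UniformEquiv (fun n => {x | ‖x‖ ≤ M * (n : ℝ) ^ (1 / α)})
            (keyExpectation μ P (Metric.closedBall c r) f) (stableFactor α L)
            (Icont μ hμ P (Metric.closedBall c r) f)) := by
  obtain ⟨β, hβ0, hβ1, hβ, hmom⟩ := h.moments
  have hα := h.alpha_pos
  have hd : 0 < d := by
    have : (0 : ℝ) < d := (div_pos hα hβ0).trans hβ
    exact_mod_cast this
  have hint : Integrable (charFun P) := by
    have h1 := (integrable_exp_neg_norm_rpow hd one_pos hα).ofReal (𝕜 := ℂ)
    refine h1.congr (.of_forall fun y => ?_)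
    simp only [h.stable, one_mul]
    rfl
  have hpos := cfDensity_stable_pos hd hα h.alpha_lt_two h.stable hint
  have hP := eq_withDensity_cfDensity hint
  have hc : Continuous fun x => (cfDensity (charFun P) x).re :=
    Complex.continuous_re.comp (continuous_cfDensity hint)
  refine ⟨fun x => (cfDensity (charFun P) x).re, hc, fun x => (hpos x).le, hP,
    fun c r hr f hf M hM => ?_⟩
  obtain ⟨hv, hv0⟩ := measure_closedBall_ne (c := c) hr
  have hLL := localLimit_of_stable (P := P) (κ := 1) hα (fun y => by rw [h.stable, one_mul]) hc hpos
    (fun x => by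
      have := cfDensity_comp_isometry (φ := charFun P) (LinearIsometryEquiv.neg ℝ)
        (fun y => by rw [h.stable, h.stable, LinearIsometryEquiv.norm_map]) x
      rw [LinearIsometryEquiv.coe_neg] at this
      rw [this])
    (fun x => (Complex.re_le_norm _).trans (norm_cfDensity_le x)) hP
    (A := Metric.closedBall c r) Metric.isClosed_closedBall.measurableSet hv hM
  -- Such a `γ` exists because `d > α/β`. Below `β` the moment is finite, and above `α/d` the
  -- exponent `θγ = dγ/α` exceeds `1`.
  obtain ⟨γ, hγ1, hγ2⟩ : ∃ γ, max (α / d) 0 < γ ∧ γ < β := by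
    refine exists_between (max_lt ?_ hβ0)
    rw [div_lt_iff₀ hβ0] at hβ
    rw [div_lt_iff₀ (by exact_mod_cast hd)]
    linarith
  have hγ0 : 0 < γ := (le_max_right _ _).trans_lt hγ1
  refine hLL.uniformAsymp_and_uniformEquiv hμ Metric.isClosed_closedBall.measurableSet hf hv hv0
    hγ0 (hγ2.le.trans hβ1) (hmom γ hγ0 hγ2) ?_ (fun n x hx => ⟨hx, Set.mem_univ x⟩)
    (fun n hn x => ?_) rfl
  · have h1 := (le_max_left _ _).trans_lt hγ1
    rw [div_lt_iff₀ (by exact_mod_cast hd)] at h1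
    rw [div_mul_eq_mul_div, lt_div_iff₀ hα]
    linarith
  · rw [stableFactor, neg_div]

end Continuous

/-! ### Gaussian densities with a general covariance matrix -/

section GaussianTransform

variable {d : ℕ} {S : Matrix (Fin d) (Fin d) ℝ}

/-- The quadratic form `⟨u, S u⟩`. -/
noncomputable def quad (S : Matrix (Fin d) (Fin d) ℝ) (u : E d) : ℝ :=
  (u : Fin d → ℝ) ⬝ᵥ (S *ᵥ (u : Fin d → ℝ))

lemma continuous_quad (S : Matrix (Fin d) (Fin d) ℝ) : Continuous (quad S) := by
  have h : Continuous fun x : E d => (x : Fin d → ℝ) := PiLp.continuous_ofLp 2 _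
  exact h.dotProduct (Continuous.matrix_mulVec continuous_const h)

lemma inner_eq_dotProduct (x y : E d) :
    (inner ℝ x y : ℝ) = (x : Fin d → ℝ) ⬝ᵥ (y : Fin d → ℝ) := by
  rw [EuclideanSpace.inner_eq_star_dotProduct, star_trivial, dotProduct_comm]

lemma repr_mulVec (hS : S.IsHermitian) (u : E d) (i : Fin d) :
    hS.eigenvectorBasis.repr (WithLp.toLp 2 (S *ᵥ (u : Fin d → ℝ))) i =
      hS.eigenvalues i * hS.eigenvectorBasis.repr u i := by
  rw [OrthonormalBasis.repr_apply_apply, OrthonormalBasis.repr_apply_apply, inner_eq_dotProduct,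
    inner_eq_dotProduct, Matrix.dotProduct_mulVec]
  have hT : Sᵀ = S := by simpa [Matrix.IsHermitian] using hS
  rw [← Matrix.mulVec_transpose, hT, hS.mulVec_eigenvectorBasis, smul_dotProduct, smul_eq_mul]

lemma inner_eq_sum_repr (hS : S.IsHermitian) (x y : E d) :
    (inner ℝ x y : ℝ) = ∑ i, hS.eigenvectorBasis.repr x i * hS.eigenvectorBasis.repr y i := by
  rw [← hS.eigenvectorBasis.repr.inner_map_map, inner_eq_dotProduct]
  rfl

lemma quad_eq_sum (hS : S.IsHermitian) (u : E d) :
    quad S u = ∑ i, hS.eigenvalues i * hS.eigenvectorBasis.repr u i ^ 2 := by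
  have h : quad S u = inner ℝ u (WithLp.toLp 2 (S *ᵥ (u : Fin d → ℝ))) :=
    by rw [inner_eq_dotProduct]; rfl
  rw [h, inner_eq_sum_repr hS]
  refine Finset.sum_congr rfl fun i _ => ?_
  rw [repr_mulVec]
  ring

lemma quad_inv_eq_sum (hS : S.PosDef) (x : E d) :
    quad S⁻¹ x = ∑ i, hS.1.eigenvectorBasis.repr x i ^ 2 / hS.1.eigenvalues i := by
  set w : E d := WithLp.toLp 2 (S⁻¹ *ᵥ (x : Fin d → ℝ)) with hw
  have hx : WithLp.toLp 2 (S *ᵥ (w : Fin d → ℝ)) = x := by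
    rw [hw]
    simp only [Matrix.mulVec_mulVec]
    rw [Matrix.mul_nonsing_inv _ (isUnit_iff_ne_zero.2 hS.det_pos.ne'), Matrix.one_mulVec]
  have h : quad S⁻¹ x = inner ℝ x w := by rw [inner_eq_dotProduct]; rfl
  rw [h, inner_eq_sum_repr hS.1]
  refine Finset.sum_congr rfl fun i _ => ?_
  have h1 := repr_mulVec hS.1 w i
  rw [hx] at h1
  have h2 := (hS.eigenvalues_pos i).ne'
  rw [h1]
  field_simp

lemma exists_le_quad (hS : S.PosDef) : ∃ c : ℝ, 0 < c ∧ ∀ u : E d, c * ‖u‖ ^ 2 ≤ quad S u := by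
  obtain ⟨c, hc0, hc⟩ : ∃ c : ℝ, 0 < c ∧ ∀ i, c ≤ hS.1.eigenvalues i := by
    rcases isEmpty_or_nonempty (Fin d) with h | h
    · exact ⟨1, one_pos, fun i => isEmptyElim i⟩
    · obtain ⟨i, hi⟩ := Finite.exists_min hS.1.eigenvalues
      exact ⟨_, hS.eigenvalues_pos i, hi⟩
  refine ⟨c, hc0, fun u => ?_⟩
  rw [quad_eq_sum hS.1, ← real_inner_self_eq_norm_sq, inner_eq_sum_repr hS.1, Finset.mul_sum]
  refine Finset.sum_le_sum fun i _ => ?_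
  rw [← sq]
  exact mul_le_mul_of_nonneg_right (hc i) (sq_nonneg _)

lemma integrable_exp_neg_quad (hS : S.PosDef) :
    Integrable fun u : E d => ((Real.exp (-quad S u / 2) : ℝ) : ℂ) := by
  obtain ⟨c, hc, h⟩ := exists_le_quad hS
  have hb : Integrable fun u : E d => Complex.exp (-((2 / c : ℝ) : ℂ)⁻¹ * ‖u‖ ^ 2) :=
    integrable_gaussian (by positivity)
  refine hb.mono ?_ (.of_forall fun u => ?_)
  · have := continuous_quad S
    exact (by fun_prop : Continuous fun u : E d => ((Real.exp (-quad S u / 2) : ℝ) : ℂ)).aestronglyMeasurable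
  · have e : -((2 / c : ℝ) : ℂ)⁻¹ * ‖u‖ ^ 2 = ((-(c * ‖u‖ ^ 2) / 2 : ℝ) : ℂ) := by
      push_cast
      rw [inv_div]
      ring
    rw [e, ← Complex.ofReal_exp, Complex.norm_real, Complex.norm_real,
      Real.norm_of_nonneg (Real.exp_pos _).le, Real.norm_of_nonneg (Real.exp_pos _).le]
    exact Real.exp_le_exp.2 (by linarith [h u])

/-- Coordinates in an orthonormal eigenbasis of `S` preserve Lebesgue measure and split the integral
into one-dimensional Gaussian integrals; the eigenvalues recombine into `det S` and the quadratic
form of `S⁻¹`. -/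
theorem cfDensity_exp_neg_quad (hS : S.PosDef) (x : E d) :
    cfDensity (fun u => ((Real.exp (-quad S u / 2) : ℝ) : ℂ)) x = gaussDensity S x := by
  have hpi := Real.pi_pos
  set b := hS.1.eigenvectorBasis with hb
  set v := hS.1.eigenvalues with hv
  have hvp : ∀ i, 0 < v i := hS.eigenvalues_pos
  set ξ : Fin d → ℝ := fun i => b.repr x i with hξ
  have h1 := GaussianFourier.integral_cexp_neg_sum_mul_add (ι := Fin d)
    (b := fun i => ((v i / 2 : ℝ) : ℂ)) (fun i => by
      rw [Complex.ofReal_re]; exact half_pos (hvp i)) (fun i => -(Complex.I * ξ i))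
  have h2 : ∫ u : E d, ((Real.exp (-quad S u / 2) : ℝ) : ℂ) *
      Complex.exp (-(inner ℝ x u : ℝ) * Complex.I) = ∫ w : Fin d → ℝ,
      Complex.exp (-∑ i, ((v i / 2 : ℝ) : ℂ) * (w i : ℂ) ^ 2 + ∑ i, -(Complex.I * ξ i) * w i) := by
    have hmp := (PiLp.volume_preserving_ofLp (Fin d)).comp b.measurePreserving_repr
    have hme : MeasurableEmbedding (fun u : E d => (WithLp.ofLp (b.repr u) : Fin d → ℝ)) :=
      (MeasurableEquiv.toLp 2 (Fin d → ℝ)).symm.measurableEmbedding.comp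
        b.repr.toHomeomorph.measurableEmbedding
    rw [← hmp.integral_comp hme]
    refine integral_congr_ae (.of_forall fun u => ?_)
    simp only [Function.comp_apply]
    rw [Complex.ofReal_exp, ← Complex.exp_add, quad_eq_sum hS.1, inner_eq_sum_repr hS.1]
    congr 1
    push_cast
    rw [neg_div, Finset.sum_div, neg_mul, Finset.sum_mul]
    congr 1
    · congr 1
      exact Finset.sum_congr rfl fun i _ => by ring
    · rw [← Finset.sum_neg_distrib]
      exact Finset.sum_congr rfl fun i _ => by ring
  rw [cfDensity, h2, h1]
  have h3 : ∀ i, ((Real.pi : ℂ) / ((v i / 2 : ℝ) : ℂ)) ^ (1 / 2 : ℂ) *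
      Complex.exp ((-(Complex.I * ξ i)) ^ 2 / (4 * ((v i / 2 : ℝ) : ℂ))) =
      ((((2 * Real.pi) ^ (1 / 2 : ℝ) * v i ^ (-(1 : ℝ) / 2)) *
        Real.exp (-(ξ i ^ 2 / v i) / 2) : ℝ) : ℂ) := by
    intro i
    have hvi := hvp i
    have e1 : (2 * Real.pi) ^ (1 / 2 : ℝ) * v i ^ (-(1 : ℝ) / 2) =
        (Real.pi / (v i / 2)) ^ (1 / 2 : ℝ) := by
      rw [neg_div, Real.rpow_neg hvi.le, ← div_eq_mul_inv, ← Real.div_rpow (by positivity) hvi.le]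
      congr 1
      field_simp
    rw [e1, Complex.ofReal_mul, Complex.ofReal_cpow (by positivity), Complex.ofReal_exp]
    congr 1
    · push_cast
      rfl
    · congr 1
      rw [neg_sq, mul_pow, Complex.I_sq]
      push_cast
      field_simp
      norm_num
  simp_rw [h3]
  rw [← Complex.ofReal_prod, ← Complex.ofReal_mul]
  congr 1
  rw [Finset.prod_mul_distrib, Finset.prod_mul_distrib, Finset.prod_const, Finset.card_univ,
    Fintype.card_fin, Real.finsetProd_rpow _ _ fun i _ => (hvp i).le, ← Real.exp_sum,
    gaussDensity, ← mul_assoc, ← mul_assoc]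
  have hdet : S.det = ∏ i, v i := by
    rw [hS.1.det_eq_prod_eigenvalues]
    rfl
  rw [hdet]
  congr 1
  · congr 1
    rw [← Real.rpow_natCast, ← Real.rpow_natCast, ← Real.rpow_mul (by positivity),
      ← Real.rpow_neg (by positivity), ← Real.rpow_add (by positivity)]
    congr 1
    ring
  · congr 1
    have := quad_inv_eq_sum hS x
    rw [quad] at this
    rw [this, ← Finset.sum_div, Finset.sum_neg_distrib]

end GaussianTransform

/-! ### Characteristic functions of symmetric lattice laws -/

section LatticeCharFun

variable {d : ℕ} {P : Measure (E d)} [IsProbabilityMeasure P]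

lemma ae_of_finiteRange {R : Finset (Fin d → ℤ)} {p : (Fin d → ℤ) → ℝ≥0}
    (hP : P = ∑ z ∈ R, (p z : ℝ≥0∞) • Measure.dirac (latticePt z)) {q : E d → Prop}
    (hq : ∀ z ∈ R, q (latticePt z)) : ∀ᵐ x ∂P, q x := by
  rw [ae_iff, hP, Measure.finsetSum_apply]
  refine Finset.sum_eq_zero fun z hz => ?_
  rw [Measure.smul_apply, Measure.dirac_apply, Set.indicator_of_notMem, smul_zero]
  simpa using hq z hz

lemma latticePt_neg (z : Fin d → ℤ) : latticePt (-z) = -latticePt z := by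
  ext i
  simp [latticePt]

lemma latticePt_sub (z w : Fin d → ℤ) : latticePt (z - w) = latticePt z - latticePt w := by
  ext i
  simp [latticePt]

lemma latticePt_add (z w : Fin d → ℤ) : latticePt (z + w) = latticePt z + latticePt w := by
  ext i
  simp [latticePt]

lemma latticePt_injective : Function.Injective (latticePt (d := d)) := by
  intro z w h
  funext i
  have := congrFun (congrArg WithLp.ofLp h) i
  simpa [latticePt] using this

lemma map_neg_of_finiteRange {R : Finset (Fin d → ℤ)} {p : (Fin d → ℤ) → ℝ≥0}
    (hP : P = ∑ z ∈ R, (p z : ℝ≥0∞) • Measure.dirac (latticePt z))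
    (hR : ∀ z ∈ R, -z ∈ R ∧ p (-z) = p z) : P.map (fun x => -x) = P := by
  ext s hs
  rw [Measure.map_apply measurable_neg hs, hP, Measure.finsetSum_apply, Measure.finsetSum_apply]
  refine Finset.sum_nbij' (fun z => -z) (fun z => -z) (fun z hz => (hR z hz).1)
    (fun z hz => (hR z hz).1) (fun z _ => neg_neg z) (fun z _ => neg_neg z) fun z hz => ?_
  rw [Measure.smul_apply, Measure.smul_apply, (hR z hz).2, Measure.dirac_apply,
    Measure.dirac_apply, latticePt_neg]
  rfl

/-- The characteristic function of a symmetric law. -/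
noncomputable def cosTransform (P : Measure (E d)) (t : E d) : ℝ := ∫ x, Real.cos (inner ℝ x t) ∂P

lemma integrable_of_ae_bound {F : Type*} [NormedAddCommGroup F] {R : ℝ} (hR : ∀ᵐ x ∂P, ‖x‖ ≤ R)
    {φ : E d → F} (hφ : Continuous φ) : Integrable φ P := by
  obtain ⟨C, hC⟩ := (isCompact_closedBall (0 : E d) R).exists_bound_of_continuousOn hφ.continuousOn
  have : SecondCountableTopologyEither (E d) F := inferInstance
  refine Integrable.of_bound hφ.aestronglyMeasurable C ?_
  filter_upwards [hR] with x hx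
  exact hC x (by simpa using hx)

lemma integrable_cos (t : E d) : Integrable (fun x => Real.cos (inner ℝ x t)) P :=
  Integrable.of_bound (by fun_prop : Continuous fun x : E d =>
    Real.cos (inner ℝ x t)).aestronglyMeasurable 1 (.of_forall fun x => Real.abs_cos_le_one _)

lemma charFun_eq_cosTransform (hs : P.map (fun x => -x) = P) (t : E d) :
    charFun P t = cosTransform P t := by
  have hc : Continuous fun x : E d => Complex.exp ((inner ℝ x t : ℝ) * Complex.I) := by fun_prop
  have h1 : charFun P (-t) = charFun P t := by
    conv_rhs => rw [← hs]
    rw [charFun_apply, charFun_apply, integral_map (by fun_prop) hc.aestronglyMeasurable]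
    simp only [inner_neg_left, inner_neg_right]
  rw [charFun_neg, Complex.conj_eq_iff_re] at h1
  rw [← h1, charFun_apply, ← RCLike.re_eq_complex_re, ← integral_re, cosTransform]
  · simp only [RCLike.re_eq_complex_re, Complex.exp_ofReal_mul_I_re]
  · exact Integrable.of_bound (C := 1) hc.aestronglyMeasurable
      (.of_forall fun x => (Complex.norm_exp_ofReal_mul_I _).le)

lemma continuous_cosTransform (hs : P.map (fun x => -x) = P) : Continuous (cosTransform P) := by
  have h : cosTransform P = fun t => (charFun P t).re := by
    funext t
    rw [charFun_eq_cosTransform hs, Complex.ofReal_re]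
  rw [h]
  exact Complex.continuous_re.comp continuous_charFun

/-- Symmetry centres the law, so covariances are plain second moments. -/
lemma quad_covMat (hs : P.map (fun x => -x) = P) {R : ℝ} (hR : ∀ᵐ x ∂P, ‖x‖ ≤ R) (t : E d) :
    quad (covMat P) t = ∫ x, (inner ℝ x t : ℝ) ^ 2 ∂P := by
  have hm : ∀ i, ∫ x : E d, x i ∂P = 0 := by
    intro i
    have hc : Continuous fun x : E d => x i := by fun_prop
    have h1 : ∫ x : E d, x i ∂P = ∫ x : E d, -x i ∂P := by
      conv_lhs => rw [← hs]
      rw [integral_map (by fun_prop) hc.aestronglyMeasurable]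
      rfl
    rw [integral_neg] at h1
    linarith
  have hL2 : ∀ i, MemLp (fun x : E d => x i) 2 P := by
    intro i
    have hc : Continuous fun x : E d => x i := by fun_prop
    rw [memLp_two_iff_integrable_sq hc.aestronglyMeasurable]
    exact integrable_of_ae_bound hR (hc.pow 2)
  have hcov : ∀ i j, covMat P i j = ∫ x : E d, x i * x j ∂P := by
    intro i j
    rw [covMat, Matrix.of_apply, covariance_eq_sub (hL2 i) (hL2 j), hm, zero_mul, sub_zero]
    rfl
  have hi : ∀ i j, Integrable (fun x : E d => t i * t j * (x i * x j)) P := fun i j =>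
    integrable_of_ae_bound hR (by fun_prop)
  have h1 : ∀ x : E d, (inner ℝ x t : ℝ) ^ 2 = ∑ i, ∑ j, t i * t j * (x i * x j) := by
    intro x
    rw [inner_eq_dotProduct, sq, dotProduct, Finset.sum_mul_sum]
    refine Finset.sum_congr rfl fun i _ => Finset.sum_congr rfl fun j _ => ?_
    ring
  simp_rw [h1]
  rw [integral_finsetSum _ fun i _ => integrable_finsetSum _ fun j _ => hi i j, quad, dotProduct]
  refine Finset.sum_congr rfl fun i _ => ?_
  rw [integral_finsetSum _ fun j _ => hi i j, Matrix.mulVec, dotProduct, Finset.mul_sum]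
  refine Finset.sum_congr rfl fun j _ => ?_
  rw [integral_const_mul, ← hcov]
  ring

/-- Integrate `cos w ≤ 1 - 2w²/π²` and use `1 - v ≤ exp (-v)`. The radius `δ` keeps `|⟨x, t⟩| ≤ 1`,
so the cosines are positive and the absolute value can be dropped. -/
lemma exists_local_bound (hs : P.map (fun x => -x) = P) {R : ℝ} (hR : ∀ᵐ x ∂P, ‖x‖ ≤ R)
    (hS : (covMat P).PosDef) : ∃ c δ : ℝ, 0 < c ∧ 0 < δ ∧
      ∀ t : E d, ‖t‖ ≤ δ → |cosTransform P t| ≤ Real.exp (-(c * ‖t‖ ^ 2)) := by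
  obtain ⟨c, hc, hq⟩ := exists_le_quad hS
  have hpi := Real.pi_pos
  refine ⟨2 / Real.pi ^ 2 * c, (max R 1)⁻¹, by positivity, by positivity, fun t ht => ?_⟩
  have hw : ∀ᵐ x ∂P, |(inner ℝ x t : ℝ)| ≤ 1 := by
    filter_upwards [hR] with x hx
    calc |(inner ℝ x t : ℝ)| ≤ ‖x‖ * ‖t‖ := abs_real_inner_le_norm x t
      _ ≤ max R 1 * (max R 1)⁻¹ := mul_le_mul (hx.trans (le_max_left _ _)) ht (norm_nonneg _)
          (by positivity)
      _ = 1 := mul_inv_cancel₀ (by positivity)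
  have hi : Integrable (fun x : E d => (inner ℝ x t : ℝ) ^ 2) P :=
    integrable_of_ae_bound hR (by fun_prop)
  have h0 : 0 ≤ cosTransform P t := by
    refine integral_nonneg_of_ae ?_
    filter_upwards [hw] with x hx
    have h1 := Real.one_sub_sq_div_two_le_cos (x := (inner ℝ x t : ℝ))
    have h2 : (inner ℝ x t : ℝ) ^ 2 ≤ 1 := by rwa [sq_le_one_iff_abs_le_one]
    simp only [Pi.zero_apply]
    linarith
  rw [abs_of_nonneg h0]
  have h1 : cosTransform P t ≤ ∫ x, (1 - 2 / Real.pi ^ 2 * (inner ℝ x t : ℝ) ^ 2) ∂P := by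
    refine integral_mono_ae (integrable_cos t) ((integrable_const _).sub (hi.const_mul _)) ?_
    filter_upwards [hw] with x hx
    exact Real.cos_le_one_sub_mul_cos_sq (hx.trans (by linarith [Real.pi_gt_three]))
  rw [integral_sub (integrable_const _) (hi.const_mul _), integral_const, probReal_univ, one_smul,
    integral_const_mul, ← quad_covMat hs hR] at h1
  have h2 := Real.add_one_le_exp (-(2 / Real.pi ^ 2 * c * ‖t‖ ^ 2))
  have h3 := mul_le_mul_of_nonneg_left (hq t) (show 0 ≤ 2 / Real.pi ^ 2 by positivity)
  linarith

/-- The cube `[-π, π]^d`. -/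
def cube (d : ℕ) : Set (E d) := {t | ∀ i, t i ∈ Set.Icc (-Real.pi) Real.pi}

lemma isClosed_cube : IsClosed (cube d) := by
  have h : cube d = ⋂ i, {t : E d | t i ∈ Set.Icc (-Real.pi) Real.pi} := by
    ext t
    simp [cube]
  rw [h]
  exact isClosed_iInter fun i => isClosed_Icc.preimage (by fun_prop : Continuous fun t : E d => t i)

lemma norm_sq_le_of_mem_cube {t : E d} (ht : t ∈ cube d) : ‖t‖ ^ 2 ≤ d * Real.pi ^ 2 := by
  rw [EuclideanSpace.real_norm_sq_eq]
  calc ∑ i, t i ^ 2 ≤ ∑ _i : Fin d, Real.pi ^ 2 :=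
        Finset.sum_le_sum fun i _ => sq_le_sq' (ht i).1 (ht i).2
    _ = d * Real.pi ^ 2 := by simp

lemma isCompact_cube : IsCompact (cube d) := by
  refine Metric.isCompact_of_isClosed_isBounded isClosed_cube
    ((Metric.isBounded_closedBall (x := (0 : E d)) (r := Real.sqrt (d * Real.pi ^ 2))).subset
      fun t ht => ?_)
  rw [mem_closedBall_zero_iff]
  exact Real.le_sqrt_of_sq_le (norm_sq_le_of_mem_cube ht)

lemma exp_inner_sum {n : ℕ} (ξ : Fin n → E d) (t : E d) :
    Complex.exp ((inner ℝ (∑ i, ξ i) t : ℝ) * Complex.I) =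
      ∏ i, Complex.exp ((inner ℝ (ξ i) t : ℝ) * Complex.I) := by
  rw [← Complex.exp_sum, sum_inner, Complex.ofReal_sum, Finset.sum_mul]

/-- In the case of equality `exp (i⟨x, t⟩)` is almost surely a constant `ε = ±1`. By aperiodicity
`exp (i⟨z, t⟩) = ε^n` for each lattice point `z` and all large `n`. Two consecutive `n` with `z = 0`
give `ε = 1`; unit vectors then give `t_j ∈ 2πℤ`, so `t = 0` in the cube. -/
lemma abs_cosTransform_lt_one
    (ha : ∀ z : Fin d → ℤ, ∀ᶠ n : ℕ in atTop,
      0 < Measure.pi (fun _ : Fin n => P) {ξ | ∑ i, ξ i = latticePt z})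
    {t : E d} (ht : t ∈ cube d) (ht0 : t ≠ 0) : |cosTransform P t| < 1 := by
  have hle : |cosTransform P t| ≤ 1 := by
    have := norm_integral_le_of_norm_le_const (μ := P) (C := 1)
      (f := fun x => Real.cos (inner ℝ x t)) (.of_forall fun x => Real.abs_cos_le_one (inner ℝ x t))
    rwa [probReal_univ, mul_one] at this
  refine lt_of_le_of_ne hle fun heq => ht0 ?_
  obtain ⟨ε, hε, hεe⟩ : ∃ ε : ℝ, (ε = 1 ∨ ε = -1) ∧ cosTransform P t = ε := by
    rcases (abs_eq zero_le_one).1 heq with h | h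
    exacts [⟨1, .inl rfl, h⟩, ⟨-1, .inr rfl, h⟩]
  have hε2 : ε * ε = 1 := by rcases hε with h | h <;> simp [h]
  have hcos : ∀ᵐ x ∂P, Complex.exp ((inner ℝ x t : ℝ) * Complex.I) = ε := by
    have h1 : ∫ x, (1 - ε * Real.cos (inner ℝ x t)) ∂P = 0 := by
      rw [integral_sub (integrable_const _) ((integrable_cos t).const_mul _), integral_const_mul,
        ← cosTransform, hεe, integral_const, probReal_univ, one_smul, hε2, sub_self]
    have h2 : 0 ≤ᵐ[P] fun x => 1 - ε * Real.cos (inner ℝ x t) := by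
      refine .of_forall fun x => ?_
      have h3 := abs_le.1 (Real.abs_cos_le_one (inner ℝ x t))
      simp only [Pi.zero_apply]
      rcases hε with h | h <;> rw [h] <;> linarith [h3.1, h3.2]
    rw [integral_eq_zero_iff_of_nonneg_ae h2
      ((integrable_const _).sub ((integrable_cos t).const_mul _))] at h1
    filter_upwards [h1] with x hx
    have hx' : 1 - ε * Real.cos (inner ℝ x t) = 0 := hx
    have h3 : Real.cos (inner ℝ x t) = ε := by linear_combination (-ε) * hx' - Real.cos (inner ℝ x t) * hε2
    have h4 : Real.sin (inner ℝ x t) = 0 := by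
      have := Real.sin_sq_add_cos_sq (inner ℝ x t)
      rw [h3] at this
      nlinarith
    rw [Complex.exp_mul_I, ← Complex.ofReal_cos, ← Complex.ofReal_sin, h3, h4]
    simp
  have hpow : ∀ z : Fin d → ℤ, ∀ᶠ n : ℕ in atTop,
      Complex.exp ((inner ℝ (latticePt z) t : ℝ) * Complex.I) = (ε : ℂ) ^ n := by
    intro z
    filter_upwards [ha z] with n hn
    have hae : ∀ᵐ ξ ∂Measure.pi (fun _ : Fin n => P),
        ∀ i, Complex.exp ((inner ℝ (ξ i) t : ℝ) * Complex.I) = ε :=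
      ae_all_iff.2 fun i =>
        (Measure.quasiMeasurePreserving_eval (fun _ : Fin n => P) i).ae hcos
    obtain ⟨ξ, hξ, hξ2⟩ := ((frequently_ae_mem_iff.2 hn.ne').and_eventually hae).exists
    rw [← (hξ : ∑ i, ξ i = latticePt z), exp_inner_sum]
    simp [hξ2]
  have hz0 : (latticePt (0 : Fin d → ℤ)) = 0 := by ext i; simp [latticePt]
  have hε1 : (ε : ℂ) = 1 := by
    have h1 := hpow 0
    rw [hz0, inner_zero_left, Complex.ofReal_zero, zero_mul, Complex.exp_zero] at h1
    obtain ⟨n, h2, h3⟩ := (h1.and ((tendsto_add_atTop_nat 1).eventually h1)).exists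
    rw [pow_succ, ← h2, one_mul] at h3
    exact h3.symm
  ext j
  obtain ⟨n, hn⟩ := (hpow (Pi.single j 1)).exists
  rw [hε1, one_pow] at hn
  have hin : (inner ℝ (latticePt (Pi.single j 1)) t : ℝ) = t j := by
    rw [inner_eq_dotProduct, dotProduct, Finset.sum_eq_single j]
    · simp [latticePt]
    · intro i _ hij
      simp [latticePt, hij]
    · simp
  rw [hin, Complex.exp_eq_one_iff] at hn
  obtain ⟨k, hk⟩ := hn
  have hk' : t j = k * (2 * Real.pi) := by
    have h1 := congrArg Complex.im hk
    simpa using h1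
  have hpi := Real.pi_pos
  obtain ⟨h1, h2⟩ := ht j
  rw [hk'] at h1 h2
  have hk1 : (k : ℝ) < 1 := by nlinarith
  have hk2 : (-1 : ℝ) < k := by nlinarith
  have hk0 : k = 0 := by
    have h3 : k < 1 := by exact_mod_cast hk1
    have h4 : -1 < k := by exact_mod_cast hk2
    omega
  rw [hk', hk0]
  simp

lemma exists_cube_bound (hs : P.map (fun x => -x) = P) {R : ℝ} (hR : ∀ᵐ x ∂P, ‖x‖ ≤ R)
    (hS : (covMat P).PosDef)
    (ha : ∀ z : Fin d → ℤ, ∀ᶠ n : ℕ in atTop,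
      0 < Measure.pi (fun _ : Fin n => P) {ξ | ∑ i, ξ i = latticePt z}) :
    ∃ c : ℝ, 0 < c ∧ ∀ t ∈ cube d, |cosTransform P t| ≤ Real.exp (-(c * ‖t‖ ^ 2)) := by
  obtain ⟨c₁, δ, hc₁, hδ, h1⟩ := exists_local_bound hs hR hS
  have hK : IsCompact (cube d \ Metric.ball 0 δ) := isCompact_cube.diff Metric.isOpen_ball
  obtain ⟨q, hq0, hq1, hq⟩ : ∃ q : ℝ, 0 ≤ q ∧ q < 1 ∧
      ∀ t ∈ cube d \ Metric.ball 0 δ, |cosTransform P t| ≤ q := by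
    rcases (cube d \ Metric.ball 0 δ).eq_empty_or_nonempty with he | hne
    · exact ⟨0, le_rfl, one_pos, by simp [he]⟩
    · obtain ⟨t, ht, hmax⟩ := hK.exists_isMaxOn hne (continuous_cosTransform hs).abs.continuousOn
      refine ⟨_, abs_nonneg _, abs_cosTransform_lt_one ha ht.1 ?_, fun s hs => hmax hs⟩
      rintro rfl
      exact ht.2 (Metric.mem_ball_self hδ)
  -- Away from `0`, compactness gives `|φ| ≤ q < 1`. As `‖t‖² ≤ d π²` on the cube, `q ≤ exp (-(1 -
  -- q))` is a bound of the required form; the `+ 1` only keeps the denominator positive.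
  have hD : (0 : ℝ) < d * Real.pi ^ 2 + 1 := by positivity
  refine ⟨min c₁ ((1 - q) / (d * Real.pi ^ 2 + 1)), lt_min hc₁ (div_pos (by linarith) hD),
    fun t ht => ?_⟩
  by_cases htδ : ‖t‖ ≤ δ
  · refine (h1 t htδ).trans (Real.exp_le_exp.2 (neg_le_neg ?_))
    exact mul_le_mul_of_nonneg_right (min_le_left _ _) (sq_nonneg _)
  · have h2 := hq t ⟨ht, by simp; linarith [not_le.1 htδ]⟩
    have h3 : min c₁ ((1 - q) / (d * Real.pi ^ 2 + 1)) * ‖t‖ ^ 2 ≤ 1 - q := by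
      calc _ ≤ (1 - q) / (d * Real.pi ^ 2 + 1) * (d * Real.pi ^ 2 + 1) :=
            mul_le_mul (min_le_right _ _) ((norm_sq_le_of_mem_cube ht).trans (by linarith))
              (sq_nonneg _) (div_pos (by linarith) hD).le
        _ = 1 - q := div_mul_cancel₀ _ hD.ne'
    have h4 := Real.add_one_le_exp (-(min c₁ ((1 - q) / (d * Real.pi ^ 2 + 1)) * ‖t‖ ^ 2))
    linarith

/-- It suffices that `n (φ(u/√n) - 1)` tends to `-⟨u, Σu⟩/2`. Bounded steps make the fourth-order
remainder of the cosine uniform, with total error at most `(R‖u‖)^4 / n`. -/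
lemma tendsto_cosTransform_pow (hs : P.map (fun x => -x) = P) {R : ℝ} (hR : ∀ᵐ x ∂P, ‖x‖ ≤ R)
    (u : E d) :
    Tendsto (fun n : ℕ => cosTransform P ((Real.sqrt n)⁻¹ • u) ^ n) atTop
      (𝓝 (Real.exp (-quad (covMat P) u / 2))) := by
  have h : Tendsto (fun n : ℕ => (n : ℝ) * (cosTransform P ((Real.sqrt n)⁻¹ • u) - 1)) atTop
      (𝓝 (-quad (covMat P) u / 2)) := by
    have hsq : Tendsto (fun n : ℕ => (Real.sqrt n)⁻¹) atTop (𝓝 0) :=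
      (Real.tendsto_sqrt_atTop.comp tendsto_natCast_atTop_atTop).inv_tendsto_atTop
    have hsm : ∀ᶠ n : ℕ in atTop, (Real.sqrt n)⁻¹ * (R * ‖u‖) ≤ 1 := by
      have := hsq.mul_const (R * ‖u‖)
      rw [zero_mul] at this
      exact this.eventually (ge_mem_nhds one_pos)
    rw [tendsto_iff_norm_sub_tendsto_zero]
    refine squeeze_zero' (.of_forall fun n => norm_nonneg _) ?_
      (tendsto_const_div_atTop_nhds_zero_nat ((R * ‖u‖) ^ 4))
    filter_upwards [hsm, eventually_gt_atTop 0] with n hn hn0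
    have hn' : (0 : ℝ) < n := by exact_mod_cast hn0
    set s := (Real.sqrt n)⁻¹ with hsdef
    have hs0 : 0 < s := by positivity
    have hns : (n : ℝ) * s ^ 2 = 1 := by
      rw [hsdef, inv_pow, Real.sq_sqrt hn'.le, mul_inv_cancel₀ hn'.ne']
    have hi : Integrable (fun x : E d => (inner ℝ x u : ℝ) ^ 2) P :=
      integrable_of_ae_bound hR (by fun_prop)
    have e1 : (n : ℝ) * (cosTransform P (s • u) - 1) - -quad (covMat P) u / 2 =
        ∫ x, ((n : ℝ) * (Real.cos (inner ℝ x (s • u)) - 1) + (inner ℝ x u : ℝ) ^ 2 / 2) ∂P := by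
      have hi2 : Integrable (fun x => (n : ℝ) * (Real.cos (inner ℝ x (s • u)) - 1)) P :=
        ((integrable_cos _).sub (integrable_const _)).const_mul _
      rw [integral_add hi2 (hi.div_const 2), integral_const_mul, integral_sub (integrable_cos _) (integrable_const _),
        integral_const, probReal_univ, one_smul, integral_div, ← quad_covMat hs hR, cosTransform]
      ring
    rw [e1]
    have h2 := norm_integral_le_of_norm_le_const (μ := P) (C := (R * ‖u‖) ^ 4 / n)
      (f := fun x => (n : ℝ) * (Real.cos (inner ℝ x (s • u)) - 1) + (inner ℝ x u : ℝ) ^ 2 / 2) ?_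
    · rwa [probReal_univ, mul_one] at h2
    filter_upwards [hR] with x hx
    set w : ℝ := inner ℝ x u with hw
    have hwb : |w| ≤ R * ‖u‖ := (abs_real_inner_le_norm x u).trans
      (mul_le_mul_of_nonneg_right hx (norm_nonneg _))
    have hsw : |s * w| ≤ 1 := by
      rw [abs_mul, abs_of_pos hs0]
      exact (mul_le_mul_of_nonneg_left hwb hs0.le).trans hn
    have hb := Real.cos_bound hsw
    rw [inner_smul_right]
    have e2 : (n : ℝ) * (Real.cos (s * w) - 1) + w ^ 2 / 2 =
        n * (Real.cos (s * w) - (1 - (s * w) ^ 2 / 2)) := by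
      linear_combination (-(w ^ 2) / 2) * hns
    rw [e2, Real.norm_eq_abs, abs_mul, abs_of_pos hn', le_div_iff₀ hn']
    have h3 : (n : ℝ) * |Real.cos (s * w) - (1 - (s * w) ^ 2 / 2)| * n ≤
        n * (|s * w| ^ 4 * (5 / 96)) * n := by gcongr
    have e3 : (n : ℝ) * (|s * w| ^ 4 * (5 / 96)) * n = |w| ^ 4 * (5 / 96) := by
      rw [abs_mul, abs_of_pos hs0, mul_pow]
      linear_combination (|w| ^ 4 * (5 / 96) * ((n : ℝ) * s ^ 2 + 1)) * hns
    have h4 : |w| ^ 4 ≤ (R * ‖u‖) ^ 4 := pow_le_pow_left₀ (abs_nonneg _) hwb 4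
    have h5 : 0 ≤ |w| ^ 4 := by positivity
    linarith
  have h2 := Real.tendsto_one_add_pow_exp_of_tendsto h
  simpa using h2

end LatticeCharFun

/-! ### The local limit theorem on the lattice -/

section Lattice

variable {d : ℕ} {P : Measure (E d)} [IsProbabilityMeasure P]

/-- The counting measure of `ℤ^d` in `ℝ^d`. -/
noncomputable def latticeMeasure (d : ℕ) : Measure (E d) :=
  (Measure.count : Measure (Fin d → ℤ)).map latticePt

instance : SFinite (latticeMeasure d) := by
  unfold latticeMeasure
  infer_instance

lemma measurableEmbedding_latticePt : MeasurableEmbedding (latticePt (d := d)) :=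
  (measurable_of_countable _).measurableEmbedding latticePt_injective

lemma ae_latticeMeasure : ∀ᵐ y ∂latticeMeasure d, y ∈ Set.range (latticePt (d := d)) := by
  rw [latticeMeasure, measurableEmbedding_latticePt.ae_map_iff]
  exact .of_forall fun z => ⟨z, rfl⟩

lemma finite_latticePt_closedBall (c : E d) (r : ℝ) :
    (latticePt ⁻¹' Metric.closedBall c r).Finite := by
  refine (Set.finite_Icc (fun i => ⌊c i - r⌋) (fun i => ⌈c i + r⌉)).subset fun z hz => ?_
  have h : ∀ i, |(z i : ℝ) - c i| ≤ r := fun i =>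
    (PiLp.norm_apply_le (latticePt z - c) i).trans (mem_closedBall_iff_norm.1 hz)
  refine ⟨fun i => ?_, fun i => ?_⟩
  · have h1 := (abs_le.1 (h i)).1
    have h2 := Int.floor_le (c i - r)
    have h3 : ((⌊c i - r⌋ : ℤ) : ℝ) ≤ z i := by linarith
    exact_mod_cast h3
  · have h1 := (abs_le.1 (h i)).2
    have h2 := Int.le_ceil (c i + r)
    have h3 : (z i : ℝ) ≤ ((⌈c i + r⌉ : ℤ) : ℝ) := by linarith
    exact_mod_cast h3

lemma latticeMeasure_closedBall_ne_top (c : E d) (r : ℝ) :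
    latticeMeasure d (Metric.closedBall c r) ≠ ∞ := by
  rw [latticeMeasure, measurableEmbedding_latticePt.map_apply]
  exact (Measure.count_apply_lt_top.2 (finite_latticePt_closedBall c r)).ne

lemma latticeMeasure_closedBall_ne_zero {c : E d} {r : ℝ}
    (h : ∃ z : Fin d → ℤ, latticePt z ∈ Metric.closedBall c r) :
    latticeMeasure d (Metric.closedBall c r) ≠ 0 := by
  rw [latticeMeasure, measurableEmbedding_latticePt.map_apply]
  exact Measure.count_ne_zero_iff.2 h

lemma setIntegral_latticeMeasure (F : E d → ℂ) (c : E d) (r : ℝ) :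
    ∫ y in Metric.closedBall c r, F y ∂latticeMeasure d =
      ∑ᶠ (z : Fin d → ℤ) (_ : latticePt z ∈ Metric.closedBall c r), F (latticePt z) := by
  have hfin := finite_latticePt_closedBall c r
  rw [latticeMeasure, measurableEmbedding_latticePt.setIntegral_map]
  have h1 := finsum_mem_eq_finite_toFinset_sum (fun z => F (latticePt z)) hfin
  simp only [Set.mem_preimage] at h1
  have h2 := setIntegral_finset (μ := Measure.count) (f := fun z => F (latticePt z)) hfin.toFinset
    ((integrable_indicator_iff (Finset.measurableSet _)).1 (integrable_count_iff.2
      (summable_of_ne_finset_zero (s := hfin.toFinset) fun z hz => by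
        rw [Set.indicator_of_notMem (by simpa using hz), norm_zero])))
  rw [hfin.coe_toFinset] at h2
  rw [h1, h2]
  simp

lemma map_latticeMeasure (w : Fin d → ℤ) :
    (latticeMeasure d).map (· + latticePt w) = latticeMeasure d := by
  have h1 : (fun y : E d => y + latticePt w) ∘ latticePt = latticePt ∘ fun z => z + w := by
    funext z
    simp [latticePt_add]
  rw [latticeMeasure, Measure.map_map (by fun_prop) (measurable_of_countable _), h1,
    ← Measure.map_map (measurable_of_countable _) (measurable_of_countable _),
    map_add_right_eq_self]

lemma ae_walk_lattice (hl : ∀ᵐ x ∂P, x ∈ Set.range (latticePt (d := d))) (n : ℕ) :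
    ∀ᵐ x ∂walk P n, x ∈ Set.range (latticePt (d := d)) := by
  induction n with
  | zero =>
    have hz0 : (latticePt (0 : Fin d → ℤ)) = 0 := by ext i; simp [latticePt]
    rw [walk, ae_dirac_eq]
    exact ⟨0, hz0⟩
  | succ n ih =>
    have hm : MeasurableSet (Set.range (latticePt (d := d))) :=
      measurableEmbedding_latticePt.measurableSet_range
    rw [walk, Measure.conv]
    refine (ae_map_iff (measurable_fst.add measurable_snd).aemeasurable hm).2 ?_
    filter_upwards [Measure.quasiMeasurePreserving_fst.ae hl,
      Measure.quasiMeasurePreserving_snd.ae ih] with p h1 h2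
    obtain ⟨z, hz⟩ := h1
    obtain ⟨w, hw⟩ := h2
    exact ⟨z + w, by rw [latticePt_add, hz, hw]; rfl⟩

/-- With respect to the counting measure of the lattice, the point masses play the role of the
density required by `localLimit_of_density`. -/
lemma avg_walk_lattice (hl : ∀ᵐ x ∂P, x ∈ Set.range (latticePt (d := d))) {V : E d → ℂ}
    (hV : Integrable V (latticeMeasure d)) (n : ℕ) {x : E d}
    (hx : x ∈ Set.range (latticePt (d := d))) :
    avg (walk P n) V x = ∫ y, V y * ((walk P n).real {y - x} : ℂ) ∂latticeMeasure d := by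
  have he := measurableEmbedding_latticePt (d := d)
  obtain ⟨w, rfl⟩ := hx
  set ν := (walk P n).comap latticePt with hν
  have hwalk : walk P n = ν.map latticePt := by
    rw [hν, he.map_comap, Measure.restrict_eq_self_of_ae_mem (ae_walk_lattice hl n)]
  have hνr : ∀ z, ν.real {z} = (walk P n).real {latticePt z} := fun z => by
    rw [measureReal_def, hν, he.comap_apply, Set.image_singleton, measureReal_def]
  have : IsProbabilityMeasure ν := ⟨by
    have h1 : (walk P n) Set.univ = 1 := measure_univ
    rwa [hwalk, he.map_apply, Set.preimage_univ] at h1⟩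
  have hVs : Summable fun z => ‖V (latticePt z)‖ := by
    rw [latticeMeasure, he.integrable_map_iff] at hV
    exact integrable_count_iff.1 hV
  have hVb : ∀ z, ‖V (latticePt z)‖ ≤ ∑' z, ‖V (latticePt z)‖ := fun z =>
    hVs.le_tsum z fun _ _ => norm_nonneg _
  have hi1 : Integrable (fun z => V (latticePt w + latticePt z)) ν := by
    refine Integrable.of_bound (measurable_of_countable _).aestronglyMeasurable
      (∑' z, ‖V (latticePt z)‖) (.of_forall fun z => ?_)
    rw [← latticePt_add]
    exact hVb _
  have hi2 : Integrable (fun z => V (latticePt z) *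
      ((walk P n).real {latticePt z - latticePt w} : ℂ)) Measure.count := by
    rw [integrable_count_iff]
    refine Summable.of_nonneg_of_le (fun _ => norm_nonneg _) (fun z => ?_) hVs
    rw [norm_mul, Complex.norm_real, Real.norm_of_nonneg measureReal_nonneg]
    exact mul_le_of_le_one_right (norm_nonneg _) measureReal_le_one
  rw [avg, latticeMeasure, he.integral_map, integral_countable hi2]
  conv_lhs => rw [hwalk]
  rw [he.integral_map, integral_countable hi1,
    ← (Equiv.addLeft w).tsum_eq (fun z => Measure.count.real {z} • (V (latticePt z) *
      ((walk P n).real {latticePt z - latticePt w} : ℂ)))]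
  refine tsum_congr fun z => ?_
  rw [Equiv.coe_addLeft, hνr, latticePt_add, add_sub_cancel_left, measureReal_def Measure.count,
    Measure.count_singleton, Complex.real_smul]
  simp [mul_comm]

lemma integral_exp_int (k : ℤ) :
    ∫ v : ℝ, (Set.Icc (-Real.pi) Real.pi).indicator (1 : ℝ → ℂ) v *
      Complex.exp (-((k * v : ℝ) : ℂ) * Complex.I) = if k = 0 then (2 * Real.pi : ℂ) else 0 := by
  have hpi := Real.pi_pos
  have h1 : ∀ v : ℝ, (Set.Icc (-Real.pi) Real.pi).indicator (1 : ℝ → ℂ) v *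
      Complex.exp (-((k * v : ℝ) : ℂ) * Complex.I) = (Set.Icc (-Real.pi) Real.pi).indicator
        (fun v : ℝ => Complex.exp ((-(k : ℂ) * Complex.I) * v)) v := by
    intro v
    by_cases hv : v ∈ Set.Icc (-Real.pi) Real.pi
    · rw [Set.indicator_of_mem hv, Set.indicator_of_mem hv, Pi.one_apply, one_mul]
      congr 1
      push_cast
      ring
    · rw [Set.indicator_of_notMem hv, Set.indicator_of_notMem hv, zero_mul]
  simp_rw [h1]
  rw [integral_indicator measurableSet_Icc, integral_Icc_eq_integral_Ioc,
    ← intervalIntegral.integral_of_le (by linarith)]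
  split_ifs with hk
  · subst hk
    simp
    ring
  · have hk' : -(k : ℂ) * Complex.I ≠ 0 := by simp [hk]
    rw [integral_exp_mul_complex hk', div_eq_zero_iff]
    left
    rw [sub_eq_zero, Complex.exp_eq_exp_iff_exists_int]
    refine ⟨-k, ?_⟩
    push_cast
    ring

/-- Orthogonality of the characters on `[-π, π]^d`, one coordinate at a time. -/
lemma cfDensity_cube (k : Fin d → ℤ) :
    cfDensity ((cube d).indicator 1) (latticePt k) = if k = 0 then 1 else 0 := by
  have hpi := Real.pi_pos
  have h1 : ∫ t, (cube d).indicator (1 : E d → ℂ) t *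
      Complex.exp (-(inner ℝ (latticePt k) t : ℝ) * Complex.I) = ∏ i, ∫ v : ℝ,
        (Set.Icc (-Real.pi) Real.pi).indicator (1 : ℝ → ℂ) v *
          Complex.exp (-((k i * v : ℝ) : ℂ) * Complex.I) := by
    rw [← integral_fintype_prod_volume_eq_prod (𝕜 := ℂ) (E := fun _ : Fin d => ℝ)
      (fun i (v : ℝ) => (Set.Icc (-Real.pi) Real.pi).indicator (1 : ℝ → ℂ) v *
          Complex.exp (-((k i * v : ℝ) : ℂ) * Complex.I)),
      ← (PiLp.volume_preserving_ofLp (Fin d)).integral_comp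
        (MeasurableEquiv.toLp 2 (Fin d → ℝ)).symm.measurableEmbedding]
    refine integral_congr_ae (.of_forall fun t => ?_)
    simp only
    rw [Finset.prod_mul_distrib, ← Complex.exp_sum, inner_eq_dotProduct, dotProduct]
    congr 1
    · by_cases ht : t ∈ cube d
      · rw [Set.indicator_of_mem ht]
        exact (Finset.prod_eq_one fun i _ => by rw [Set.indicator_of_mem (ht i)]; rfl).symm
      · rw [Set.indicator_of_notMem ht]
        obtain ⟨i, hi⟩ := not_forall.1 ht
        exact (Finset.prod_eq_zero (Finset.mem_univ i) (Set.indicator_of_notMem hi _)).symm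
    · congr 1
      push_cast
      rw [← Finset.sum_neg_distrib, Finset.sum_mul]
      rfl
  rw [cfDensity, h1]
  simp_rw [integral_exp_int]
  split_ifs with hk
  · subst hk
    simp only [Pi.zero_apply, if_true, Finset.prod_const, Finset.card_univ, Fintype.card_fin]
    push_cast
    exact inv_mul_cancel₀ (pow_ne_zero _ (by simp [hpi.ne']))
  · obtain ⟨i, hi⟩ := Function.ne_iff.1 hk
    rw [Finset.prod_eq_zero (Finset.mem_univ i) (if_neg hi), mul_zero]

lemma integrable_indicator_cube : Integrable ((cube d).indicator (1 : E d → ℂ)) :=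
  (integrable_indicator_iff isClosed_cube.measurableSet).2
    (integrableOn_const isCompact_cube.measure_lt_top.ne)

/-- The inversion formula for lattice laws. -/
lemma walk_singleton (hl : ∀ᵐ x ∂P, x ∈ Set.range (latticePt (d := d))) (n : ℕ) {x : E d}
    (hx : x ∈ Set.range (latticePt (d := d))) :
    ((walk P n).real {x} : ℂ) =
      cfDensity (fun t => (cube d).indicator 1 t * charFun P t ^ n) x := by
  obtain ⟨z, rfl⟩ := hx
  simp_rw [← charFun_walk]
  -- The kernel obtained from the cube is a Kronecker delta on the lattice, so its mean under the
  -- walk is the mass of the point.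
  rw [cfDensity_mul_charFun integrable_indicator_cube,
    ← integral_indicator_one (measurableSet_singleton (latticePt z)), ← integral_complex_ofReal]
  refine integral_congr_ae ?_
  filter_upwards [ae_walk_lattice hl n] with y hy
  obtain ⟨w, rfl⟩ := hy
  rw [← latticePt_sub, cfDensity_cube]
  by_cases h : z = w
  · simp [h]
  · rw [if_neg (sub_ne_zero.2 h), Set.indicator_of_notMem, Complex.ofReal_zero]
    exact fun h' => h (latticePt_injective h').symm

lemma norm_cfDensity_sub_le {φ ψ : E d → ℂ} (hφ : Integrable φ) (hψ : Integrable ψ) (x : E d) :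
    ‖cfDensity φ x - cfDensity ψ x‖ ≤ ((2 * Real.pi) ^ d)⁻¹ * ∫ y, ‖φ y - ψ y‖ := by
  have h : cfDensity φ x - cfDensity ψ x = cfDensity (fun y => φ y - ψ y) x := by
    rw [cfDensity, cfDensity, cfDensity, ← mul_sub,
      ← integral_sub (integrable_mul_phase hφ x) (integrable_mul_phase hψ x)]
    simp only [sub_mul]
  rw [h]
  exact norm_cfDensity_le x

/-- The rescaled characteristic function of the `n`-step walk. -/
noncomputable def scaledCharFun (P : Measure (E d)) (n : ℕ) (u : E d) : ℂ :=
  (cube d).indicator 1 ((Real.sqrt n)⁻¹ • u) * (cosTransform P ((Real.sqrt n)⁻¹ • u) : ℂ) ^ n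

lemma measurable_scaledCharFun (hs : P.map (fun x => -x) = P) (n : ℕ) :
    Measurable (scaledCharFun P n) := by
  have h1 : Measurable ((cube d).indicator (1 : E d → ℂ)) :=
    measurable_one.indicator isClosed_cube.measurableSet
  have h2 : Continuous fun t : E d => (cosTransform P t : ℂ) :=
    Complex.continuous_ofReal.comp (continuous_cosTransform hs)
  exact (h1.comp (measurable_const_smul _)).mul
    ((h2.measurable.comp (measurable_const_smul _)).pow_const n)

lemma rpow_mul_walk_singleton (hs : P.map (fun x => -x) = P)
    (hl : ∀ᵐ x ∂P, x ∈ Set.range (latticePt (d := d))) {n : ℕ} (hn : 0 < n) {x : E d}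
    (hx : x ∈ Set.range (latticePt (d := d))) :
    (((n : ℝ) ^ ((d : ℝ) / 2) * (walk P n).real {x} : ℝ) : ℂ) =
      cfDensity (scaledCharFun P n) ((Real.sqrt n)⁻¹ • x) := by
  have hn' : (0 : ℝ) < n := by exact_mod_cast hn
  have hs0 : 0 < (Real.sqrt n)⁻¹ := by positivity
  have h := cfDensity_comp_smul
    (φ := fun t => (cube d).indicator 1 t * (cosTransform P t : ℂ) ^ n) hs0 ((Real.sqrt n)⁻¹ • x)
  rw [smul_smul, inv_mul_cancel₀ hs0.ne', one_smul] at h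
  have e : (((Real.sqrt n)⁻¹ ^ d)⁻¹ : ℝ) = (n : ℝ) ^ ((d : ℝ) / 2) := by
    rw [inv_pow, inv_inv, Real.sqrt_eq_rpow, ← Real.rpow_natCast, ← Real.rpow_mul hn'.le]
    congr 1
    ring
  rw [e] at h
  rw [Complex.ofReal_mul, walk_singleton hl n hx]
  simp_rw [charFun_eq_cosTransform hs]
  exact h.symm

section Bound

/-! ### Consequences of the Gaussian bound on the cube. -/

variable {c : ℝ}

lemma norm_scaledCharFun_le
    (hb : ∀ t ∈ cube d, |cosTransform P t| ≤ Real.exp (-(c * ‖t‖ ^ 2))) {n : ℕ} (hn : 0 < n)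
    (u : E d) : ‖scaledCharFun P n u‖ ≤ Real.exp (-(c * ‖u‖ ^ 2)) := by
  have hn' : (0 : ℝ) < n := by exact_mod_cast hn
  rw [scaledCharFun]
  by_cases hu : (Real.sqrt n)⁻¹ • u ∈ cube d
  · rw [Set.indicator_of_mem hu, Pi.one_apply, one_mul, norm_pow, Complex.norm_real,
      Real.norm_eq_abs]
    refine (pow_le_pow_left₀ (abs_nonneg _) (hb _ hu) n).trans_eq ?_
    rw [← Real.exp_nat_mul, norm_smul, mul_pow, norm_inv, Real.norm_of_nonneg (Real.sqrt_nonneg _),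
      inv_pow, Real.sq_sqrt hn'.le]
    congr 1
    field_simp
  · rw [Set.indicator_of_notMem hu, zero_mul, norm_zero]
    positivity

lemma integrable_exp_neg_sq {c : ℝ} (hc : 0 < c) :
    Integrable fun u : E d => Real.exp (-(c * ‖u‖ ^ 2)) := by
  have h := (integrable_gaussian (d := d) (inv_pos.2 hc)).norm
  refine h.congr (.of_forall fun u => ?_)
  have e : -((c⁻¹ : ℝ) : ℂ)⁻¹ * ‖u‖ ^ 2 = ((-(c * ‖u‖ ^ 2) : ℝ) : ℂ) := by
    push_cast
    rw [inv_inv, neg_mul]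
  simp only [e]
  rw [← Complex.ofReal_exp, Complex.norm_real, Real.norm_of_nonneg (Real.exp_pos _).le]

lemma integrable_scaledCharFun (hs : P.map (fun x => -x) = P) (hc : 0 < c)
    (hb : ∀ t ∈ cube d, |cosTransform P t| ≤ Real.exp (-(c * ‖t‖ ^ 2))) {n : ℕ} (hn : 0 < n) :
    Integrable (scaledCharFun P n) :=
  (integrable_exp_neg_sq hc).mono' (measurable_scaledCharFun hs n).aestronglyMeasurable
    (.of_forall (norm_scaledCharFun_le hb hn))

lemma tendsto_scaledCharFun (hs : P.map (fun x => -x) = P) {R : ℝ} (hR : ∀ᵐ x ∂P, ‖x‖ ≤ R)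
    (u : E d) : Tendsto (fun n => scaledCharFun P n u) atTop
      (𝓝 ((Real.exp (-quad (covMat P) u / 2) : ℝ) : ℂ)) := by
  have h1 := (Complex.continuous_ofReal.tendsto _).comp (tendsto_cosTransform_pow hs hR u)
  refine h1.congr' ?_
  have hsq : Tendsto (fun n : ℕ => (Real.sqrt n)⁻¹ * ‖u‖) atTop (𝓝 (0 * ‖u‖)) :=
    ((Real.tendsto_sqrt_atTop.comp tendsto_natCast_atTop_atTop).inv_tendsto_atTop).mul_const _
  rw [zero_mul] at hsq
  filter_upwards [hsq.eventually (ge_mem_nhds Real.pi_pos)] with n hn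
  have hu : (Real.sqrt n)⁻¹ • u ∈ cube d := by
    intro i
    refine abs_le.1 ?_
    refine (PiLp.norm_apply_le ((Real.sqrt n)⁻¹ • u) i).trans ?_
    rwa [norm_smul, norm_inv, Real.norm_of_nonneg (Real.sqrt_nonneg _)]
  rw [scaledCharFun, Set.indicator_of_mem hu]
  simp

lemma exists_walk_singleton_le (hs : P.map (fun x => -x) = P)
    (hl : ∀ᵐ x ∂P, x ∈ Set.range (latticePt (d := d))) (hc : 0 < c)
    (hb : ∀ t ∈ cube d, |cosTransform P t| ≤ Real.exp (-(c * ‖t‖ ^ 2))) :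
    ∃ C : ℝ, ∀ n : ℕ, 0 < n → ∀ x ∈ Set.range (latticePt (d := d)),
      (walk P n).real {x} ≤ C * (n : ℝ) ^ (-((d : ℝ) / 2)) := by
  have hpi := Real.pi_pos
  refine ⟨((2 * Real.pi) ^ d)⁻¹ * ∫ u : E d, Real.exp (-(c * ‖u‖ ^ 2)), fun n hn x hx => ?_⟩
  have hn' : (0 : ℝ) < n := by exact_mod_cast hn
  have h1 := congrArg norm (rpow_mul_walk_singleton hs hl hn hx)
  rw [Complex.norm_real, Real.norm_of_nonneg (by positivity)] at h1
  rw [Real.rpow_neg hn'.le, ← div_eq_mul_inv, le_div_iff₀ (by positivity), mul_comm, h1]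
  refine (norm_cfDensity_le _).trans (mul_le_mul_of_nonneg_left ?_ (by positivity))
  exact integral_mono (integrable_scaledCharFun hs hc hb hn).norm (integrable_exp_neg_sq hc)
    (norm_scaledCharFun_le hb hn)

/-- The supremum over `x` is at most a constant times the `L¹` distance between the rescaled
transform and its Gaussian limit. This distance tends to `0` by dominated convergence, the cube
bound being the majorant. -/
lemma uniform_walk_singleton (hs : P.map (fun x => -x) = P)
    (hl : ∀ᵐ x ∂P, x ∈ Set.range (latticePt (d := d))) {R : ℝ} (hR : ∀ᵐ x ∂P, ‖x‖ ≤ R)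
    (hS : (covMat P).PosDef) (hc : 0 < c)
    (hb : ∀ t ∈ cube d, |cosTransform P t| ≤ Real.exp (-(c * ‖t‖ ^ 2))) {ε : ℝ} (hε : 0 < ε) :
    ∀ᶠ n : ℕ in atTop, ∀ x ∈ Set.range (latticePt (d := d)),
      |(n : ℝ) ^ ((d : ℝ) / 2) * (walk P n).real {x} -
        gaussDensity (covMat P) (((n : ℝ) ^ (1 / 2 : ℝ))⁻¹ • x)| ≤ ε := by
  set g : E d → ℂ := fun u => ((Real.exp (-quad (covMat P) u / 2) : ℝ) : ℂ) with hg
  have hgi : Integrable g := integrable_exp_neg_quad hS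
  have hlim : Tendsto (fun n => ((2 * Real.pi) ^ d)⁻¹ * ∫ u, ‖scaledCharFun P n u - g u‖) atTop
      (𝓝 (((2 * Real.pi) ^ d)⁻¹ * ∫ _ : E d, (0 : ℝ))) := by
    refine Tendsto.const_mul _ (tendsto_integral_filter_of_dominated_convergence
      (fun u => Real.exp (-(c * ‖u‖ ^ 2)) + ‖g u‖) ?_ ?_
      ((integrable_exp_neg_sq hc).add hgi.norm) (.of_forall fun u => ?_))
    · exact .of_forall fun n =>
        ((measurable_scaledCharFun hs n).aestronglyMeasurable.sub hgi.aestronglyMeasurable).norm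
    · filter_upwards [eventually_gt_atTop 0] with n hn
      refine .of_forall fun u => ?_
      rw [norm_norm]
      exact (norm_sub_le _ _).trans (add_le_add_left (norm_scaledCharFun_le hb hn u) _)
    · have h1 := ((tendsto_scaledCharFun hs hR u).sub_const (g u)).norm
      rwa [sub_self, norm_zero] at h1
  rw [integral_zero, mul_zero] at hlim
  filter_upwards [hlim.eventually (ge_mem_nhds hε), eventually_gt_atTop 0] with n hn hn0 x hx
  rw [← Real.sqrt_eq_rpow, ← Real.norm_eq_abs, ← Complex.norm_real, Complex.ofReal_sub,
    rpow_mul_walk_singleton hs hl hn0 hx, ← cfDensity_exp_neg_quad hS]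
  exact (norm_cfDensity_sub_le (integrable_scaledCharFun hs hc hb hn0) hgi _).trans hn

end Bound

end Lattice

/-! ### The branching random walk with lattice motion -/

section LatticeMotion

variable {d : ℕ} {P : Measure (E d)} [IsProbabilityMeasure P] {μ : PMF ℕ}

lemma exists_hit_le_of_singleton (hl : ∀ᵐ x ∂P, x ∈ Set.range (latticePt (d := d))) {θ : ℝ}
    (h : ∃ C : ℝ, ∀ n : ℕ, 0 < n → ∀ x ∈ Set.range (latticePt (d := d)),
      (walk P n).real {x} ≤ C * (n : ℝ) ^ (-θ)) (c : E d) (r : ℝ) :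
    ∃ C : ℝ, ∀ (n : ℕ) x, hit P (Metric.closedBall c r) (n + 1) x ≤ C * ((n : ℝ) + 1) ^ (-θ) := by
  obtain ⟨C, hC⟩ := h
  -- Two lattice points in a ball of radius `r` differ by a lattice vector of norm at most `2r`.
  -- This bounds their number uniformly over all real centres.
  have hfin := finite_latticePt_closedBall (0 : E d) (2 * r)
  refine ⟨hfin.toFinset.card * C, fun n x => ?_⟩
  have hC' := hC (n + 1) n.succ_pos
  rw [Nat.cast_succ] at hC'
  have hb0 : 0 ≤ C * ((n : ℝ) + 1) ^ (-θ) :=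
    measureReal_nonneg.trans (hC' _ ⟨0, rfl⟩)
  rw [hit_eq Metric.isClosed_closedBall.measurableSet, mul_assoc]
  set s := {z | x + z ∈ Metric.closedBall c r} with hs
  have hcongr : (walk P (n + 1)).real s =
      (walk P (n + 1)).real (s ∩ Set.range (latticePt (d := d))) := by
    refine measureReal_congr ?_
    filter_upwards [ae_walk_lattice hl (n + 1)] with z hz
    exact propext ⟨fun h => ⟨h, hz⟩, fun h => h.1⟩
  rw [hcongr]
  rcases (s ∩ Set.range (latticePt (d := d))).eq_empty_or_nonempty with he | ⟨_, hz, z₀, rfl⟩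
  · rw [he, measureReal_empty]
    positivity
  · have hsub : s ∩ Set.range (latticePt (d := d)) ⊆
        ⋃ w ∈ hfin.toFinset, {latticePt (z₀ + w)} := by
      rintro _ ⟨hy, z, rfl⟩
      simp only [Set.mem_iUnion, Set.mem_singleton_iff, Set.Finite.mem_toFinset, Set.mem_preimage]
      refine ⟨z - z₀, ?_, by rw [add_sub_cancel]⟩
      rw [latticePt_sub, mem_closedBall_zero_iff]
      have h1 : ‖x + latticePt z - c‖ ≤ r := mem_closedBall_iff_norm.1 hy
      have h2 : ‖x + latticePt z₀ - c‖ ≤ r := mem_closedBall_iff_norm.1 hz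
      have h3 := norm_sub_le (x + latticePt z - c) (x + latticePt z₀ - c)
      have e : x + latticePt z - c - (x + latticePt z₀ - c) = latticePt z - latticePt z₀ := by abel
      rw [e] at h3
      linarith
    calc (walk P (n + 1)).real (s ∩ Set.range (latticePt (d := d)))
        ≤ (walk P (n + 1)).real (⋃ w ∈ hfin.toFinset, {latticePt (z₀ + w)}) :=
          measureReal_mono hsub (measure_ne_top _ _)
      _ ≤ ∑ w ∈ hfin.toFinset, (walk P (n + 1)).real {latticePt (z₀ + w)} :=
          measureReal_biUnion_finset_le _ _
      _ ≤ ∑ _w ∈ hfin.toFinset, C * ((n : ℝ) + 1) ^ (-θ) :=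
          Finset.sum_le_sum fun w _ => hC' _ ⟨_, rfl⟩
      _ = _ := by rw [Finset.sum_const, nsmul_eq_mul]

lemma measurable_measureReal_singleton (ν : Measure (E d)) [IsProbabilityMeasure ν] :
    Measurable fun x => ν.real {x} := by
  have h : MeasurableSet {p : E d × E d | p.2 = p.1} :=
    measurableSet_eq_fun measurable_snd measurable_fst
  exact (measurable_measure_prodMk_left (ν := ν) h).ennreal_toReal

theorem asymp_of_lattice (hμ : Critical μ) (h : H2 μ P) {c : E d} {r : ℝ}
    (hA : ∃ z : Fin d → ℤ, latticePt z ∈ Metric.closedBall c r)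
    {f : E d → ℂ} (hf : Admissible (Metric.closedBall c r) f) {M : ℝ} (hM : 0 < M) :
    UniformAsymp (fun n => {x | ‖x‖ ≤ M * Real.sqrt n ∧ ∃ z : Fin d → ℤ, x = latticePt z})
      (keyExpectation μ P (Metric.closedBall c r) f) (gaussFactor (covMat P))
      (Ilattice μ hμ P (Metric.closedBall c r) f) ∧
    ((∀ y, (f y).im = 0) ∨ Ilattice μ hμ P (Metric.closedBall c r) f ≠ 0 →
      UniformEquiv (fun n => {x | ‖x‖ ≤ M * Real.sqrt n ∧ ∃ z : Fin d → ℤ, x = latticePt z})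
        (keyExpectation μ P (Metric.closedBall c r) f) (gaussFactor (covMat P))
        (Ilattice μ hμ P (Metric.closedBall c r) f)) := by
  obtain ⟨R, p, hP, hR⟩ := h.finiteRange
  have hs := map_neg_of_finiteRange hP hR
  have hl : ∀ᵐ x ∂P, x ∈ Set.range (latticePt (d := d)) :=
    ae_of_finiteRange hP fun z _ => ⟨z, rfl⟩
  have hb : ∀ᵐ x ∂P, ‖x‖ ≤ ∑ z ∈ R, ‖latticePt z‖ :=
    ae_of_finiteRange hP fun z hz =>
      Finset.single_le_sum (f := fun z => ‖latticePt z‖) (fun _ _ => norm_nonneg _) hz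
  obtain ⟨κ, hκ, hcube⟩ := exists_cube_bound hs hb h.posDef h.aperiodic
  have hz0 : (0 : E d) ∈ Set.range (latticePt (d := d)) := ⟨0, by ext i; simp [latticePt]⟩
  have hd : (3 : ℝ) ≤ d := by exact_mod_cast h.three_le
  have hLL : LocalLimit P (Metric.closedBall c r) (latticeMeasure d) ((d : ℝ) / 2)
      (fun n => {x | ‖x‖ ≤ M * (n : ℝ) ^ (1 / 2 : ℝ) ∧ x ∈ Set.range (latticePt (d := d))})
      (fun n x => gaussDensity (covMat P) (((n : ℝ) ^ (1 / 2 : ℝ))⁻¹ • x)) := by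
    -- Here `X` is the lattice, stable under differences, and `B` is the sup bound that the
    -- inversion formula gives for the Gaussian density.
    refine localLimit_of_density (p := fun n x => (walk P n).real {x})
      (B := ((2 * Real.pi) ^ d)⁻¹ * ∫ u : E d, ‖((Real.exp (-quad (covMat P) u / 2) : ℝ) : ℂ)‖)
      one_half_pos hM hz0 ?_
      ae_latticeMeasure ?_
      (exists_hit_le_of_singleton hl (exists_walk_singleton_le hs hl hκ hcube) c r)
      (continuous_gaussDensity _) (gaussDensity_pos h.posDef.det_pos) (fun x => ?_)
      (gaussDensity_neg _) (fun n => measurable_measureReal_singleton _)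
      (fun V _ hV n _ x hx => avg_walk_lattice hl hV n hx)
      fun ε hε => uniform_walk_singleton hs hl hb h.posDef hκ hcube hε
    · rintro _ ⟨z, rfl⟩ _ ⟨w, rfl⟩
      exact ⟨w - z, latticePt_sub w z⟩
    · filter_upwards [hl] with x hx
      obtain ⟨w, rfl⟩ := hx
      exact map_latticeMeasure w
    · have h1 := norm_cfDensity_le
        (φ := fun u => ((Real.exp (-quad (covMat P) u / 2) : ℝ) : ℂ)) x
      rw [cfDensity_exp_neg_quad h.posDef, Complex.norm_real] at h1
      exact (le_abs_self _).trans h1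
  refine hLL.uniformAsymp_and_uniformEquiv hμ Metric.isClosed_closedBall.measurableSet hf
    (latticeMeasure_closedBall_ne_top c r) (latticeMeasure_closedBall_ne_zero hA) one_pos le_rfl
    h.secondMoment.tsum_rpow_lt_top (by linarith) ?_
    (fun n hn x => gaussFactor_eq _ hn x) ?_
  · rintro n x ⟨hx, z, rfl⟩
    exact ⟨by rwa [← Real.sqrt_eq_rpow], z, rfl⟩
  · rw [setIntegral_latticeMeasure, Ilattice]

end LatticeMotion

end BRW

theorem mainTheorem4 {d : ℕ} (μ : PMF ℕ) (hμ : BRW.Critical μ)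
    (P : Measure (BRW.E d)) [IsProbabilityMeasure P] :
    -- Gaussian motion
    (BRW.H1 μ P →
      ∀ (c : BRW.E d) (r : ℝ), 0 < r →
      ∀ f : BRW.E d → ℂ, BRW.Admissible (Metric.closedBall c r) f →
      ∀ M : ℝ, 0 < M →
        BRW.UniformAsymp (fun n => {x | ‖x‖ ≤ M * Real.sqrt n})
          (BRW.keyExpectation μ P (Metric.closedBall c r) f)
          (BRW.gaussFactor 1)
          (BRW.Icont μ hμ P (Metric.closedBall c r) f) ∧
        ((∀ y, (f y).im = 0) ∨ BRW.Icont μ hμ P (Metric.closedBall c r) f ≠ 0 →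
          BRW.UniformEquiv (fun n => {x | ‖x‖ ≤ M * Real.sqrt n})
            (BRW.keyExpectation μ P (Metric.closedBall c r) f)
            (BRW.gaussFactor 1)
            (BRW.Icont μ hμ P (Metric.closedBall c r) f))) ∧
    -- lattice motion
    (BRW.H2 μ P →
      ∀ (c : BRW.E d) (r : ℝ), 0 < r →
      (∃ z : Fin d → ℤ, BRW.latticePt z ∈ Metric.closedBall c r) →
      ∀ f : BRW.E d → ℂ, BRW.Admissible (Metric.closedBall c r) f →
      ∀ M : ℝ, 0 < M →
        BRW.UniformAsymp
          (fun n => {x | ‖x‖ ≤ M * Real.sqrt n ∧ ∃ z : Fin d → ℤ, x = BRW.latticePt z})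
          (BRW.keyExpectation μ P (Metric.closedBall c r) f)
          (BRW.gaussFactor (BRW.covMat P))
          (BRW.Ilattice μ hμ P (Metric.closedBall c r) f) ∧
        ((∀ y, (f y).im = 0) ∨ BRW.Ilattice μ hμ P (Metric.closedBall c r) f ≠ 0 →
          BRW.UniformEquiv
            (fun n => {x | ‖x‖ ≤ M * Real.sqrt n ∧ ∃ z : Fin d → ℤ, x = BRW.latticePt z})
            (BRW.keyExpectation μ P (Metric.closedBall c r) f)
            (BRW.gaussFactor (BRW.covMat P))
            (BRW.Ilattice μ hμ P (Metric.closedBall c r) f))) ∧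
    -- stable motion; `L` is the continuous density of the motion law
    (∀ α : ℝ, BRW.H3 μ P α →
      ∃ L : BRW.E d → ℝ, Continuous L ∧ (∀ x, 0 ≤ L x) ∧
        P = volume.withDensity (fun x => ENNReal.ofReal (L x)) ∧
        ∀ (c : BRW.E d) (r : ℝ), 0 < r →
        ∀ f : BRW.E d → ℂ, BRW.Admissible (Metric.closedBall c r) f →
        ∀ M : ℝ, 0 < M →
          BRW.UniformAsymp (fun n => {x | ‖x‖ ≤ M * (n : ℝ) ^ (1 / α)})
            (BRW.keyExpectation μ P (Metric.closedBall c r) f)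
            (BRW.stableFactor α L)
            (BRW.Icont μ hμ P (Metric.closedBall c r) f) ∧
          ((∀ y, (f y).im = 0) ∨ BRW.Icont μ hμ P (Metric.closedBall c r) f ≠ 0 →
            BRW.UniformEquiv (fun n => {x | ‖x‖ ≤ M * (n : ℝ) ^ (1 / α)})
              (BRW.keyExpectation μ P (Metric.closedBall c r) f)
              (BRW.stableFactor α L)
              (BRW.Icont μ hμ P (Metric.closedBall c r) f))) := by
  exact ⟨fun h _ _ hr _ hf _ hM => BRW.asymp_of_gaussian hμ h hr hf hM,
    fun h _ _ _ hA _ hf _ hM => BRW.asymp_of_lattice hμ h hA hf hM,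
    fun _ h => BRW.asymp_of_stable hμ h⟩
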